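/- **Setting.** Let $M=N=\mathbf Z^n$, paired by the dot product. A lattice polytope is the convex hull of a finite non-empty set of lattice points; its polar dual is $P^\vee=\{w : \langle w,p\rangle\ge -1 \ \forall p\in P\}$, and $P$ is reflexive if $P$ and $P^\vee$ are lattice polytopes. A nef-partition is a family $\Delta_1,\dots,\Delta_r\subset M_{\mathbf R}$ of lattice polytopes, each containing $0$ and different from $\{0\}$, whose Minkowski sum is reflexive. Its Borisov dual is $\nabla_k=\{y\in N_{\mathbf R} : \langle x,y\rangle+\delta_{k'k}\ge 0 \text{ for all } k' \text{ and all } x\in\Delta_{k'}\}$. Let $\Delta^{(1)}$ and $\Delta^{(2)}$ be multiple mirror nef-partitions: there are $n_1,\dots,n_r\in N$ with $\sum_k n_k=0$ and $\nabla^{(2)}_k=\nabla^{(1)}_k+n_k$ for all $k$. Put $\overline M=M\oplus\bigoplus_k\mathbf Z e_k$. Embed $M$ in $\overline M$ by $\phi_1(m)=m$ and by $\phi_2(m)=m+\sum_k\langle m,n_k\rangle e_k$, and let $\Lambda^{(i)}_k=\{\phi_i(m)+e_k : m\in\Delta^{(i)}_k\cap M\}$ and $\Xi^{(i)}=\bigcup_k\Lambda^{(i)}_k$.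 Let $C$ be the torus over $\mathbf C$ with coordinates $c_\xi$, $\xi\in\Xi^{(1)}\cup\Xi^{(2)}$. Let $Y_-^{(i)}$ be the projective toric variety over $\mathbf C$ of the polytope $\sum_k\Delta^{(i)}_k$, and $\mathcal L^{(i)}_k$ the line bundle on it given by $\Delta^{(i)}_k$, whose global sections have the basis $\chi^m e_k$, $m\in\Delta^{(i)}_k\cap M$. Let $g^{(i)}$ be the universal section of $\bigoplus_k\mathcal L^{(i)}_k$ over $Y_-^{(i)}\times C$, with components $\sum_{m\in\Delta^{(i)}_k\cap M}c_{\phi_i(m)+e_k}\chi^m e_k$. Let $Z^{(i)}\subseteq Y_-^{(i)}\times C$ be its zero scheme, and $(Z^{(i)})_c$ the fibre of $Z^{(i)}\to C$ over $c\in C$. Let $T=T_-\times C$, where $T_-$ is the torus with character group $\overline M$. It projects to $Y_-^{(i)}\times C$ by $\phi_i$ on characters (onto the big torus times $C$). Let $(W)$ be the $r\times r$ matrix of functions on $T$ with $W_{ab}=\sum_{\xi\in\Lambda^{(1)}_a\cap\Lambda^{(2)}_b}c_\xi\chi^\xi$, and $\beta$ the number of connected components of the graph on $\{1,\dots,r\}$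 that joins $a\neq b$ when $\Lambda^{(1)}_a\cap\Lambda^{(2)}_b$ or $\Lambda^{(1)}_b\cap\Lambda^{(2)}_a$ is non-empty. Let $\Omega^{(i)}\subseteq Z^{(i)}$ be the image of the set of points of $T$ that lie over both $Z^{(1)}$ and $Z^{(2)}$ and at which $(W)$ has rank $r-\beta$. **Theorem.** In this situation $\Xi^{(1)}=\Xi^{(2)}$, so both universal sections involve all the coefficients. For $i=1,2$ the universal complete intersection $Z^{(i)}$ is irreducible, and $\Omega^{(i)}$ is an open dense subset of it. Moreover there is an open dense subset $U\subseteq C$ such that for every $c\in U$ the fibres $(Z^{(1)})_c$ and $(Z^{(2)})_c$ are birational over the residue field of $c$ (which is $\mathbf C$ when $c$ is a closed point), i.e. they have isomorphic dense open subschemes. -/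

import Mathlib

open AlgebraicGeometry CategoryTheory
open scoped Pointwise

noncomputable section

namespace NefMirror

/-! ### Lattice polytopes, nef-partitions and Borisov duality

The lattices are `M = N = ℤⁿ`, paired by the dot product, inside `ℝⁿ`. -/

/-- The inclusion of the lattice `ℤⁿ` in `ℝⁿ`. -/
def toReal {n : ℕ} (m : Fin n → ℤ) : Fin n → ℝ := fun j => (m j : ℝ)

/-- Integral, compact, convex polytopes: convex hulls of finite sets of lattice points. -/
def IsLatticePolytope {n : ℕ} (P : Set (Fin n → ℝ)) : Prop :=
  ∃ S : Set (Fin n → ℤ), S.Finite ∧ S.Nonempty ∧ P = convexHull ℝ (toReal '' S)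

/-- The polar dual `{w | ⟨w, p⟩ ≥ -1 for all p ∈ P}`. -/
def polarDual {n : ℕ} (P : Set (Fin n → ℝ)) : Set (Fin n → ℝ) :=
  {w | ∀ p ∈ P, -1 ≤ w ⬝ᵥ p}

/-- Lattice polytopes whose polar dual is a lattice polytope. -/
def IsReflexive {n : ℕ} (P : Set (Fin n → ℝ)) : Prop :=
  IsLatticePolytope P ∧ IsLatticePolytope (polarDual P)

/-- A nef-partition `Δ_1, …, Δ_r` in `ℝⁿ`. -/
structure NefPartition (n r : ℕ) where
  poly : Fin r → Set (Fin n → ℝ)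
  isLatticePolytope : ∀ k, IsLatticePolytope (poly k)
  ne_zero : ∀ k, poly k ≠ {0}
  zero_mem : ∀ k, 0 ∈ poly k
  isReflexive_sum : IsReflexive (∑ k, poly k)

namespace NefPartition

variable {n r : ℕ} (Δ : NefPartition n r)

/-- The Borisov dual polytopes
`∇_k = {y | ⟨x, y⟩ + δ(k', k) ≥ 0 for all k' and all x ∈ Δ_{k'}}`. -/
def borisovDual (k : Fin r) : Set (Fin n → ℝ) :=
  {y | ∀ k', ∀ x ∈ Δ.poly k', 0 ≤ x ⬝ᵥ y + (if k' = k then 1 else 0)}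

/-- The lattice points of `Δ_k`. -/
def latticePoints (k : Fin r) : Set (Fin n → ℤ) := {m | toReal m ∈ Δ.poly k}

/-- The Minkowski sum `Δ_1 + ⋯ + Δ_r`. -/
def total : Set (Fin n → ℝ) := ∑ k, Δ.poly k

theorem convex_total : Convex ℝ Δ.total := by
  obtain ⟨S, -, -, hS⟩ := Δ.isReflexive_sum.1
  rw [total, hS]
  exact convex_convexHull ℝ _

theorem zero_mem_total : 0 ∈ Δ.total := by
  have h := Set.finsetSum_mem_finsetSum (Finset.univ : Finset (Fin r)) Δ.poly (fun _ => 0)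
    (fun k _ => Δ.zero_mem k)
  simpa [total] using h

/-- The monoid `σ_P ∩ (M ⊕ ℤ) = {(u, d) | u ∈ d P}` of lattice points of the cone over the
polytope `P = Δ_1 + ⋯ + Δ_r`, graded by `d ≥ 0`. -/
def coneMonoid : AddSubmonoid ((Fin n → ℤ) × ℕ) where
  carrier := {x | toReal x.1 ∈ (x.2 : ℝ) • Δ.total}
  zero_mem' := by
    refine ⟨0, Δ.zero_mem_total, ?_⟩
    ext j
    simp [toReal]
  add_mem' := by
    intro x y hx hy
    have h : toReal (x + y).1 = toReal x.1 + toReal y.1 := by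
      ext j
      simp [toReal]
    change toReal (x + y).1 ∈ ((x.2 + y.2 : ℕ) : ℝ) • Δ.total
    rw [h, Nat.cast_add, Δ.convex_total.add_smul (Nat.cast_nonneg _) (Nat.cast_nonneg _)]
    exact Set.add_mem_add hx hy

theorem zero_one_mem_coneMonoid : ((0, 1) : (Fin n → ℤ) × ℕ) ∈ Δ.coneMonoid := by
  refine ⟨0, Δ.zero_mem_total, ?_⟩
  ext j
  simp [toReal]

/-- The degree `(u, d) ↦ d`. -/
def degree : Δ.coneMonoid →+ ℕ :=
  (AddMonoidHom.snd (Fin n → ℤ) ℕ).comp Δ.coneMonoid.subtype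

variable (R : Type) [CommRing R]

/-- The homogeneous coordinate ring `R[σ_P ∩ (M ⊕ ℤ)]`. The monomial at `(u, d)` is written
`χᵘ tᵈ` in the comments. -/
abbrev CoordRing : Type := AddMonoidAlgebra R Δ.coneMonoid

/-- The grading of the coordinate ring by the exponent of `t`. -/
abbrev grading : ℕ → Submodule R (Δ.CoordRing R) := AddMonoidAlgebra.gradeBy R Δ.degree

/-- The toric variety `Proj R[σ_P ∩ (M ⊕ ℤ)]` of the polytope `P = Δ_1 + ⋯ + Δ_r` over the
base `Spec R`. For `R = ℂ` it is the projective toric variety `Y_-`, and for a `ℂ`-algebra `R` it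
is `Y_- × Spec R`. -/
def toricVariety : Scheme.{0} := Proj (Δ.grading R)

/-- The structure morphism to `Spec R`. -/
def toBase : Δ.toricVariety R ⟶ Spec (CommRingCat.of R) :=
  Proj.toSpecZero (Δ.grading R) ≫
    Spec.map (CommRingCat.ofHom (algebraMap R (Δ.grading R 0)))

end NefPartition

/-! ### Closed subschemes of `Proj` -/

section ProjIdeal

variable {R A : Type} [CommRing R] [CommRing A] [Algebra R A] (𝒜 : ℕ → Submodule R A)
  [GradedAlgebra 𝒜]

/-- For a homogeneous ideal `I`, the ideal `(I_f)₀` of the degree zero part `(A_f)₀` of the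
localization at `f`. -/
def awayIdeal (I : Ideal A) (f : A) : Ideal (HomogeneousLocalization.Away 𝒜 f) :=
  (I.map (algebraMap A (Localization.Away f))).comap
    (algebraMap (HomogeneousLocalization.Away 𝒜 f) (Localization.Away f))

/-- For `f` homogeneous of degree `d > 0`, the locally closed subscheme
`Spec ((A_f)₀ / (I_f)₀) ⟶ Spec (A_f)₀ = D₊(f) ⟶ Proj A`. -/
def chartSubscheme (I : Ideal A) {f : A} {d : ℕ} (hf : f ∈ 𝒜 d) (hd : 0 < d) :
    Spec (CommRingCat.of (HomogeneousLocalization.Away 𝒜 f ⧸ awayIdeal 𝒜 I f)) ⟶ Proj 𝒜 :=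
  Spec.map (CommRingCat.ofHom (Ideal.Quotient.mk (awayIdeal 𝒜 I f))) ≫ Proj.awayι 𝒜 f hf hd

/-- The ideal sheaf on `Proj A` of a homogeneous ideal `I`, i.e. the one whose restriction to each
chart `D₊(f) = Spec (A_f)₀` is given by `(I_f)₀`. It is written as the largest ideal sheaf that
vanishes on all the subschemes `Spec ((A_f)₀ / (I_f)₀)` of the charts. -/
def projIdealSheaf (I : Ideal A) : (Proj 𝒜).IdealSheafData :=
  ⨅ f : {f : A × ℕ // f.1 ∈ 𝒜 f.2 ∧ 0 < f.2}, (chartSubscheme 𝒜 I f.2.1 f.2.2).ker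

end ProjIdeal

/-! ### Multiple mirror nef-partitions -/

/-- Two nef-partitions `Δ⁽¹⁾ = Δ 0` and `Δ⁽²⁾ = Δ 1` that are multiple mirrors: their Borisov
duals satisfy `∇⁽²⁾_k = ∇⁽¹⁾_k + n_k` for lattice vectors `n_k = trans k` with sum zero. -/
structure MultipleMirrors (n r : ℕ) where
  Δ : Fin 2 → NefPartition n r
  trans : Fin r → Fin n → ℤ
  sum_trans : ∑ k, trans k = 0
  borisovDual_eq : ∀ k, (Δ 1).borisovDual k = toReal (trans k) +ᵥ (Δ 0).borisovDual k

namespace MultipleMirrors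

variable {n r : ℕ} (D : MultipleMirrors n r)

/-- The characters of the torus `T_-` of the total spaces, in the coordinates
`M ⊕ ⨁_k ℤ e_k` given by the first nef-partition. -/
abbrev Char (n r : ℕ) : Type := (Fin n → ℤ) × (Fin r → ℤ)

/-- The translation vectors of the `i`-th nef-partition relative to the first one. -/
def shift (i : Fin 2) (k : Fin r) : Fin n → ℤ := if i = 0 then 0 else D.trans k

/-- The character of `T_-` that a character `m ∈ M` of the `i`-th toric variety pulls back to:
for `i = 1` it is `(m, 0)` and for `i = 2` it is `(m, ∑_k ⟨m, n_k⟩ e_k)`. (This is the identification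
of the two lattices `M ⊕ ⨁_k ℤ e_k` that is dual to `(y, e_k') ↦ (y + n_k, e_k')` and so matches the
cones of global characters.) -/
def baseChar (i : Fin 2) : (Fin n → ℤ) →+ Char n r where
  toFun m := (m, fun k => m ⬝ᵥ D.shift i k)
  map_zero' := by
    ext <;> simp
  map_add' a b := by
    ext <;> simp [add_dotProduct]

/-- The characters of `T_-` that are global sections of `L⁽ⁱ⁾_k`: the lattice points of
`Δ⁽ⁱ⁾_k + e_k`. -/
def sectionChars (i : Fin 2) (k : Fin r) : Set (Char n r) :=
  {x | ∃ m ∈ (D.Δ i).latticePoints k, x = D.baseChar i m + (0, Pi.single k 1)}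

/-- The characters of the global sections of `L⁽ⁱ⁾_1 ⊕ ⋯ ⊕ L⁽ⁱ⁾_r`, that is the lattice points of
`conv (⋃_k (Δ⁽ⁱ⁾_k + e_k))`. -/
def globalSectionChars (i : Fin 2) : Set (Char n r) := ⋃ k, D.sectionChars i k

/-- The index set of the coefficients. The two sets in the union are in fact equal. -/
def indexSet : Set (Char n r) := D.globalSectionChars 0 ∪ D.globalSectionChars 1

/-- The ring `ℂ[c_x^{±1}]` of Laurent polynomials in the coefficients, with monomials indexed by
their exponents. -/
abbrev CoeffRing : Type := AddMonoidAlgebra ℂ (D.indexSet →₀ ℤ)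

/-- The coefficient torus `C`. -/
abbrev coeffTorus : Scheme.{0} := Spec (CommRingCat.of D.CoeffRing)

/-- The coefficient `c_x`, a coordinate function on `C`. -/
def coeff (x : D.indexSet) : D.CoeffRing := AddMonoidAlgebra.single (Finsupp.single x 1) 1

/-- `Y⁽ⁱ⁾ = Y_-⁽ⁱ⁾ × C`. -/
def ambient (i : Fin 2) : Scheme.{0} := (D.Δ i).toricVariety D.CoeffRing

/-- The universal section of `L⁽ⁱ⁾_k`, divided by the trivializing section `e_k`:
the Laurent polynomial `ℓ⁽ⁱ⁾_k = ∑_{m ∈ Δ⁽ⁱ⁾_k ∩ M} c_m χᵐ`, in `R[M × ℕ]` with `R = ℂ[c^{±1}]`. -/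
def universalSection (i : Fin 2) (k : Fin r) :
    AddMonoidAlgebra D.CoeffRing ((Fin n → ℤ) × ℕ) :=
  ∑ᶠ (x : D.indexSet) (_ : x.1 ∈ D.sectionChars i k),
    AddMonoidAlgebra.single (x.1.1, 0) (D.coeff x)

/-- The homogeneous ideal of the zero locus of the universal section `g⁽ⁱ⁾ = (ℓ⁽ⁱ⁾_k e_k)_k`. It is
generated by all products `χᵘ tᵈ ℓ⁽ⁱ⁾_k` that lie in the homogeneous coordinate ring, i.e. with
`u + Δ⁽ⁱ⁾_k ⊆ d P`. As `χᵘ tᵈ` is then a section of `O(d) ⊗ (L⁽ⁱ⁾_k)⁻¹`, this is the ideal of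
the image of `⨁_k (L⁽ⁱ⁾_k)⁻¹ → O` under evaluation at `g⁽ⁱ⁾`. -/
def zeroIdeal (i : Fin 2) : Ideal ((D.Δ i).CoordRing D.CoeffRing) :=
  Ideal.span {s | ∃ (k : Fin r) (u : Fin n → ℤ) (d : ℕ),
    AddMonoidAlgebra.mapDomainRingHom D.CoeffRing (D.Δ i).coneMonoid.subtype s =
      AddMonoidAlgebra.single (u, d) 1 * D.universalSection i k}

/-- The ideal sheaf of `Z⁽ⁱ⁾` in `Y⁽ⁱ⁾`. -/
def idealSheaf (i : Fin 2) : (D.ambient i).IdealSheafData :=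
  projIdealSheaf ((D.Δ i).grading D.CoeffRing) (D.zeroIdeal i)

/-- The universal complete intersection `Z⁽ⁱ⁾`, the vanishing locus of the universal section. -/
def Z (i : Fin 2) : Scheme.{0} := (D.idealSheaf i).subscheme

/-- The inclusion of `Z⁽ⁱ⁾` in `Y⁽ⁱ⁾`. -/
def ι (i : Fin 2) : D.Z i ⟶ D.ambient i := (D.idealSheaf i).subschemeι

/-- The family `Z⁽ⁱ⁾ ⟶ C`, whose fibre over `c` is `(Z⁽ⁱ⁾)_c`. -/
def toCoeff (i : Fin 2) : D.Z i ⟶ D.coeffTorus := D.ι i ≫ (D.Δ i).toBase D.CoeffRing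

/-! ### The torus `T` and the sets `Ω⁽ⁱ⁾` -/

/-- The ring of functions on the torus `T = T_- × C` of the total spaces. -/
abbrev TorusRing : Type := AddMonoidAlgebra D.CoeffRing (Char n r)

/-- The torus `T = T_- × C`. -/
abbrev torus : Scheme.{0} := Spec (CommRingCat.of D.TorusRing)

/-- The pullback `χᵘ tᵈ ↦ χᵘ` of homogeneous coordinates to `T`, with `O(1)` trivialized by `t`. -/
def pullbackHom (i : Fin 2) : (D.Δ i).CoordRing D.CoeffRing →+* D.TorusRing :=
  AddMonoidAlgebra.mapDomainRingHom D.CoeffRing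
    ((D.baseChar i).comp
      ((AddMonoidHom.fst (Fin n → ℤ) ℕ).comp (D.Δ i).coneMonoid.subtype))

/-- The same as a homomorphism to the global sections on the scheme `T`. -/
def globalPullbackHom (i : Fin 2) : (D.Δ i).CoordRing D.CoeffRing →+* Γ(D.torus, ⊤) :=
  (Scheme.ΓSpecIso (CommRingCat.of D.TorusRing)).inv.hom.comp (D.pullbackHom i)

theorem map_irrelevant (i : Fin 2) :
    ((HomogeneousIdeal.irrelevant ((D.Δ i).grading D.CoeffRing)).toIdeal).map
      (D.globalPullbackHom i) = ⊤ := by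
  rw [Ideal.eq_top_iff_one]
  have hdeg : (AddMonoidAlgebra.single ⟨(0, 1), (D.Δ i).zero_one_mem_coneMonoid⟩ 1 :
      (D.Δ i).CoordRing D.CoeffRing) ∈ (D.Δ i).grading D.CoeffRing 1 :=
    AddMonoidAlgebra.single_mem_gradeBy (D.Δ i).degree _ 1
  have h1 := HomogeneousIdeal.mem_irrelevant_of_mem ((D.Δ i).grading D.CoeffRing)
    one_pos hdeg
  have h2 := Ideal.mem_map_of_mem (D.globalPullbackHom i) h1
  have h3 : D.pullbackHom i
      (AddMonoidAlgebra.single ⟨(0, 1), (D.Δ i).zero_one_mem_coneMonoid⟩ 1) = 1 := by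
    simp [pullbackHom, AddMonoidAlgebra.one_def]
  rwa [globalPullbackHom, RingHom.comp_apply, h3, map_one] at h2

/-- The projection `T ⟶ T_{Y⁽ⁱ⁾} ⊆ Y⁽ⁱ⁾`. -/
def proj (i : Fin 2) : D.torus ⟶ D.ambient i :=
  Proj.fromOfGlobalSections ((D.Δ i).grading D.CoeffRing) (D.globalPullbackHom i)
    (D.map_irrelevant i)

/-- The matrix `(W)`: its entry `W_{ab}` is the sum of the terms `c_χ χ` of `W` that belong to
`L⁽¹⁾_a` and to `L⁽²⁾_b`. -/
def W : Matrix (Fin r) (Fin r) D.TorusRing := fun a b =>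
  ∑ᶠ (x : D.indexSet) (_ : x.1 ∈ D.sectionChars 0 a ∩ D.sectionChars 1 b),
    AddMonoidAlgebra.single x.1 (D.coeff x)

/-- The (undirected) graph underlying the directed graph `D`, which has an arrow from `a` to `b`
when some term of `W` belongs to `L⁽¹⁾_a` and to `L⁽²⁾_b`. -/
def graph : SimpleGraph (Fin r) :=
  SimpleGraph.fromRel fun a b => (D.sectionChars 0 a ∩ D.sectionChars 1 b).Nonempty

/-- The number `β` of connected components of the graph. -/
def numComponents : ℕ := Nat.card D.graph.ConnectedComponent

/-- The rank of the matrix `(W)` at a point of `T`. -/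
def rankAt (x : PrimeSpectrum D.TorusRing) : ℕ :=
  (D.W.map (algebraMap D.TorusRing x.asIdeal.ResidueField)).rank

/-- The set `R⁽¹⁾ ∩ R⁽²⁾`: the points of `T` that lie over both `Z⁽¹⁾` and `Z⁽²⁾` and where the
rank of `(W)` is `r - β`. -/
def R : Set D.torus :=
  {x | (∀ i, D.proj i x ∈ Set.range (D.ι i)) ∧ D.rankAt x + D.numComponents = r}

/-- The set `Ω⁽ⁱ⁾`, the image of `R⁽¹⁾ ∩ R⁽²⁾` in `Z⁽ⁱ⁾`. -/
def Omega (i : Fin 2) : Set (D.Z i) := {z | ∃ x ∈ D.R, D.proj i x = D.ι i z}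

end MultipleMirrors

end NefMirror

end

noncomputable section

namespace NefMirror

/-! ### Convex geometry of lattice polytopes -/

section Lattice

variable {n : ℕ}

/-! Combinatorics. If `m ∈ Δ⁽¹⁾_a`, the integers `δ_{ak} - ⟨m, n_k⟩` are nonnegative with sum one,
so exactly one is nonzero, say at `k = b`, and Borisov duality gives `m ∈ Δ⁽²⁾_b`
(`exists_mem_latticePoints_of_borisovDual_eq`). Hence both nef-partitions have the same section
characters, and each character belongs to exactly one pair `(a, b)`. With `s_a` the fibre
coordinates of `T`, row `a` of `(W)` sums to `s_a ℓ⁽¹⁾_a` and column `b` to `s_b ℓ⁽²⁾_b`.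

The sets `Ω`. Write `(W) = diag(s) w` with `w` defined on the big torus of `Y_-⁽¹⁾`. Over `Z⁽¹⁾` one
has `w 1 = 0`, and a point of `T` lies over `Z⁽²⁾` as well exactly when `s w = 0`. The matrix `w` is
block diagonal along the components of the graph, so its corank is at least `β`. Adding one at a
root of each block gives `grounded`, whose cofactors form the left null vector `leftNull`. Over
`Z⁽¹⁾`, the function `discr` is nonzero exactly where the corank is `β` and some left null vector
has no zero entry. Therefore `Ω⁽¹⁾` is a basic open subset of the torus part of `Z⁽¹⁾` (`mem_R_iff`,
`Omega_eq`), and `s = leftNull` is a section over it. It is non-empty because the components of the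
graph are strongly connected (`reflTransGen_arrow_of_arrow`): suitable coefficients turn `w` into a
graph Laplacian, where a minimum principle applies (`discr_ne_zero_of_real`).

Symmetry. Exchanging the nef-partitions transposes `(W)`, and the normalization of the null vector
is compatible with this (`leftNull_eq_of_conj`). The two sections thus have the same image in `T`,
which identifies `Ω⁽¹⁾` with `Ω⁽²⁾` over `C` (`exists_omegaRing_hom`).

Irreducibility. The equations are linear in the coefficients and involve disjoint sets of them.
Solving each for one coefficient exhibits the ideal on the torus as the kernel of a map to a field
(`equationIdeal_eq_ker`); the same elimination in homogeneous coordinates shows that `Z⁽ⁱ⁾` is the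
scheme-theoretic closure of its torus part (`exists_pow_mul_mem`, `idealSheaf_eq_ker`), hence
integral.

Fibres. By generic freeness, proved with Gröbner normal forms, a non-empty open subset of `Z⁽ⁱ⁾` is
dense in the fibres over a dense open subset of `C` (`exists_dense_in_fibres`). Restricting the
isomorphism of the `Ω⁽ⁱ⁾` to such fibres gives the birational equivalence. -/

theorem toReal_add (a b : Fin n → ℤ) : toReal (a + b) = toReal a + toReal b := by
  ext j
  simp [toReal]

theorem toReal_neg (a : Fin n → ℤ) : toReal (-a) = -toReal a := by
  ext j
  simp [toReal]

theorem toReal_zero : toReal (0 : Fin n → ℤ) = 0 := by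
  ext j
  simp [toReal]

theorem toReal_sum {ι : Type*} (s : Finset ι) (f : ι → Fin n → ℤ) :
    toReal (∑ i ∈ s, f i) = ∑ i ∈ s, toReal (f i) := by
  ext j
  simp [toReal, Finset.sum_apply]

theorem toReal_dotProduct (a b : Fin n → ℤ) : toReal a ⬝ᵥ toReal b = ((a ⬝ᵥ b : ℤ) : ℝ) := by
  simp [toReal, dotProduct]

theorem toReal_injective : Function.Injective (toReal : (Fin n → ℤ) → Fin n → ℝ) := by
  intro a b h
  ext j
  have := congrFun h j
  simpa [toReal] using this

theorem finite_toReal_preimage {P : Set (Fin n → ℝ)} (hP : Bornology.IsBounded P) :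
    {m : Fin n → ℤ | toReal m ∈ P}.Finite := by
  obtain ⟨C, hC⟩ := hP.exists_norm_le
  refine (Set.finite_Icc (fun _ : Fin n => -⌈C⌉) (fun _ => ⌈C⌉)).subset fun m hm => ?_
  have h : ∀ j, |(m j : ℝ)| ≤ C := fun j => (norm_le_pi_norm (toReal m) j).trans (hC _ hm)
  constructor
  · intro j
    have := (abs_le.1 (h j)).1
    have h2 := Int.le_ceil C
    have : ((-⌈C⌉ : ℤ) : ℝ) ≤ m j := by push_cast; linarith
    exact_mod_cast this
  · intro j
    have := (abs_le.1 (h j)).2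
    have h2 := Int.le_ceil C
    have : (m j : ℝ) ≤ ⌈C⌉ := by linarith
    exact_mod_cast this

theorem exists_eq_dotProduct (f : (Fin n → ℝ) →L[ℝ] ℝ) : ∃ y, ∀ x, f x = x ⬝ᵥ y := by
  refine ⟨fun j => f (Pi.single j 1), fun x => ?_⟩
  have := LinearMap.pi_apply_eq_sum_univ (f : (Fin n → ℝ) →ₗ[ℝ] ℝ) x
  simp only [ContinuousLinearMap.coe_coe, smul_eq_mul] at this
  rw [this, dotProduct]
  congr! with j _
  rename_i j' _
  simp [Pi.single_apply, eq_comm]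

theorem exists_dotProduct_separation {P : Set (Fin n → ℝ)} (hc : Convex ℝ P) (hP : IsClosed P)
    {x : Fin n → ℝ} (hx : x ∉ P) : ∃ (y : Fin n → ℝ) (u : ℝ), x ⬝ᵥ y < u ∧ ∀ p ∈ P, u < p ⬝ᵥ y := by
  obtain ⟨f, u, h1, h2⟩ := geometric_hahn_banach_point_closed hc hP hx
  obtain ⟨y, hy⟩ := exists_eq_dotProduct f
  exact ⟨y, u, by rwa [← hy], fun p hp => by rw [← hy]; exact h2 p hp⟩

theorem convex_le_dotProduct (y : Fin n → ℝ) (c : ℝ) : Convex ℝ {x : Fin n → ℝ | c ≤ x ⬝ᵥ y} := by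
  intro a ha b hb s t hs ht hst
  simp only [Set.mem_ofPred_eq, add_dotProduct, smul_dotProduct, smul_eq_mul] at *
  calc c = s * c + t * c := by rw [← add_mul, hst, one_mul]
    _ ≤ _ := by gcongr

/-- A rescaled center of mass. When the total weight is zero, every term vanishes and `0 ∈ P` is
needed. -/
theorem sum_smul_mem_smul {P : Set (Fin n → ℝ)} (hc : Convex ℝ P) (h0 : 0 ∈ P) {ι : Type*}
    (s : Finset ι) (w : ι → ℝ) (f : ι → Fin n → ℝ) (hw : ∀ i ∈ s, 0 ≤ w i) (hf : ∀ i ∈ s, f i ∈ P) :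
    ∑ i ∈ s, w i • f i ∈ (∑ i ∈ s, w i) • P := by
  rcases (Finset.sum_nonneg hw).eq_or_lt' with h | h
  · rw [Finset.sum_eq_zero_iff_of_nonneg hw] at h
    refine ⟨0, h0, ?_⟩
    change (∑ i ∈ s, w i) • (0 : Fin n → ℝ) = _
    rw [smul_zero, Finset.sum_eq_zero]
    intro i hi
    rw [h i hi, zero_smul]
  · refine ⟨s.centerMass w f, hc.centerMass_mem hw h hf, ?_⟩
    simp only [Finset.centerMass]
    rw [smul_inv_smul₀ h.ne']

variable {P : Set (Fin n → ℝ)}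

theorem IsLatticePolytope.isCompact (h : IsLatticePolytope P) : IsCompact P := by
  obtain ⟨S, hS, -, rfl⟩ := h
  exact (hS.image _).isCompact_convexHull ℝ

theorem IsLatticePolytope.convex (h : IsLatticePolytope P) : Convex ℝ P := by
  obtain ⟨S, hS, -, rfl⟩ := h
  exact convex_convexHull _ _

theorem IsLatticePolytope.exists_minimizer (h : IsLatticePolytope P) (y : Fin n → ℝ) :
    ∃ v : Fin n → ℤ, toReal v ∈ P ∧ ∀ x ∈ P, toReal v ⬝ᵥ y ≤ x ⬝ᵥ y := by
  obtain ⟨S, hS, hne, rfl⟩ := h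
  obtain ⟨v, hv, hmin⟩ := Set.exists_min_image S (fun v => toReal v ⬝ᵥ y) hS hne
  refine ⟨v, subset_convexHull _ _ ⟨v, hv, rfl⟩, fun x hx => ?_⟩
  refine convexHull_min ?_ (convex_le_dotProduct y _) hx
  rintro _ ⟨s, hs, rfl⟩
  exact hmin s hs

/-- Integrality enters the combinatorics here, both in Borisov duality and in the comparison of
mirrors: over `ℝ` the mass could be spread over several indices. -/
theorem exists_eq_ite_of_sum_eq_one {ι : Type*} [Fintype ι] [DecidableEq ι] (j : ι → ℤ)
    (h0 : ∀ k, 0 ≤ j k) (h1 : ∑ k, j k = 1) : ∃ b, ∀ k, j k = if b = k then 1 else 0 := by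
  obtain ⟨b, -, hb⟩ : ∃ b ∈ Finset.univ, 0 < j b := by
    apply Finset.exists_lt_of_sum_lt
    simp [h1]
  rw [← Finset.add_sum_erase _ _ (Finset.mem_univ b)] at h1
  have h2 : 0 ≤ ∑ k ∈ Finset.univ.erase b, j k := Finset.sum_nonneg fun k _ => h0 k
  have h3 : ∑ k ∈ Finset.univ.erase b, j k = 0 := by omega
  rw [Finset.sum_eq_zero_iff_of_nonneg fun k _ => h0 k] at h3
  refine ⟨b, fun k => ?_⟩
  split_ifs with h
  · subst h
    rw [Finset.sum_eq_zero fun k hk => h3 k hk] at h1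
    omega
  · exact h3 k (Finset.mem_erase.2 ⟨fun h' => h h'.symm, Finset.mem_univ _⟩)

end Lattice

/-! ### Nef-partitions and Borisov duality -/

namespace NefPartition

variable {n r : ℕ} (Δ : NefPartition n r)

theorem mem_latticePoints {k : Fin r} {m : Fin n → ℤ} :
    m ∈ Δ.latticePoints k ↔ toReal m ∈ Δ.poly k := Iff.rfl

theorem finite_latticePoints (k : Fin r) : (Δ.latticePoints k).Finite :=
  finite_toReal_preimage (Δ.isLatticePolytope k).isCompact.isBounded

theorem zero_mem_latticePoints (k : Fin r) : 0 ∈ Δ.latticePoints k := by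
  rw [mem_latticePoints, toReal_zero]
  exact Δ.zero_mem k

theorem exists_ne_zero_mem_latticePoints (k : Fin r) : ∃ m ∈ Δ.latticePoints k, m ≠ 0 := by
  by_contra! h
  apply Δ.ne_zero k
  obtain ⟨S, -, hne, hP⟩ := Δ.isLatticePolytope k
  have hS : S = {0} := by
    refine hne.subset_singleton_iff.1 fun s hs => h s ?_
    rw [mem_latticePoints, hP]
    exact subset_convexHull _ _ ⟨s, hs, rfl⟩
  rw [hP, hS, Set.image_singleton, toReal_zero, convexHull_singleton]

theorem mem_total_iff {p : Fin n → ℝ} :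
    p ∈ Δ.total ↔ ∃ x : Fin r → Fin n → ℝ, (∀ k, x k ∈ Δ.poly k) ∧ ∑ k, x k = p := by
  rw [total, Set.mem_finsetSum]
  constructor
  · rintro ⟨g, hg, rfl⟩
    exact ⟨g, fun k => hg (Finset.mem_univ k), rfl⟩
  · rintro ⟨x, hx, rfl⟩
    exact ⟨x, fun {k} _ => hx k, rfl⟩

theorem isCompact_total : IsCompact Δ.total := Δ.isReflexive_sum.1.isCompact

theorem isCompact_polarDual : IsCompact (polarDual Δ.total) := Δ.isReflexive_sum.2.isCompact

/-- A lattice point of `Δ_k` where the linear function `y` is minimal. -/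
def vertex (k : Fin r) (y : Fin n → ℝ) : Fin n → ℤ :=
  ((Δ.isLatticePolytope k).exists_minimizer y).choose

theorem vertex_mem (k : Fin r) (y : Fin n → ℝ) : toReal (Δ.vertex k y) ∈ Δ.poly k :=
  ((Δ.isLatticePolytope k).exists_minimizer y).choose_spec.1

theorem vertex_le (k : Fin r) (y : Fin n → ℝ) {x : Fin n → ℝ} (hx : x ∈ Δ.poly k) :
    toReal (Δ.vertex k y) ⬝ᵥ y ≤ x ⬝ᵥ y :=
  ((Δ.isLatticePolytope k).exists_minimizer y).choose_spec.2 x hx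

theorem vertex_nonpos (k : Fin r) (y : Fin n → ℝ) : toReal (Δ.vertex k y) ⬝ᵥ y ≤ 0 := by
  simpa using Δ.vertex_le k y (Δ.zero_mem k)

theorem neg_one_le_sum_vertex {w : Fin n → ℝ} (hw : w ∈ polarDual Δ.total) :
    -1 ≤ ∑ k, toReal (Δ.vertex k w) ⬝ᵥ w := by
  rw [← sum_dotProduct, dotProduct_comm]
  exact hw _ (Δ.mem_total_iff.2 ⟨_, fun k => Δ.vertex_mem k w, rfl⟩)

theorem sum_vertex_le {p : Fin n → ℝ} (hp : p ∈ Δ.total) (y : Fin n → ℝ) :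
    ∑ k, toReal (Δ.vertex k y) ⬝ᵥ y ≤ p ⬝ᵥ y := by
  obtain ⟨x, hx, rfl⟩ := Δ.mem_total_iff.1 hp
  rw [sum_dotProduct]
  exact Finset.sum_le_sum fun k _ => Δ.vertex_le k y (hx k)

/-- The half of Borisov duality that recovers `Δ_b` from the dual polytopes. -/
theorem mem_poly_of_forall_borisovDual {b : Fin r} {x : Fin n → ℝ}
    (hx : ∀ k, ∀ y ∈ Δ.borisovDual k, 0 ≤ x ⬝ᵥ y + (if b = k then 1 else 0)) : x ∈ Δ.poly b := by
  by_contra hxb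
  obtain ⟨y, u, h1, h2⟩ := exists_dotProduct_separation (Δ.isLatticePolytope b).convex
    (Δ.isLatticePolytope b).isCompact.isClosed hxb
  have hlt : x ⬝ᵥ y < toReal (Δ.vertex b y) ⬝ᵥ y := h1.trans (h2 _ (Δ.vertex_mem b y))
  apply hlt.not_ge
  clear! u
  -- `-H` is the minimum of `y` on the Minkowski sum.
  set H : ℝ := -∑ k, toReal (Δ.vertex k y) ⬝ᵥ y with hH
  have hH0 : 0 ≤ H := by
    rw [hH, neg_nonneg]
    exact Finset.sum_nonpos fun k _ => Δ.vertex_nonpos k y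
  rcases hH0.eq_or_lt' with hH0 | hH0
  · have h0 : ∀ k, toReal (Δ.vertex k y) ⬝ᵥ y = 0 := by
      have := (Finset.sum_eq_zero_iff_of_nonpos fun k _ => Δ.vertex_nonpos k y).1
        (neg_eq_zero.1 hH0)
      exact fun k => this k (Finset.mem_univ k)
    rw [h0]
    by_contra! hneg
    -- As all minima are zero, every nonnegative multiple of `y` lies in `∇_b`. This factor makes
    -- the pairing with `x` equal to `-2`, below the permitted `-1`.
    have hmem : (2 / -(x ⬝ᵥ y)) • y ∈ Δ.borisovDual b := by
      intro k z hz
      have hz0 := Δ.vertex_le k y hz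
      rw [h0] at hz0
      rw [dotProduct_smul, smul_eq_mul]
      have : 0 ≤ 2 / -(x ⬝ᵥ y) := div_nonneg zero_le_two (by linarith)
      have := mul_nonneg this hz0
      split_ifs <;> linarith
    have h3 := hx b _ hmem
    rw [dotProduct_smul, smul_eq_mul, if_pos rfl] at h3
    have h4 : 2 / -(x ⬝ᵥ y) * (x ⬝ᵥ y) = -2 := by
      field_simp [hneg.ne]
    linarith
  · have hyH : H⁻¹ • y ∈ polarDual Δ.total := by
      intro p hp
      have := Δ.sum_vertex_le hp y
      rw [smul_dotProduct, smul_eq_mul, dotProduct_comm]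
      rw [← neg_le_neg_iff, neg_neg, ← mul_neg, ← div_eq_inv_mul, div_le_one hH0]
      linarith
    -- Reflexivity: the polar dual is the hull of lattice points, so `y` is a combination of lattice
    -- points `z` of it with coefficients `H * w z ≥ 0`.
    obtain ⟨S, hS, -, hpol⟩ := Δ.isReflexive_sum.2
    change polarDual Δ.total = _ at hpol
    have hy1 := hyH
    lift S to Finset (Fin n → ℤ) using hS
    classical
    rw [hpol, ← Finset.coe_image, Finset.mem_convexHull'] at hy1
    obtain ⟨w, hw0, hw1, hwy⟩ := hy1
    set F := S.image toReal
    have hy2 : y = ∑ z ∈ F, (H * w z) • z := by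
      simp_rw [mul_smul]
      rw [← Finset.smul_sum, hwy, smul_inv_smul₀ hH0.ne']
    have hFpol : ∀ z ∈ F, z ∈ polarDual Δ.total := by
      intro z hz
      rw [hpol]
      exact subset_convexHull _ _ (by simpa [F] using hz)
    have hc0 : ∀ z ∈ F, 0 ≤ H * w z := fun z hz => mul_nonneg hH0.le (hw0 z hz)
    have hdot : ∀ v : Fin n → ℝ, v ⬝ᵥ y = ∑ z ∈ F, (H * w z) * (v ⬝ᵥ z) := by
      intro v
      conv_lhs => rw [hy2]
      simp [dotProduct_sum, dotProduct_smul]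
    -- The minimum over `Δ_k` is superadditive in the functional. Summed over `k`, these
    -- inequalities meet the bound `-1` for each `z`, which forces equality in all of them.
    have hsup : ∀ k, ∑ z ∈ F, (H * w z) * (toReal (Δ.vertex k z) ⬝ᵥ z) ≤
        toReal (Δ.vertex k y) ⬝ᵥ y := by
      intro k
      rw [hdot]
      exact Finset.sum_le_sum fun z hz =>
        mul_le_mul_of_nonneg_left (Δ.vertex_le k z (Δ.vertex_mem k y)) (hc0 z hz)
    have hz1 : ∀ z ∈ F, (H * w z) * (-1) ≤
        ∑ k, (H * w z) * (toReal (Δ.vertex k z) ⬝ᵥ z) := by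
      intro z hz
      rw [← Finset.mul_sum]
      exact mul_le_mul_of_nonneg_left (Δ.neg_one_le_sum_vertex (hFpol z hz)) (hc0 z hz)
    have hsum1 : ∑ z ∈ F, (H * w z) * (-1) = -H := by
      rw [← Finset.sum_mul, ← Finset.mul_sum, hw1]
      ring
    have htot : ∑ k, ∑ z ∈ F, (H * w z) * (toReal (Δ.vertex k z) ⬝ᵥ z) ≤ -H := by
      rw [hH, neg_neg]
      exact Finset.sum_le_sum fun k _ => hsup k
    rw [Finset.sum_comm] at htot
    have hzeq : ∀ z ∈ F, (H * w z) * (-1) =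
        ∑ k, (H * w z) * (toReal (Δ.vertex k z) ⬝ᵥ z) :=
      (Finset.sum_eq_sum_iff_of_le hz1).1
        (le_antisymm (Finset.sum_le_sum hz1) (htot.trans hsum1.ge))
    have hkeq : ∑ k, ∑ z ∈ F, (H * w z) * (toReal (Δ.vertex k z) ⬝ᵥ z) =
        ∑ k, toReal (Δ.vertex k y) ⬝ᵥ y := by
      rw [Finset.sum_comm, ← Finset.sum_congr rfl hzeq, hsum1, hH, neg_neg]
    have hbeq := (Finset.sum_eq_sum_iff_of_le fun k _ => hsup k).1 hkeq b (Finset.mem_univ b)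
    rw [← hbeq, hdot x]
    refine Finset.sum_le_sum fun z hz => ?_
    rcases (hc0 z hz).eq_or_lt' with hcz | hcz
    · simp [hcz]
    refine mul_le_mul_of_nonneg_left ?_ hcz.le
    have hz2 := hzeq z hz
    rw [← Finset.mul_sum] at hz2
    have hz3 := mul_left_cancel₀ hcz.ne' hz2
    obtain ⟨u, hu, rfl⟩ := Finset.mem_image.1 hz
    simp_rw [toReal_dotProduct] at hz3
    -- The minima of `u` on the `Δ_k` are nonpositive integers with sum `-1`, so `u` lies in
    -- `∇_{k₀}` for the one `k₀` where the minimum is `-1`.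
    obtain ⟨k₀, hk₀⟩ := exists_eq_ite_of_sum_eq_one
      (fun k => -(Δ.vertex k (toReal u) ⬝ᵥ u)) (fun k => by
        have := Δ.vertex_nonpos k (toReal u)
        rw [toReal_dotProduct] at this
        have : Δ.vertex k (toReal u) ⬝ᵥ u ≤ 0 := by exact_mod_cast this
        omega) (by
        rw [Finset.sum_neg_distrib, neg_eq_iff_eq_neg]
        exact_mod_cast hz3.symm)
    have hv : ∀ k, toReal (Δ.vertex k (toReal u)) ⬝ᵥ toReal u = -(if k = k₀ then 1 else 0) := by
      intro k
      have := hk₀ k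
      rw [toReal_dotProduct, neg_eq_iff_eq_neg.1 this]
      simp [eq_comm]
    have hmem : toReal u ∈ Δ.borisovDual k₀ := by
      intro k' x' hx'
      have := Δ.vertex_le k' (toReal u) hx'
      rw [hv] at this
      linarith
    have := hx k₀ _ hmem
    rw [hv]
    linarith

end NefPartition
end NefMirror

/-! ### Lattice points of multiple mirrors and the cone monoid -/

namespace NefMirror

theorem eq_zero_of_forall_smul_mem {n : ℕ} {S : Set (Fin n → ℝ)} (hS : Bornology.IsBounded S)
    {z : Fin n → ℝ} (hz : ∀ t : ℝ, 0 ≤ t → t • z ∈ S) : z = 0 := by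
  obtain ⟨C, hC⟩ := hS.exists_norm_le
  by_contra h
  have h0 : 0 < ‖z‖ := norm_pos_iff.2 h
  have hC0 : 0 ≤ C := (norm_nonneg _).trans (hC _ (hz 0 le_rfl))
  have h1 := hC _ (hz ((C + 1) / ‖z‖) (by positivity))
  rw [norm_smul, Real.norm_of_nonneg (by positivity), div_mul_cancel₀ _ h0.ne'] at h1
  linarith

namespace NefPartition

variable {n r : ℕ} (Δ : NefPartition n r)

theorem zero_mem_borisovDual (k : Fin r) : 0 ∈ Δ.borisovDual k := by
  intro k' x _
  rw [dotProduct_zero, zero_add]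
  split_ifs <;> norm_num

/-- A lattice point of `Δ_a` lies in some `Δ'_b` of a multiple mirror. -/
theorem exists_mem_latticePoints_of_borisovDual_eq {Δ Δ' : NefPartition n r}
    {ν : Fin r → Fin n → ℤ} (hν : ∑ k, ν k = 0)
    (h : ∀ k, Δ'.borisovDual k = toReal (ν k) +ᵥ Δ.borisovDual k) {a : Fin r} {m : Fin n → ℤ}
    (hm : m ∈ Δ.latticePoints a) :
    ∃ b, m ∈ Δ'.latticePoints b ∧
      ∀ k, m ⬝ᵥ ν k = (if a = k then 1 else 0) - (if b = k then 1 else 0) := by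
  have h0 : ∀ k, 0 ≤ (if a = k then 1 else 0) - m ⬝ᵥ ν k := by
    intro k
    -- `0 ∈ ∇'_k` means `-ν_k ∈ ∇_k`, and `m ∈ Δ_a` can be paired with this vector.
    have h1 := Δ'.zero_mem_borisovDual k
    rw [h] at h1
    obtain ⟨z, hz, hz0⟩ := h1
    have h2 : z = -toReal (ν k) := by
      rw [eq_neg_iff_add_eq_zero, add_comm]
      exact hz0
    have h3 := hz a _ hm
    rw [h2, dotProduct_neg, toReal_dotProduct] at h3
    have h4 : (0 : ℝ) ≤ (((if a = k then 1 else 0) - m ⬝ᵥ ν k : ℤ) : ℝ) := by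
      push_cast
      linarith
    exact_mod_cast h4
  obtain ⟨b, hb⟩ := exists_eq_ite_of_sum_eq_one _ h0 (by
    rw [Finset.sum_sub_distrib, ← dotProduct_sum, hν, dotProduct_zero]
    simp)
  refine ⟨b, ?_, fun k => by rw [← hb k]; ring⟩
  apply Δ'.mem_poly_of_forall_borisovDual
  intro k y hy
  rw [h] at hy
  obtain ⟨z, hz, rfl⟩ := hy
  have h3 := hz a _ hm
  change 0 ≤ toReal m ⬝ᵥ (toReal (ν k) + z) + _
  rw [dotProduct_add, toReal_dotProduct]
  have h4 : ((m ⬝ᵥ ν k : ℤ) : ℝ) = (if a = k then 1 else 0) - (if b = k then 1 else 0) := by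
    have := congrArg (Int.cast : ℤ → ℝ) (hb k)
    push_cast at this
    linarith
  rw [h4]
  linarith

/-- All multiples `-t y` with `t ≥ 0` would lie in the polar dual, which is bounded. -/
theorem eq_zero_of_forall_dotProduct_nonpos {y : Fin n → ℝ}
    (h : ∀ a, ∀ m ∈ Δ.latticePoints a, toReal m ⬝ᵥ y ≤ 0) : y = 0 := by
  have h1 : ∀ p ∈ Δ.total, p ⬝ᵥ y ≤ 0 := by
    intro p hp
    have h2 := Δ.sum_vertex_le hp (-y)
    have h3 : 0 ≤ ∑ k, toReal (Δ.vertex k (-y)) ⬝ᵥ -y := Finset.sum_nonneg fun k _ => by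
      rw [dotProduct_neg, neg_nonneg]
      exact h k _ (Δ.vertex_mem k _)
    rw [dotProduct_neg] at h2
    linarith
  rw [← neg_eq_zero]
  refine eq_zero_of_forall_smul_mem Δ.isCompact_polarDual.isBounded fun t ht p hp => ?_
  rw [smul_dotProduct, neg_dotProduct, smul_eq_mul, dotProduct_comm]
  nlinarith [h1 p hp, mul_nonneg ht (neg_nonneg.2 (h1 p hp))]

/-- The polar dual is compact, so its pairings with `u` are bounded by some `C < d`. A functional
separating `u / d` from the polytope would, once normalized, be a point of the polar dual whose
pairing with `u` is below `-d`. -/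
theorem exists_mem_coneMonoid (u : Fin n → ℤ) : ∃ d, (u, d) ∈ Δ.coneMonoid := by
  obtain ⟨C, hC⟩ := (Δ.isCompact_polarDual.image
    (f := fun w : Fin n → ℝ => w ⬝ᵥ toReal u) (by fun_prop)).isBounded.exists_norm_le
  obtain ⟨d, hd⟩ := exists_nat_gt (max C 1)
  have hdC : C < d := (le_max_left _ _).trans_lt hd
  have hd0 : (0 : ℝ) < d := one_pos.trans ((le_max_right _ _).trans_lt hd)
  refine ⟨d, (d : ℝ)⁻¹ • toReal u, ?_, smul_inv_smul₀ hd0.ne' _⟩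
  by_contra hx
  obtain ⟨y, c, h1, h2⟩ := exists_dotProduct_separation Δ.convex_total
    Δ.isCompact_total.isClosed hx
  have hc : 0 < -c := by
    have := h2 0 Δ.zero_mem_total
    rw [zero_dotProduct] at this
    linarith
  have hw : (-c)⁻¹ • y ∈ polarDual Δ.total := by
    intro p hp
    have := h2 p hp
    rw [smul_dotProduct, smul_eq_mul, dotProduct_comm, ← neg_le_neg_iff, neg_neg, ← mul_neg,
      ← div_eq_inv_mul, div_le_one hc]
    linarith
  have h3 := hC _ ⟨_, hw, rfl⟩
  dsimp only at h3
  rw [smul_dotProduct, smul_eq_mul, Real.norm_eq_abs, dotProduct_comm] at h3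
  have h4 := (abs_le.1 h3).1
  rw [smul_dotProduct, smul_eq_mul, ← div_eq_inv_mul, div_lt_iff₀ hd0] at h1
  have h5 : (-c)⁻¹ * (toReal u ⬝ᵥ y) < -d := by
    rw [← div_eq_inv_mul, div_lt_iff₀ hc]
    linarith
  linarith

theorem sum_mem_coneMonoid {v : Fin r → Fin n → ℤ} (hv : ∀ k, v k ∈ Δ.latticePoints k) :
    (∑ k, v k, 1) ∈ Δ.coneMonoid := by
  change toReal (∑ k, v k) ∈ ((1 : ℕ) : ℝ) • Δ.total
  rw [Nat.cast_one, one_smul, toReal_sum]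
  exact Δ.mem_total_iff.2 ⟨_, hv, rfl⟩

theorem poly_eq_convexHull (k : Fin r) :
    Δ.poly k = convexHull ℝ (toReal '' Δ.latticePoints k) := by
  apply subset_antisymm
  · obtain ⟨S, -, -, hP⟩ := Δ.isLatticePolytope k
    rw [hP]
    apply convexHull_mono
    apply Set.image_mono
    intro s hs
    rw [mem_latticePoints, hP]
    exact subset_convexHull _ _ ⟨s, hs, rfl⟩
  · apply convexHull_min _ (Δ.isLatticePolytope k).convex
    rintro _ ⟨m, hm, rfl⟩
    exact hm

/-- Convex hulls commute with Minkowski sums. The generators are kept as sums of lattice points of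
the summands because they will serve as products of sections. -/
theorem exists_finset_total_eq :
    ∃ F : Finset (Fin n → ℝ), Δ.total = convexHull ℝ (F : Set (Fin n → ℝ)) ∧
      ∀ z ∈ F, ∃ v : Fin r → Fin n → ℤ, (∀ k, v k ∈ Δ.latticePoints k) ∧
        z = toReal (∑ k, v k) := by
  have : ∀ k, Finite (Δ.latticePoints k) := fun k => Δ.finite_latticePoints k
  have hfin := Set.finite_range
    (fun v : (∀ k, Δ.latticePoints k) => toReal (∑ k, (v k : Fin n → ℤ)))
  refine ⟨hfin.toFinset, ?_, ?_⟩
  · rw [total, Finset.sum_congr rfl fun k _ => Δ.poly_eq_convexHull k, ← convexHull_sum]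
    congr 1
    ext p
    rw [Set.mem_finsetSum]
    simp only [Set.Finite.coe_toFinset, Set.mem_range]
    constructor
    · rintro ⟨g, hg, rfl⟩
      choose v hv hvg using fun k => hg (Finset.mem_univ k)
      refine ⟨fun k => ⟨v k, hv k⟩, ?_⟩
      rw [toReal_sum]
      exact Finset.sum_congr rfl fun k _ => hvg k
    · rintro ⟨v, rfl⟩
      exact ⟨fun k => toReal (v k), fun {k} _ => ⟨_, (v k).2, rfl⟩, (toReal_sum _ _).symm⟩
  · intro z hz
    obtain ⟨v, rfl⟩ := hfin.mem_toFinset.1 hz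
    exact ⟨fun k => v k, fun k => (v k).2, rfl⟩

/-- In large degree, a lattice point of the cone can be divided by a product of sections. -/
theorem exists_eq_add_sum :
    ∃ c : ℕ, 1 ≤ c ∧ ∀ x ∈ Δ.coneMonoid, c ≤ x.2 →
      ∃ v : Fin r → Fin n → ℤ, (∀ k, v k ∈ Δ.latticePoints k) ∧
        ∃ y ∈ Δ.coneMonoid, x = y + (∑ k, v k, 1) := by
  obtain ⟨F, hF, hv⟩ := Δ.exists_finset_total_eq
  have hFne : F.Nonempty := by
    rw [← Finset.coe_nonempty, ← convexHull_nonempty_iff (𝕜 := ℝ), ← hF]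
    exact ⟨0, Δ.zero_mem_total⟩
  have hcard : (0 : ℝ) < F.card := by exact_mod_cast hFne.card_pos
  refine ⟨F.card, hFne.card_pos, fun x hx hxd => ?_⟩
  obtain ⟨p, hp, hpx⟩ := hx
  change (x.2 : ℝ) • p = _ at hpx
  rw [hF, Finset.mem_convexHull'] at hp
  obtain ⟨w, hw0, hw1, hwp⟩ := hp
  -- In degree at least `F.card`, the degree times this weight is at least one, so the generator
  -- `z₀` can be subtracted once with all weights staying nonnegative.
  obtain ⟨z₀, hz₀, hwz⟩ : ∃ z ∈ F, (F.card : ℝ)⁻¹ ≤ w z := by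
    apply Finset.exists_le_of_sum_le hFne
    rw [hw1, Finset.sum_const, nsmul_eq_mul, mul_inv_cancel₀ hcard.ne']
  obtain ⟨v, hvm, hvz⟩ := hv z₀ hz₀
  have hx1 : 1 ≤ x.2 := hFne.card_pos.trans_le hxd
  refine ⟨v, hvm, (x.1 - ∑ k, v k, x.2 - 1), ?_, ?_⟩
  · change toReal (x.1 - ∑ k, v k) ∈ ((x.2 - 1 : ℕ) : ℝ) • Δ.total
    have hmul : 1 ≤ x.2 * w z₀ := by
      have h1 : (F.card : ℝ) ≤ x.2 := by exact_mod_cast hxd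
      calc (1 : ℝ) = F.card * (F.card : ℝ)⁻¹ := (mul_inv_cancel₀ hcard.ne').symm
        _ ≤ _ := by gcongr
    have h1 := sum_smul_mem_smul Δ.convex_total Δ.zero_mem_total F
      (fun z => x.2 * w z - if z = z₀ then 1 else 0) (fun z => z) (fun z hz => by
        split_ifs with h
        · subst h
          linarith
        · have := hw0 z hz
          rw [sub_zero]
          positivity) (fun z hz => by
        rw [hF]
        exact subset_convexHull _ _ hz)
    have h2 : ∑ z ∈ F, ((x.2 : ℝ) * w z - if z = z₀ then 1 else 0) = ((x.2 - 1 : ℕ) : ℝ) := by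
      rw [Finset.sum_sub_distrib, ← Finset.mul_sum, hw1, Finset.sum_ite_eq' F z₀, if_pos hz₀,
        Nat.cast_sub hx1]
      simp
    have h3 : ∑ z ∈ F, ((x.2 : ℝ) * w z - if z = z₀ then 1 else 0) • z =
        toReal (x.1 - ∑ k, v k) := by
      simp_rw [sub_smul, Finset.sum_sub_distrib, mul_smul, ← Finset.smul_sum, hwp, hpx,
        ite_smul, one_smul, zero_smul]
      rw [Finset.sum_ite_eq' F z₀, if_pos hz₀, hvz, sub_eq_add_neg, sub_eq_add_neg, toReal_add,
        toReal_neg]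
    rwa [h2, h3] at h1
  · ext1
    · simp
    · simp only [Prod.snd_add]
      omega

/-- The finitely many elements of degree at most `c` generate, since in larger degree an element of
degree one splits off. This makes the toric variety of finite type over its base. -/
theorem fg_coneMonoid : Δ.coneMonoid.FG := by
  obtain ⟨c, hc, hdiv⟩ := Δ.exists_eq_add_sum
  rw [AddSubmonoid.fg_iff]
  have hB : {x | x ∈ Δ.coneMonoid ∧ x.2 ≤ c}.Finite := by
    have h1 : ∀ d : ℕ, {u : Fin n → ℤ | toReal u ∈ (d : ℝ) • Δ.total}.Finite := fun d =>
      finite_toReal_preimage (Δ.isCompact_total.isBounded.smul₀ _)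
    refine (Set.Finite.biUnion (Set.finite_Iic c) fun d _ => (h1 d).image (·, d)).subset ?_
    rintro ⟨u, d⟩ ⟨hx, hd⟩
    exact Set.mem_biUnion hd ⟨u, hx, rfl⟩
  refine ⟨_, le_antisymm (AddSubmonoid.closure_le.2 fun x hx => hx.1) fun x hx => ?_, hB⟩
  induction h : x.2 using Nat.strong_induction_on generalizing x with
  | _ d ih =>
    by_cases hd : x.2 ≤ c
    · exact AddSubmonoid.subset_closure ⟨hx, hd⟩
    · obtain ⟨v, hv, y, hy, rfl⟩ := hdiv x hx (by omega)
      refine add_mem (ih y.2 ?_ y hy rfl)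
        (AddSubmonoid.subset_closure ⟨Δ.sum_mem_coneMonoid hv, hc⟩)
      rw [← h]
      simp

end NefPartition

/-! ### The common index set and strong connectivity of the graph -/

namespace MultipleMirrors

variable {n r : ℕ} (D : MultipleMirrors n r)

theorem mem_sectionChars {i : Fin 2} {k : Fin r} {x : Char n r} :
    x ∈ D.sectionChars i k ↔ x.1 ∈ (D.Δ i).latticePoints k ∧
      ∀ j, x.2 j = x.1 ⬝ᵥ D.shift i j + if k = j then 1 else 0 := by
  constructor
  · rintro ⟨m, hm, rfl⟩
    refine ⟨by simpa [baseChar] using hm, fun j => ?_⟩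
    simp [baseChar, Pi.single_apply, eq_comm]
  · rintro ⟨h1, h2⟩
    refine ⟨x.1, h1, Prod.ext (by simp [baseChar]) ?_⟩
    ext j
    rw [h2]
    simp [baseChar, Pi.single_apply, eq_comm]

theorem eq_of_mem_sectionChars {i : Fin 2} {k l : Fin r} {x : Char n r}
    (hk : x ∈ D.sectionChars i k) (hl : x ∈ D.sectionChars i l) : k = l := by
  have h1 := (D.mem_sectionChars.1 hk).2 k
  have h2 := (D.mem_sectionChars.1 hl).2 k
  rw [h1] at h2
  by_contra h
  simp at h2
  exact h h2.symm

theorem ext_of_mem_sectionChars {i : Fin 2} {k : Fin r} {x y : Char n r}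
    (hx : x ∈ D.sectionChars i k) (hy : y ∈ D.sectionChars i k) (h : x.1 = y.1) : x = y := by
  refine Prod.ext h (funext fun j => ?_)
  rw [(D.mem_sectionChars.1 hx).2, (D.mem_sectionChars.1 hy).2, h]

theorem finite_sectionChars (i : Fin 2) (k : Fin r) : (D.sectionChars i k).Finite := by
  refine (((D.Δ i).finite_latticePoints k).image
    fun m => D.baseChar i m + (0, Pi.single k 1)).subset ?_
  rintro x ⟨m, hm, rfl⟩
  exact ⟨m, hm, rfl⟩

theorem finite_globalSectionChars (i : Fin 2) : (D.globalSectionChars i).Finite :=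
  Set.finite_iUnion fun k => D.finite_sectionChars i k

theorem finite_indexSet : D.indexSet.Finite :=
  (D.finite_globalSectionChars 0).union (D.finite_globalSectionChars 1)

instance : Finite D.indexSet := D.finite_indexSet

theorem sectionChars_subset_indexSet (i : Fin 2) (k : Fin r) :
    D.sectionChars i k ⊆ D.indexSet := by
  fin_cases i
  · exact (Set.subset_iUnion (D.sectionChars 0) k).trans Set.subset_union_left
  · exact (Set.subset_iUnion (D.sectionChars 1) k).trans Set.subset_union_right

theorem exists_mem_sectionChars_one {a : Fin r} {x : Char n r} (hx : x ∈ D.sectionChars 0 a) :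
    ∃ b, x ∈ D.sectionChars 1 b := by
  rw [mem_sectionChars] at hx
  obtain ⟨b, hb, h⟩ := NefPartition.exists_mem_latticePoints_of_borisovDual_eq D.sum_trans
    D.borisovDual_eq hx.1
  refine ⟨b, D.mem_sectionChars.2 ⟨hb, fun j => ?_⟩⟩
  rw [hx.2, shift, shift, if_pos rfl, if_neg one_ne_zero, h]
  simp

theorem exists_mem_sectionChars_zero {b : Fin r} {x : Char n r} (hx : x ∈ D.sectionChars 1 b) :
    ∃ a, x ∈ D.sectionChars 0 a := by
  rw [mem_sectionChars] at hx
  obtain ⟨a, ha, h⟩ := NefPartition.exists_mem_latticePoints_of_borisovDual_eq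
    (Δ := D.Δ 1) (Δ' := D.Δ 0) (ν := fun k => -D.trans k)
    (by rw [Finset.sum_neg_distrib, D.sum_trans, neg_zero])
    (fun k => by rw [D.borisovDual_eq k, vadd_vadd, ← toReal_add, neg_add_cancel, toReal_zero,
      zero_vadd]) hx.1
  refine ⟨a, D.mem_sectionChars.2 ⟨ha, fun j => ?_⟩⟩
  have h1 := h j
  rw [dotProduct_neg] at h1
  rw [hx.2, shift, shift, if_pos rfl, if_neg one_ne_zero, dotProduct_zero]
  linarith

theorem globalSectionChars_eq : D.globalSectionChars 0 = D.globalSectionChars 1 := by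
  ext x
  simp only [globalSectionChars, Set.mem_iUnion]
  exact ⟨fun ⟨a, ha⟩ => D.exists_mem_sectionChars_one ha,
    fun ⟨b, hb⟩ => D.exists_mem_sectionChars_zero hb⟩

/-- Every index belongs to a unique pair `(a, b)`. -/
theorem exists_mem_sectionChars_inter (x : D.indexSet) :
    ∃ a b, x.1 ∈ D.sectionChars 0 a ∩ D.sectionChars 1 b := by
  obtain ⟨x, hx | hx⟩ := x
  · obtain ⟨a, ha⟩ := Set.mem_iUnion.1 hx
    obtain ⟨b, hb⟩ := D.exists_mem_sectionChars_one ha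
    exact ⟨a, b, ha, hb⟩
  · obtain ⟨b, hb⟩ := Set.mem_iUnion.1 hx
    obtain ⟨a, ha⟩ := D.exists_mem_sectionChars_zero hb
    exact ⟨a, b, ha, hb⟩

/-- The arrows of the directed graph. -/
def Arrow (a b : Fin r) : Prop := (D.sectionChars 0 a ∩ D.sectionChars 1 b).Nonempty

/-- Let `y = ∑_{k ∈ S} n_k`. A character of type `(a, b)` pairs with `y` to `1_S(a) - 1_S(b)`, which
is nonpositive when no arrow leaves `S`. Then `y` is nonpositive on all the polytopes, so `y = 0`,
all these differences vanish, and no arrow enters `S` either. -/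
theorem mem_of_arrow {S : Set (Fin r)} (hS : ∀ a b, a ∈ S → D.Arrow a b → b ∈ S) {a b : Fin r}
    (hab : D.Arrow a b) (hb : b ∈ S) : a ∈ S := by
  classical
  let y : Fin n → ℤ := ∑ k with k ∈ S, D.trans k
  have key : ∀ a b x, x ∈ D.sectionChars 0 a → x ∈ D.sectionChars 1 b →
      x.1 ⬝ᵥ y = (if a ∈ S then 1 else 0) - (if b ∈ S then 1 else 0) := by
    intro a b x ha hb
    -- The two descriptions of `x` must give the same `e_k`-coordinate.
    have h : ∀ k, x.1 ⬝ᵥ D.trans k = (if a = k then 1 else 0) - (if b = k then 1 else 0) := by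
      intro k
      have h1 := (D.mem_sectionChars.1 ha).2 k
      have h2 := (D.mem_sectionChars.1 hb).2 k
      rw [h1, shift, shift, if_pos rfl, if_neg one_ne_zero, dotProduct_zero] at h2
      linarith
    rw [dotProduct_sum, Finset.sum_congr rfl fun k _ => h k, Finset.sum_sub_distrib]
    simp
  have hy : toReal y = 0 := by
    apply (D.Δ 0).eq_zero_of_forall_dotProduct_nonpos
    intro a m hm
    have hx : D.baseChar 0 m + (0, Pi.single a 1) ∈ D.sectionChars 0 a := ⟨m, hm, rfl⟩
    obtain ⟨b, hb⟩ := D.exists_mem_sectionChars_one hx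
    have h1 := key a b _ hx hb
    have h2 : (D.baseChar 0 m + (0, Pi.single a 1) : Char n r).1 = m := by simp [baseChar]
    rw [h2] at h1
    rw [toReal_dotProduct, h1]
    have := hS a b
    have h3 : a ∈ S → b ∈ S := fun h => this h ⟨_, hx, hb⟩
    by_cases ha : a ∈ S
    · simp [ha, h3 ha]
    · by_cases hb : b ∈ S <;> simp [ha, hb]
  have hy0 : y = 0 := toReal_injective (by rw [hy, toReal_zero])
  obtain ⟨x, hxa, hxb⟩ := hab
  have h := key a b x hxa hxb
  rw [hy0, dotProduct_zero] at h
  by_contra ha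
  simp [ha, hb] at h

/-- The set of vertices reachable from `b` is closed under outgoing arrows, hence under incoming
ones. Weakly connected components are therefore strongly connected. -/
theorem reflTransGen_arrow_of_arrow {a b : Fin r} (h : D.Arrow a b) :
    Relation.ReflTransGen D.Arrow b a :=
  D.mem_of_arrow (S := {k | Relation.ReflTransGen D.Arrow b k})
    (fun _ _ h1 h2 => Relation.ReflTransGen.tail h1 h2) h Relation.ReflTransGen.refl

theorem reflTransGen_arrow_of_reachable {a b : Fin r} (h : D.graph.Reachable a b) :
    Relation.ReflTransGen D.Arrow a b := by
  rw [SimpleGraph.reachable_iff_reflTransGen] at h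
  induction h with
  | refl => exact Relation.ReflTransGen.refl
  | tail _ h ih =>
    rw [graph, SimpleGraph.fromRel_adj] at h
    rcases h.2 with h | h
    · exact ih.tail h
    · exact ih.trans (D.reflTransGen_arrow_of_arrow h)

theorem connectedComponentMk_eq_of_arrow {a b : Fin r} (h : D.Arrow a b) :
    D.graph.connectedComponentMk a = D.graph.connectedComponentMk b := by
  by_cases hab : a = b
  · rw [hab]
  · apply SimpleGraph.ConnectedComponent.sound
    apply SimpleGraph.Adj.reachable
    rw [graph, SimpleGraph.fromRel_adj]
    exact ⟨hab, Or.inl h⟩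

end MultipleMirrors
end NefMirror

namespace NefMirror

/-! ### Laurent polynomials in the coefficients -/

section Laurent

/-- Laurent polynomials over `ℂ` in the variables `X`. -/
abbrev Laurent (X : Type) : Type := AddMonoidAlgebra ℂ (X →₀ ℤ)

namespace Laurent

variable {X : Type}

/-- The variable `x`, a unit. -/
def var (x : X) : (Laurent X)ˣ where
  val := AddMonoidAlgebra.single (Finsupp.single x 1) 1
  inv := AddMonoidAlgebra.single (Finsupp.single x (-1)) 1
  val_inv := by
    rw [AddMonoidAlgebra.single_mul_single, ← Finsupp.single_add]
    simp [AddMonoidAlgebra.one_def]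
  inv_val := by
    rw [AddMonoidAlgebra.single_mul_single, ← Finsupp.single_add]
    simp [AddMonoidAlgebra.one_def]

theorem induction {p : Laurent X → Prop} (hC : ∀ z : ℂ, p (algebraMap ℂ _ z))
    (hvar : ∀ x : X, p (var x : (Laurent X)ˣ)) (hinv : ∀ x : X, p ((var x)⁻¹ : (Laurent X)ˣ))
    (hadd : ∀ a b, p a → p b → p (a + b)) (hmul : ∀ a b, p a → p b → p (a * b)) (a : Laurent X) :
    p a := by
  have hmon : ∀ e : X →₀ ℤ, p (AddMonoidAlgebra.single e 1) := by
    intro e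
    induction e using Finsupp.induction_linear with
    | zero =>
      have := hC 1
      rwa [map_one, AddMonoidAlgebra.one_def] at this
    | add e e' h h' =>
      have := hmul _ _ h h'
      rwa [AddMonoidAlgebra.single_mul_single, one_mul] at this
    | single x k =>
      induction k using Int.induction_on with
      | zero =>
        have := hC 1
        rwa [map_one, AddMonoidAlgebra.one_def, ← Finsupp.single_zero x] at this
      | succ k ih =>
        have := hmul _ _ ih (hvar x)
        rwa [var, AddMonoidAlgebra.single_mul_single, ← Finsupp.single_add, one_mul] at this
      | pred k ih =>
        have := hmul _ _ ih (hinv x)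
        rwa [var, Units.inv_mk, Units.val_mk, AddMonoidAlgebra.single_mul_single,
          ← Finsupp.single_add, one_mul] at this
  induction a using AddMonoidAlgebra.induction_linear with
  | zero =>
    have := hC 0
    rwa [map_zero] at this
  | add a b ha hb => exact hadd _ _ ha hb
  | single e z =>
    have := hmul _ _ (hC z) (hmon e)
    rwa [AddMonoidAlgebra.coe_algebraMap, Function.comp_apply, AddMonoidAlgebra.single_mul_single,
      zero_add, mul_one] at this

variable {S : Type*} [CommRing S] [Algebra ℂ S]

/-- Substitution of units for the variables. -/
def lift (u : X → Sˣ) : Laurent X →ₐ[ℂ] S :=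
  AddMonoidAlgebra.lift ℂ S (X →₀ ℤ) ((Units.coeHom S).comp
    (AddMonoidHom.toMultiplicativeLeft
      (Finsupp.liftAddHom fun x => zmultiplesHom (Additive Sˣ) (Additive.ofMul (u x)))))

theorem lift_var (u : X → Sˣ) (x : X) : lift u (var x : (Laurent X)ˣ) = u x := by
  rw [lift, var, Units.val_mk, AddMonoidAlgebra.lift_single]
  simp

end Laurent

end Laurent

/-! ### Elimination of coefficients by linear equations -/

section Elimination

variable {X P κ : Type} [AddCommMonoid P] [IsDomain (AddMonoidAlgebra (Laurent X) P)]

variable (p : κ → X) (q : κ → AddMonoidAlgebra (Laurent X) P) (hq : ∀ k, q k ≠ 0)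

open Classical in
/-- The values of the substitution `c_{p k} ↦ q k`. -/
def substUnit (x : X) : (FractionRing (AddMonoidAlgebra (Laurent X) P))ˣ :=
  Units.mk0
    (algebraMap (AddMonoidAlgebra (Laurent X) P) _
      (if h : ∃ k, p k = x then q h.choose
        else AddMonoidAlgebra.single 0 (Laurent.var x : (Laurent X)ˣ)))
    (by
      rw [Ne, IsFractionRing.to_map_eq_zero_iff]
      split_ifs with h
      · exact hq _
      · exact ((Laurent.var x).isUnit.map
          (algebraMap (Laurent X) (AddMonoidAlgebra (Laurent X) P))).ne_zero)

/-- The substitution `c_{p k} ↦ q k`, with values in the field of fractions. -/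
def substHom :
    AddMonoidAlgebra (Laurent X) P →+* FractionRing (AddMonoidAlgebra (Laurent X) P) :=
  AddMonoidAlgebra.liftNCRingHom (Laurent.lift (substUnit p q hq)).toRingHom
    ((algebraMap (AddMonoidAlgebra (Laurent X) P)
      (FractionRing (AddMonoidAlgebra (Laurent X) P)) : AddMonoidAlgebra (Laurent X) P →* _).comp
        (AddMonoidAlgebra.of (Laurent X) P))
    (fun _ _ => Commute.all _ _)

theorem substHom_single (e : P) :
    substHom p q hq (AddMonoidAlgebra.single e 1) =
      algebraMap _ _ (AddMonoidAlgebra.single e (1 : Laurent X)) := by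
  rw [substHom, AddMonoidAlgebra.liftNCRingHom_single, map_one, one_mul]
  rfl

theorem substHom_single_zero (z : Laurent X) :
    substHom p q hq (AddMonoidAlgebra.single 0 z) = Laurent.lift (substUnit p q hq) z := by
  rw [substHom, AddMonoidAlgebra.liftNCRingHom_single]
  simp only [ofAdd_zero, map_one, mul_one]
  rfl

theorem substHom_algebraMap (z : ℂ) :
    substHom p q hq (AddMonoidAlgebra.single 0 (algebraMap ℂ (Laurent X) z)) =
      algebraMap _ _ (AddMonoidAlgebra.single (0 : P) (algebraMap ℂ (Laurent X) z)) := by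
  rw [substHom_single_zero]
  refine (AlgHom.commutes _ z).trans ?_
  rw [IsScalarTower.algebraMap_apply ℂ (AddMonoidAlgebra (Laurent X) P)]
  rfl

theorem substHom_var_of_mem (hp : Function.Injective p) (k : κ) :
    substHom p q hq (AddMonoidAlgebra.single 0 (Laurent.var (p k) : (Laurent X)ˣ)) =
      algebraMap _ _ (q k) := by
  have h : ∃ l, p l = p k := ⟨k, rfl⟩
  rw [substHom_single_zero, Laurent.lift_var, substUnit, Units.val_mk0, dif_pos h,
    hp h.choose_spec]

theorem substHom_var_of_notMem {x : X} (hx : ∀ k, p k ≠ x) :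
    substHom p q hq (AddMonoidAlgebra.single 0 (Laurent.var x : (Laurent X)ˣ)) =
      algebraMap _ _ (AddMonoidAlgebra.single (0 : P) (Laurent.var x : (Laurent X)ˣ).val) := by
  have h : ¬ ∃ l, p l = x := by simpa using hx
  rw [substHom_single_zero, Laurent.lift_var, substUnit, Units.val_mk0, dif_neg h]

variable {Q : Type} [AddCommMonoid Q] (j : Q →+ P)

/-- The elimination of the variables `c_{p k}` by the relations `c_{p k} χᶠ = q' k`. -/
theorem mem_of_substHom_eq_zero (hj : Function.Injective j)
    (I : Ideal (AddMonoidAlgebra (Laurent X) Q)) (f : Q)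
    (hf : ∀ b, AddMonoidAlgebra.single f 1 * b ∈ I → b ∈ I)
    (q' : κ → AddMonoidAlgebra (Laurent X) Q)
    (hq' : ∀ k, AddMonoidAlgebra.mapDomainRingHom (Laurent X) j (q' k) =
      AddMonoidAlgebra.single (j f) 1 * q k)
    (hθq : ∀ k, substHom p q hq (q k) = algebraMap _ _ (q k))
    (hI : ∀ k, AddMonoidAlgebra.single f ((Laurent.var (p k) : (Laurent X)ˣ) : Laurent X) - q' k ∈ I)
    (hker : ∀ b ∈ I, substHom p q hq (AddMonoidAlgebra.mapDomainRingHom (Laurent X) j b) = 0)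
    {b : AddMonoidAlgebra (Laurent X) Q}
    (hb : substHom p q hq (AddMonoidAlgebra.mapDomainRingHom (Laurent X) j b) = 0) : b ∈ I := by
  set ρ := AddMonoidAlgebra.mapDomainRingHom (Laurent X) j
  set θ := substHom p q hq
  have hρ : ∀ e z, ρ (AddMonoidAlgebra.single e z) = AddMonoidAlgebra.single (j e) z := by
    intro e z
    simp [ρ]
  let π := algebraMap (AddMonoidAlgebra (Laurent X) P)
    (FractionRing (AddMonoidAlgebra (Laurent X) P))
  have hρinj : Function.Injective ρ := AddMonoidAlgebra.mapDomain_injective hj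
  -- `T b`: modulo `I`, and up to a factor `s` that is cancellable modulo `I`, `b` agrees with an
  -- element fixed by the substitution. This property passes to sums and products, so it need only
  -- be checked on generators.
  let T : AddMonoidAlgebra (Laurent X) Q → Prop := fun b => ∃ s a, θ (ρ s) = π (ρ s) ∧
    θ (ρ a) = π (ρ a) ∧ (∀ x, s * x ∈ I → x ∈ I) ∧ s * b - a ∈ I
  have hfix : ∀ b, θ (ρ b) = π (ρ b) → T b := fun b h =>
    ⟨1, b, by simp, h, fun x hx => by rwa [one_mul] at hx, by simp⟩
  have hadd : ∀ b b', T b → T b' → T (b + b') := by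
    rintro b b' ⟨s, a, hs, ha, hsI, h⟩ ⟨s', a', hs', ha', hsI', h'⟩
    refine ⟨s * s', a * s' + a' * s, by simp [hs, hs'], by simp [hs, hs', ha, ha'],
      fun x hx => hsI' _ (hsI _ (by rwa [← mul_assoc])), ?_⟩
    have := I.add_mem (I.mul_mem_left s' h) (I.mul_mem_left s h')
    convert this using 1
    ring
  have hmul : ∀ b b', T b → T b' → T (b * b') := by
    rintro b b' ⟨s, a, hs, ha, hsI, h⟩ ⟨s', a', hs', ha', hsI', h'⟩
    refine ⟨s * s', a * a', by simp [hs, hs'], by simp [ha, ha'],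
      fun x hx => hsI' _ (hsI _ (by rwa [← mul_assoc])), ?_⟩
    have := I.add_mem (I.mul_mem_left (s' * b') h) (I.mul_mem_left a h')
    convert this using 1
    ring
  have hsingle : ∀ e, θ (ρ (AddMonoidAlgebra.single e 1)) =
      π (ρ (AddMonoidAlgebra.single e 1)) := by
    intro e
    rw [hρ]
    exact substHom_single p q hq _
  have hsplit : ∀ x : Laurent X, (AddMonoidAlgebra.single f x) =
      AddMonoidAlgebra.single f 1 * AddMonoidAlgebra.single (0 : Q) x := fun x => by
    rw [AddMonoidAlgebra.single_mul_single, add_zero, one_mul]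
  have hθq' : ∀ k, θ (ρ (q' k)) = π (ρ (q' k)) := by
    intro k
    rw [hq', map_mul, map_mul, hθq k, ← hρ, hsingle]
  have hconst : ∀ x : Laurent X, T (AddMonoidAlgebra.single 0 x) := by
    intro x
    induction x using Laurent.induction with
    | hC z =>
      apply hfix
      rw [hρ, map_zero]
      exact substHom_algebraMap p q hq z
    | hvar x =>
      by_cases hx : ∃ k, p k = x
      · obtain ⟨k, rfl⟩ := hx
        refine ⟨AddMonoidAlgebra.single f 1, q' k, hsingle f, hθq' k, hf, ?_⟩
        rw [← hsplit]
        exact hI k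
      · apply hfix
        rw [hρ, map_zero]
        exact substHom_var_of_notMem p q hq (by simpa using hx)
    | hinv x =>
      by_cases hx : ∃ k, p k = x
      · obtain ⟨k, rfl⟩ := hx
        -- For the inverse of a pivot the two sides of the relation exchange roles; `q' k` is
        -- cancellable because modulo `I` it is a unit times the monomial at `f`.
        refine ⟨q' k, AddMonoidAlgebra.single f 1, hθq' k, hsingle f, fun x hx => ?_, ?_⟩
        · have h1 := I.add_mem (I.mul_mem_right x (hI k)) hx
          rw [← add_mul, sub_add_cancel, hsplit, mul_assoc] at h1
          have h2 := I.mul_mem_left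
            (AddMonoidAlgebra.single 0 (((Laurent.var (p k))⁻¹ : (Laurent X)ˣ) : Laurent X)) (hf _ h1)
          rwa [← mul_assoc, AddMonoidAlgebra.single_mul_single, zero_add, Units.inv_mul,
            ← AddMonoidAlgebra.one_def, one_mul] at h2
        · have h1 := I.neg_mem (I.mul_mem_right
            (AddMonoidAlgebra.single 0 (((Laurent.var (p k))⁻¹ : (Laurent X)ˣ) : Laurent X)) (hI k))
          rw [sub_mul, AddMonoidAlgebra.single_mul_single, add_zero, Units.mul_inv, neg_sub] at h1
          exact h1
      · have h1 : θ (ρ (AddMonoidAlgebra.single 0 ((Laurent.var x : (Laurent X)ˣ) : Laurent X))) =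
            π (ρ (AddMonoidAlgebra.single 0 ((Laurent.var x : (Laurent X)ˣ) : Laurent X))) := by
          rw [hρ, map_zero]
          exact substHom_var_of_notMem p q hq (by simpa using hx)
        have hu : (AddMonoidAlgebra.single 0
            (((Laurent.var x)⁻¹ : (Laurent X)ˣ) : Laurent X) : AddMonoidAlgebra (Laurent X) Q) *
            AddMonoidAlgebra.single 0 ((Laurent.var x : (Laurent X)ˣ) : Laurent X) = 1 := by
          rw [AddMonoidAlgebra.single_mul_single, add_zero, Units.inv_mul,
            ← AddMonoidAlgebra.one_def]
        refine ⟨AddMonoidAlgebra.single 0 ((Laurent.var x : (Laurent X)ˣ) : Laurent X), 1, h1, by simp,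
          fun y hy => ?_, ?_⟩
        · have h2 := I.mul_mem_left (AddMonoidAlgebra.single 0
            (((Laurent.var x)⁻¹ : (Laurent X)ˣ) : Laurent X)) hy
          rwa [← mul_assoc, hu, one_mul] at h2
        · rw [mul_comm, hu, sub_self]
          exact I.zero_mem
    | hadd a b ha hb =>
      rw [AddMonoidAlgebra.single_add]
      exact hadd _ _ ha hb
    | hmul a b ha hb =>
      have := hmul _ _ ha hb
      rwa [AddMonoidAlgebra.single_mul_single, add_zero] at this
  have hall : ∀ b, T b := by
    intro b
    induction b using AddMonoidAlgebra.induction_linear with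
    | zero => exact hfix 0 (by simp)
    | add a b ha hb => exact hadd _ _ ha hb
    | single e z =>
      have := hmul _ _ (hfix _ (hsingle e)) (hconst z)
      rwa [AddMonoidAlgebra.single_mul_single, add_zero, one_mul] at this
  -- The numerator `a` is fixed by the substitution and killed by it, so it is zero and `s` can be
  -- cancelled from `s * b ∈ I`.
  obtain ⟨s, a, hs, ha, hsI, h⟩ := hall b
  have h1 := hker _ h
  have h2 : ρ a = 0 := by
    rw [map_sub, map_sub, map_mul, map_mul, hb, mul_zero, zero_sub, neg_eq_zero, ha] at h1
    exact (IsFractionRing.to_map_eq_zero_iff).1 h1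
  have h3 : a = 0 := hρinj (by rw [h2, map_zero])
  rw [h3, sub_zero] at h
  exact hsI _ h

end Elimination

end NefMirror

namespace NefMirror

/-! ### Specialization, and restriction of homogeneous coordinates to the torus -/

section MonoidAlgebra

variable {X P S : Type} [AddCommMonoid P] [CommRing S] [Algebra ℂ S]

/-- The specialization of the variables `c_x` and of the monomials `χᵐ`. -/
def specialize (u : X → Sˣ) (g : Multiplicative P →* S) : AddMonoidAlgebra (Laurent X) P →+* S :=
  AddMonoidAlgebra.liftNCRingHom (Laurent.lift u).toRingHom g (fun _ _ => Commute.all _ _)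

theorem specialize_single (u : X → Sˣ) (g : Multiplicative P →* S) (e : P) (z : Laurent X) :
    specialize u g (AddMonoidAlgebra.single e z) = Laurent.lift u z * g (Multiplicative.ofAdd e) :=
  AddMonoidAlgebra.liftNCRingHom_single ..

theorem specialize_single_var (u : X → Sˣ) (g : Multiplicative P →* S) (e : P) (x : X) :
    specialize u g (AddMonoidAlgebra.single e (Laurent.var x : (Laurent X)ˣ)) =
      u x * g (Multiplicative.ofAdd e) := by
  rw [specialize_single, Laurent.lift_var]

/-- At the point where all variables and monomials equal one, the sum takes the value `s.card`. -/
theorem sum_single_var_ne_zero {s : Finset X} (hs : s.Nonempty) (f : X → P) :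
    ∑ x ∈ s, AddMonoidAlgebra.single (f x) ((Laurent.var x : (Laurent X)ˣ) : Laurent X) ≠ 0 := by
  intro h
  have h1 := congrArg (specialize (S := ℂ) (1 : X → ℂˣ) (1 : Multiplicative P →* ℂ)) h
  rw [map_sum, map_zero, Finset.sum_congr rfl fun x _ => specialize_single_var _ _ _ _] at h1
  simp [hs.ne_empty] at h1

end MonoidAlgebra

namespace NefPartition

variable {n r : ℕ} (Δ : NefPartition n r) (R : Type) [CommRing R]

/-- The restriction `χᵘ tᵈ ↦ χᵘ` of homogeneous coordinates to the big torus. -/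
def toTorus : Δ.CoordRing R →+* AddMonoidAlgebra R (Fin n → ℤ) :=
  AddMonoidAlgebra.mapDomainRingHom R
    ((AddMonoidHom.fst (Fin n → ℤ) ℕ).comp Δ.coneMonoid.subtype)

theorem toTorus_single (x : Δ.coneMonoid) (z : R) :
    Δ.toTorus R (AddMonoidAlgebra.single x z) = AddMonoidAlgebra.single x.1.1 z := by
  simp [toTorus]

/-- The inclusion of the homogeneous coordinate ring in `R[M × ℕ]`. -/
abbrev toProd : Δ.CoordRing R →+* AddMonoidAlgebra R ((Fin n → ℤ) × ℕ) :=
  AddMonoidAlgebra.mapDomainRingHom R Δ.coneMonoid.subtype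

/-- The inclusion `R[M] ⊆ R[M × ℕ]`. -/
abbrev _root_.NefMirror.inlHom (n : ℕ) (R : Type) [CommRing R] :
    AddMonoidAlgebra R (Fin n → ℤ) →+* AddMonoidAlgebra R ((Fin n → ℤ) × ℕ) :=
  AddMonoidAlgebra.mapDomainRingHom R (AddMonoidHom.inl (Fin n → ℤ) ℕ)

theorem toProd_injective : Function.Injective (Δ.toProd R) :=
  AddMonoidAlgebra.mapDomain_injective Subtype.val_injective

variable {R}

theorem mem_grading_induction {d : ℕ} {p : Δ.CoordRing R → Prop} (h0 : p 0)
    (hadd : ∀ a b, p a → p b → p (a + b))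
    (hs : ∀ (x : Δ.coneMonoid) (z : R), x.1.2 = d → p (AddMonoidAlgebra.single x z))
    {a : Δ.CoordRing R} (ha : a ∈ Δ.grading R d) : p a := by
  rw [AddMonoidAlgebra.mem_gradeBy_iff] at ha
  rw [← AddMonoidAlgebra.sum_coeff_single a, Finsupp.sum]
  exact Finset.sum_induction _ p hadd h0 fun x hx => hs x _ (ha hx)

/-- Homogeneity fixes the exponent of `t`, so restriction to the torus loses nothing within one
degree. -/
theorem toProd_eq {d : ℕ} {a : Δ.CoordRing R} (ha : a ∈ Δ.grading R d) :
    Δ.toProd R a = AddMonoidAlgebra.single (0, d) 1 * inlHom n R (Δ.toTorus R a) := by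
  refine Δ.mem_grading_induction (p := fun a => Δ.toProd R a =
    AddMonoidAlgebra.single (0, d) 1 * inlHom n R (Δ.toTorus R a)) (by simp)
    (fun a b ha hb => by rw [map_add, map_add, map_add, mul_add, ha, hb]) (fun x z hx => ?_) ha
  rw [toTorus_single]
  simp only [AddMonoidAlgebra.mapDomainRingHom_apply, AddMonoidAlgebra.mapDomain_single,
    AddMonoidAlgebra.single_mul_single, one_mul]
  congr 1
  ext1 <;> simp [hx]

theorem eq_zero_of_toTorus_eq_zero (d : ℕ) (a : Δ.CoordRing R) (ha : a ∈ Δ.grading R d)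
    (h : Δ.toTorus R a = 0) : a = 0 := by
  apply Δ.toProd_injective R
  rw [Δ.toProd_eq ha, h, map_zero, map_zero, mul_zero]

/-- The homogeneous coordinate `t`. -/
def coordT : Δ.CoordRing R := AddMonoidAlgebra.single ⟨(0, 1), Δ.zero_one_mem_coneMonoid⟩ 1

theorem coordT_mem : (Δ.coordT : Δ.CoordRing R) ∈ Δ.grading R 1 :=
  AddMonoidAlgebra.single_mem_gradeBy Δ.degree _ 1

theorem toTorus_coordT : Δ.toTorus R Δ.coordT = 1 := by
  rw [coordT, toTorus_single]
  rfl

theorem exists_mem_grading_toTorus_eq (x : AddMonoidAlgebra R (Fin n → ℤ)) :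
    ∃ d, ∃ a ∈ Δ.grading R d, Δ.toTorus R a = x := by
  induction x using AddMonoidAlgebra.induction_linear with
  | zero => exact ⟨0, 0, Submodule.zero_mem _, map_zero _⟩
  | add x y hx hy =>
    obtain ⟨d, a, ha, rfl⟩ := hx
    obtain ⟨e, b, hb, rfl⟩ := hy
    have ht : ∀ k, (Δ.coordT ^ k : Δ.CoordRing R) ∈ Δ.grading R k := fun k => by
      simpa using SetLike.pow_mem_graded k (Δ.coordT_mem (R := R))
    -- Powers of `t` bring both summands to a common degree without changing their restrictions.
    refine ⟨d + e, a * Δ.coordT ^ e + Δ.coordT ^ d * b, Submodule.add_mem _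
      (SetLike.mul_mem_graded ha (ht e)) (SetLike.mul_mem_graded (ht d) hb), ?_⟩
    simp [toTorus_coordT]
  | single u z =>
    obtain ⟨d, hd⟩ := Δ.exists_mem_coneMonoid u
    exact ⟨d, AddMonoidAlgebra.single ⟨(u, d), hd⟩ z,
      AddMonoidAlgebra.single_mem_gradeBy Δ.degree _ z, Δ.toTorus_single R _ z⟩

end NefPartition

theorem map_neg_eq_mul_neg {A B : Type*} [CommRing A] [CommRing B] (f : A →+* B) {s : A} {a t : B}
    (h : f s = a * t) : f (-s) = a * -t := by
  rw [map_neg, h, mul_neg]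

/-- The elements that are in an ideal after multiplication by a power of `f`. -/
def saturate {A : Type*} [CommRing A] (I : Ideal A) (f : A) : Ideal A where
  carrier := {b | ∃ N : ℕ, f ^ N * b ∈ I}
  zero_mem' := ⟨0, by simp⟩
  add_mem' := by
    rintro a b ⟨N, hN⟩ ⟨N', hN'⟩
    refine ⟨N + N', ?_⟩
    have := I.add_mem (I.mul_mem_left (f ^ N') hN) (I.mul_mem_left (f ^ N) hN')
    convert this using 1
    ring
  smul_mem' := by
    rintro c a ⟨N, hN⟩
    refine ⟨N, ?_⟩
    have := I.mul_mem_left c hN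
    convert this using 1
    rw [smul_eq_mul]
    ring

/-! ### The equations of `Z⁽ⁱ⁾`: primality and saturation -/

namespace MultipleMirrors

variable {n r : ℕ} (D : MultipleMirrors n r)

/-- The ring of functions on the big torus times `C`. -/
abbrev BaseRing : Type := AddMonoidAlgebra D.CoeffRing (Fin n → ℤ)

/-- The indices of the global sections of `L⁽ⁱ⁾_k`. -/
def sectionFinset (i : Fin 2) (k : Fin r) : Finset D.indexSet :=
  (Set.toFinite {x : D.indexSet | x.1 ∈ D.sectionChars i k}).toFinset

theorem mem_sectionFinset {i : Fin 2} {k : Fin r} {x : D.indexSet} :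
    x ∈ D.sectionFinset i k ↔ x.1 ∈ D.sectionChars i k := by
  simp [sectionFinset]

theorem coeff_eq (x : D.indexSet) : D.coeff x = (Laurent.var x : (Laurent D.indexSet)ˣ) := rfl

/-- The universal section of `L⁽ⁱ⁾_k` on the big torus. -/
def sect (i : Fin 2) (k : Fin r) : D.BaseRing :=
  ∑ x ∈ D.sectionFinset i k, AddMonoidAlgebra.single x.1.1 (D.coeff x)

/-- The ideal of the universal complete intersection on the big torus. -/
def equationIdeal (i : Fin 2) : Ideal D.BaseRing := Ideal.span (Set.range (D.sect i))

theorem sect_mem_equationIdeal (i : Fin 2) (k : Fin r) : D.sect i k ∈ D.equationIdeal i :=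
  Ideal.subset_span ⟨k, rfl⟩

theorem universalSection_eq (i : Fin 2) (k : Fin r) :
    D.universalSection i k = inlHom n D.CoeffRing (D.sect i k) := by
  rw [universalSection, sect, map_sum]
  refine (finsum_mem_eq_finite_toFinset_sum _
    (Set.toFinite {x : D.indexSet | x.1 ∈ D.sectionChars i k})).trans ?_
  refine Finset.sum_congr rfl fun x _ => ?_
  simp

theorem zeroIdeal_le_comap (i : Fin 2) :
    D.zeroIdeal i ≤ (D.equationIdeal i).comap ((D.Δ i).toTorus D.CoeffRing) := by
  rw [zeroIdeal, Ideal.span_le]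
  rintro s ⟨k, u, d, hs⟩
  have h := congrArg (AddMonoidAlgebra.mapDomainRingHom D.CoeffRing
    (AddMonoidHom.fst (Fin n → ℤ) ℕ)) hs
  have h1 : (D.Δ i).toTorus D.CoeffRing s = AddMonoidAlgebra.single u 1 * D.sect i k := by
    rw [universalSection_eq, map_mul] at h
    refine Eq.trans ?_ (h.trans ?_)
    · rw [NefPartition.toTorus, AddMonoidAlgebra.mapDomainRingHom_comp]
      rfl
    · congr 1
      · simp
      · rw [← RingHom.comp_apply, ← AddMonoidAlgebra.mapDomainRingHom_comp]
        simp
  rw [SetLike.mem_coe, Ideal.mem_comap, h1]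
  exact Ideal.mul_mem_left _ _ (D.sect_mem_equationIdeal i k)

/-- `Δ_k` contains `0` and, being different from `{0}`, a second lattice point. Two terms are needed
so that the solution for a pivot coefficient is nonzero and may replace a unit. -/
theorem one_lt_card_sectionFinset (i : Fin 2) (k : Fin r) : 1 < (D.sectionFinset i k).card := by
  obtain ⟨m, hm, hm0⟩ := (D.Δ i).exists_ne_zero_mem_latticePoints k
  have h : ∀ m ∈ (D.Δ i).latticePoints k, ∃ x ∈ D.sectionFinset i k, x.1.1 = m := by
    intro m hm
    have hx : D.baseChar i m + (0, Pi.single k 1) ∈ D.sectionChars i k := ⟨m, hm, rfl⟩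
    exact ⟨⟨_, D.sectionChars_subset_indexSet i k hx⟩, D.mem_sectionFinset.2 hx,
      by simp [baseChar]⟩
  obtain ⟨x, hx, hx1⟩ := h m hm
  obtain ⟨y, hy, hy1⟩ := h 0 ((D.Δ i).zero_mem_latticePoints k)
  refine Finset.one_lt_card.2 ⟨x, hx, y, hy, fun hxy => hm0 ?_⟩
  rw [← hx1, hxy, hy1]

section Eliminate

variable {D} {i : Fin 2} (p : ∀ k, D.sectionFinset i k)

theorem injective_pivot : Function.Injective fun k => (p k : D.indexSet) := fun k l h =>
  D.eq_of_mem_sectionChars (D.mem_sectionFinset.1 (p k).2)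
    (by
      have h' : (p k : D.indexSet) = p l := h
      rw [h']
      exact D.mem_sectionFinset.1 (p l).2)

open Classical in
/-- The solution of `ℓ_k = 0` for the pivot variable. -/
def solution (k : Fin r) : AddMonoidAlgebra (Laurent D.indexSet) ((Fin n → ℤ) × ℕ) :=
  -∑ x ∈ (D.sectionFinset i k).erase (p k), AddMonoidAlgebra.single
    (x.1.1 - (p k).1.1.1, 0) ((Laurent.var x : (Laurent D.indexSet)ˣ) : Laurent D.indexSet)

theorem solution_ne_zero (k : Fin r) : solution p k ≠ 0 := by
  classical
  rw [solution, neg_ne_zero]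
  apply sum_single_var_ne_zero
  rw [← Finset.card_pos, Finset.card_erase_of_mem (p k).2]
  have := D.one_lt_card_sectionFinset i k
  omega

/-- The elimination of the pivot variables. -/
abbrev eliminate : AddMonoidAlgebra (Laurent D.indexSet) ((Fin n → ℤ) × ℕ) →+*
    FractionRing (AddMonoidAlgebra (Laurent D.indexSet) ((Fin n → ℤ) × ℕ)) :=
  substHom (fun k => (p k : D.indexSet)) (solution p) (solution_ne_zero p)

/-- No pivot coefficient occurs in a solution, because different `L_k` share no index. -/
theorem eliminate_solution (k : Fin r) :
    eliminate p (solution p k) = algebraMap _ _ (solution p k) := by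
  classical
  rw [solution, map_neg, map_neg, map_sum, map_sum]
  congr 1
  refine Finset.sum_congr rfl fun x hx => ?_
  rw [Finset.mem_erase] at hx
  have h : ∀ l, (p l : D.indexSet) ≠ x := by
    rintro l rfl
    apply hx.1
    have := D.eq_of_mem_sectionChars (D.mem_sectionFinset.1 hx.2) (D.mem_sectionFinset.1 (p l).2)
    rw [this]
  have h1 := substHom_var_of_notMem _ _ (solution_ne_zero p) h
  have h2 := substHom_single (fun k => (p k : D.indexSet)) _ (solution_ne_zero p)
    (x.1.1 - (p k).1.1.1, 0)
  have h3 := congrArg₂ (· * ·) h2 h1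
  rw [← map_mul, ← map_mul, AddMonoidAlgebra.single_mul_single, one_mul, add_zero] at h3
  exact h3

theorem inlHom_sect (k : Fin r) :
    inlHom n D.CoeffRing (D.sect i k) = AddMonoidAlgebra.single ((p k).1.1.1, 0) 1 *
      (AddMonoidAlgebra.single 0
        ((Laurent.var (p k : D.indexSet) : (Laurent D.indexSet)ˣ) : Laurent D.indexSet) -
          solution p k) := by
  classical
  rw [sect, map_sum, ← Finset.add_sum_erase _ _ (p k).2, solution, sub_neg_eq_add, mul_add,
    Finset.mul_sum]
  congr 1
  · simp [AddMonoidAlgebra.single_mul_single, coeff_eq]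
  · refine Finset.sum_congr rfl fun x _ => ?_
    simp [AddMonoidAlgebra.single_mul_single, coeff_eq]

theorem eliminate_sect (k : Fin r) :
    eliminate p (inlHom n D.CoeffRing (D.sect i k)) = 0 := by
  rw [inlHom_sect p, map_mul, map_sub]
  have h1 := substHom_var_of_mem _ _ (solution_ne_zero p) (injective_pivot p) k
  have h2 := eliminate_solution p k
  rw [h2, h1, sub_self, mul_zero]

theorem equationIdeal_le_ker :
    D.equationIdeal i ≤ RingHom.ker ((eliminate p).comp (inlHom n D.CoeffRing)) := by
  rw [equationIdeal, Ideal.span_le]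
  rintro _ ⟨k, rfl⟩
  exact eliminate_sect p k

/-- The elimination lemma with `f = 0`: on the torus the pivot monomials are invertible, so each
equation can be solved for its pivot coefficient. Since the target is a field, primality follows. -/
theorem equationIdeal_eq_ker :
    D.equationIdeal i = RingHom.ker ((eliminate p).comp (inlHom n D.CoeffRing)) := by
  classical
  apply le_antisymm (equationIdeal_le_ker p)
  intro b hb
  refine mem_of_substHom_eq_zero (fun k => (p k : D.indexSet)) (solution p) (solution_ne_zero p)
    (AddMonoidHom.inl (Fin n → ℤ) ℕ) (fun a b h => congrArg Prod.fst h)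
    (D.equationIdeal i) 0 (fun b hb => by rwa [← AddMonoidAlgebra.one_def, one_mul] at hb)
    (fun k => -∑ x ∈ (D.sectionFinset i k).erase (p k),
      AddMonoidAlgebra.single (x.1.1 - (p k).1.1.1) (D.coeff x)) (fun k => ?_)
    (eliminate_solution p) (fun k => ?_) (fun b hb => equationIdeal_le_ker p hb) hb
  · rw [solution, map_neg, map_sum, map_zero, ← Prod.mk_zero_zero]
    rw [Prod.mk_zero_zero, ← AddMonoidAlgebra.one_def, one_mul]
    congr 1
    refine Finset.sum_congr rfl fun x _ => ?_
    simp [coeff_eq]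
  · have h := (D.equationIdeal i).mul_mem_left (AddMonoidAlgebra.single (-(p k).1.1.1) 1)
      (D.sect_mem_equationIdeal i k)
    convert h using 1
    rw [sect, ← Finset.add_sum_erase _ _ (p k).2, mul_add, Finset.mul_sum, sub_neg_eq_add]
    congr 1
    · simp [AddMonoidAlgebra.single_mul_single, coeff_eq]
    · refine Finset.sum_congr rfl fun x _ => ?_
      rw [AddMonoidAlgebra.single_mul_single, one_mul, sub_eq_neg_add]

theorem pivot_mem_latticePoints (k : Fin r) : (p k).1.1.1 ∈ (D.Δ i).latticePoints k :=
  (D.mem_sectionChars.1 (D.mem_sectionFinset.1 (p k).2)).1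

/-- The product of the pivot sections, a homogeneous coordinate of degree one. -/
def pivotChar : (D.Δ i).coneMonoid :=
  ⟨(∑ k, (p k).1.1.1, 1), (D.Δ i).sum_mem_coneMonoid (pivot_mem_latticePoints p)⟩

theorem eliminate_toProd_of_mem_zeroIdeal {b : (D.Δ i).CoordRing D.CoeffRing}
    (hb : b ∈ D.zeroIdeal i) : eliminate p ((D.Δ i).toProd D.CoeffRing b) = 0 := by
  have h : D.zeroIdeal i ≤ RingHom.ker ((eliminate p).comp ((D.Δ i).toProd D.CoeffRing)) := by
    rw [zeroIdeal, Ideal.span_le]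
    rintro s ⟨k, u, d, hs⟩
    rw [SetLike.mem_coe, RingHom.mem_ker, RingHom.comp_apply, hs, universalSection_eq, map_mul,
      eliminate_sect p, mul_zero]
  exact h hb

/-- In the homogeneous ring the equations become solvable only after multiplication by the product
of the pivot monomials, hence the saturation by that product. -/
theorem exists_pow_mul_mem_zeroIdeal {b : (D.Δ i).CoordRing D.CoeffRing}
    (hb : eliminate p ((D.Δ i).toProd D.CoeffRing b) = 0) :
    b ∈ saturate (D.zeroIdeal i) (AddMonoidAlgebra.single (pivotChar p) 1) := by
  classical
  have hE : ∀ k (x : D.indexSet), ∃ e : (D.Δ i).coneMonoid, x ∈ D.sectionFinset i k →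
      e.1 = ((pivotChar p).1.1 - (p k).1.1.1 + x.1.1, 1) := by
    intro k x
    by_cases hx : x ∈ D.sectionFinset i k
    · have hm := (D.Δ i).sum_mem_coneMonoid
        (v := Function.update (fun k => (p k).1.1.1) k x.1.1) (fun l => by
          by_cases h : l = k
          · subst h
            rw [Function.update_self]
            exact (D.mem_sectionChars.1 (D.mem_sectionFinset.1 hx)).1
          · rw [Function.update_of_ne h]
            exact pivot_mem_latticePoints p l)
      refine ⟨⟨_, hm⟩, fun _ => ?_⟩
      ext1
      · change ∑ l, Function.update (fun k => (p k).1.1.1) k x.1.1 l =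
          ∑ k, (p k).1.1.1 - (p k).1.1.1 + x.1.1
        rw [Finset.sum_update_of_mem (Finset.mem_univ k),
          Finset.sum_eq_add_sum_sdiff_singleton_of_mem (Finset.mem_univ k)]
        abel
      · rfl
    · exact ⟨0, fun h => absurd h hx⟩
  choose e he using hE
  have hek : ∀ k, e k (p k) = pivotChar p := by
    intro k
    apply Subtype.ext
    rw [he k _ (p k).2, sub_add_cancel]
    rfl
  refine mem_of_substHom_eq_zero (fun k => (p k : D.indexSet)) (solution p) (solution_ne_zero p)
    (D.Δ i).coneMonoid.subtype Subtype.val_injective _ (pivotChar p) ?_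
    (fun k => -∑ x ∈ (D.sectionFinset i k).erase (p k),
      AddMonoidAlgebra.single (e k x) (D.coeff x)) (fun k => ?_)
    (eliminate_solution p) (fun k => ?_) ?_ hb
  · rintro b ⟨N, hN⟩
    refine ⟨N + 1, ?_⟩
    rwa [pow_succ, mul_assoc]
  · refine map_neg_eq_mul_neg _ ?_
    rw [map_sum, Finset.mul_sum]
    refine Finset.sum_congr rfl fun x hx => ?_
    rw [Finset.mem_erase] at hx
    rw [AddMonoidAlgebra.mapDomainRingHom_apply, AddMonoidAlgebra.mapDomain_single,
      AddMonoidAlgebra.single_mul_single, one_mul]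
    congr 1
    rw [AddSubmonoid.coe_subtype, he k x hx.2]
    ext1
    · simp only [Prod.fst_add]
      abel
    · rfl
  · refine ⟨0, ?_⟩
    rw [pow_zero, one_mul]
    refine Ideal.subset_span ⟨k, (pivotChar p).1.1 - (p k).1.1.1, 1, ?_⟩
    rw [sub_neg_eq_add, ← hek k, ← coeff_eq,
      Finset.add_sum_erase (D.sectionFinset i k)
        (fun x => (AddMonoidAlgebra.single (e k x) (D.coeff x) :
          AddMonoidAlgebra D.CoeffRing (D.Δ i).coneMonoid)) (p k).2,
      map_sum, universalSection_eq, sect, map_sum, Finset.mul_sum]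
    refine Finset.sum_congr rfl fun x hx => ?_
    simp only [AddMonoidAlgebra.mapDomainRingHom_apply, AddMonoidAlgebra.mapDomain_single,
      AddMonoidAlgebra.single_mul_single, one_mul]
    congr 1
    rw [AddSubmonoid.coe_subtype, he k x hx, hek]
    rfl
  · rintro b ⟨N, hN⟩
    have h := eliminate_toProd_of_mem_zeroIdeal p hN
    rw [map_mul, map_mul, map_pow, map_pow] at h
    refine (mul_eq_zero.1 h).resolve_left (pow_ne_zero _ ?_)
    rw [AddMonoidAlgebra.mapDomainRingHom_apply, AddMonoidAlgebra.mapDomain_single]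
    have h1 := substHom_single (fun k => (p k : D.indexSet)) _ (solution_ne_zero p)
      ((D.Δ i).coneMonoid.subtype (pivotChar p))
    rw [h1, Ne, IsFractionRing.to_map_eq_zero_iff, AddMonoidAlgebra.single_eq_zero]
    exact one_ne_zero

end Eliminate

theorem exists_pivot (i : Fin 2) : Nonempty (∀ k, D.sectionFinset i k) :=
  ⟨fun k => ⟨_, (Finset.card_pos.1 (zero_lt_one.trans
    (D.one_lt_card_sectionFinset i k))).choose_spec⟩⟩

instance isPrime_equationIdeal (i : Fin 2) : (D.equationIdeal i).IsPrime := by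
  obtain ⟨p⟩ := D.exists_pivot i
  rw [equationIdeal_eq_ker p]
  exact RingHom.ker_isPrime _

/-- The ideal of `Z⁽ⁱ⁾` and the contraction of its restriction to the big torus agree up to
saturation by the irrelevant ideal. -/
theorem exists_pow_mul_mem (i : Fin 2) (e : ℕ) (a : (D.Δ i).CoordRing D.CoeffRing)
    (ha : a ∈ (D.Δ i).grading D.CoeffRing e)
    (haJ : (D.Δ i).toTorus D.CoeffRing a ∈ D.equationIdeal i) (d : ℕ) (hd : 0 < d)
    (g : (D.Δ i).CoordRing D.CoeffRing) (hg : g ∈ (D.Δ i).grading D.CoeffRing d) :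
    ∃ M : ℕ, g ^ M * a ∈ D.zeroIdeal i := by
  have hrad : ∀ g, (∃ M : ℕ, g ^ M * a ∈ D.zeroIdeal i) ↔
      g ∈ ((D.zeroIdeal i).colon {a}).radical := by
    intro g
    simp only [Ideal.mem_radical_iff, Submodule.mem_colon_singleton, smul_eq_mul]
  rw [hrad]
  have hp : ∀ p : (∀ k, D.sectionFinset i k), AddMonoidAlgebra.single (pivotChar p) 1 ∈
      ((D.zeroIdeal i).colon {a}).radical := by
    intro p
    rw [← hrad]
    apply exists_pow_mul_mem_zeroIdeal p
    rw [(D.Δ i).toProd_eq ha, map_mul]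
    have := equationIdeal_le_ker p haJ
    rw [RingHom.mem_ker, RingHom.comp_apply] at this
    rw [this, mul_zero]
  -- The `c`-th power of a monomial of positive degree is divisible by a product of sections, that
  -- is by the pivot product of some choice of pivots. So the pivot products generate the irrelevant
  -- ideal up to radical.
  obtain ⟨c, hc, hdiv⟩ := (D.Δ i).exists_eq_add_sum
  refine (D.Δ i).mem_grading_induction (p := fun g => g ∈ ((D.zeroIdeal i).colon {a}).radical)
    (Ideal.zero_mem _) (fun a b ha hb => Ideal.add_mem _ ha hb) (fun x z hx => ?_) hg
  · 
    have hx1 : (AddMonoidAlgebra.single x z : (D.Δ i).CoordRing D.CoeffRing) =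
        AddMonoidAlgebra.single 0 z * AddMonoidAlgebra.single x 1 := by
      rw [AddMonoidAlgebra.single_mul_single, zero_add, mul_one]
    rw [hx1]
    apply Ideal.mul_mem_left
    have hcx : c ≤ (c • x.1).2 := by
      rw [Prod.smul_snd, hx, smul_eq_mul]
      exact Nat.le_mul_of_pos_right _ hd
    obtain ⟨v, hv, y, hy, hxy⟩ := hdiv (c • x.1) (AddSubmonoid.nsmul_mem _ x.2 c) hcx
    have hv' : ∀ k, ∃ q : D.sectionFinset i k, q.1.1.1 = v k := by
      intro k
      have hx : D.baseChar i (v k) + (0, Pi.single k 1) ∈ D.sectionChars i k := ⟨_, hv k, rfl⟩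
      exact ⟨⟨⟨_, D.sectionChars_subset_indexSet i k hx⟩, D.mem_sectionFinset.2 hx⟩,
        by simp [baseChar]⟩
    choose q hq using hv'
    apply (Ideal.radical_isRadical _)
    refine ⟨c, ?_⟩
    rw [AddMonoidAlgebra.single_pow, one_pow]
    have hcx : c • x = ⟨y, hy⟩ + pivotChar q := by
      apply Subtype.ext
      rw [AddSubmonoidClass.coe_nsmul, hxy, AddSubmonoid.coe_add]
      simp [pivotChar, hq]
    rw [hcx, ← one_mul (1 : D.CoeffRing), ← AddMonoidAlgebra.single_mul_single]
    exact Ideal.mul_mem_left _ _ (hp q)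

end MultipleMirrors
end NefMirror

namespace NefMirror

/-! ### Morphisms to `Proj` on charts, and ideal sheaves as kernels -/

section ProjCharts

variable {R A : Type} [CommRing R] [CommRing A] [Algebra R A] (𝒜 : ℕ → Submodule R A)
  [GradedAlgebra 𝒜]

/-- A ring homomorphism on `A` that inverts `g` gives one on the degree zero part of `A_g`. -/
def awayLift {S : Type} [CommRing S] (ψ : A →+* S) {g : A} (hg : IsUnit (ψ g)) :
    HomogeneousLocalization.Away 𝒜 g →+* S :=
  (IsLocalization.Away.lift (S := Localization.Away g) g hg).comp
    (algebraMap (HomogeneousLocalization.Away 𝒜 g) (Localization.Away g))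

theorem awayLift_mk {S : Type} [CommRing S] (ψ : A →+* S) {g : A} (hg : IsUnit (ψ g)) {d : ℕ}
    (hd : g ∈ 𝒜 d) (N : ℕ) (a : A) (ha : a ∈ 𝒜 (N • d)) :
    awayLift 𝒜 ψ hg (HomogeneousLocalization.Away.mk 𝒜 hd N a ha) * ψ g ^ N = ψ a := by
  simp only [awayLift, RingHom.comp_apply, HomogeneousLocalization.algebraMap_apply,
    HomogeneousLocalization.Away.val_mk, Localization.mk_eq_mk']
  rw [← IsLocalization.Away.lift_eq (S := Localization.Away g) g hg,
    ← IsLocalization.Away.lift_eq (S := Localization.Away g) g hg, ← map_pow, ← map_mul,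
    ← map_pow]
  congr 1
  exact IsLocalization.mk'_spec (Localization.Away g) a
    (⟨g ^ N, N, rfl⟩ : Submonoid.powers g)

theorem awayLift_eq_zero {S : Type} [CommRing S] (ψ : A →+* S) {g : A} (hg : IsUnit (ψ g))
    {I : Ideal A} (hI : ∀ a ∈ I, ψ a = 0) (x : HomogeneousLocalization.Away 𝒜 g)
    (hx : x ∈ awayIdeal 𝒜 I g) : awayLift 𝒜 ψ hg x = 0 := by
  have h1 : I.map (algebraMap A (Localization.Away g)) ≤ RingHom.ker
      (IsLocalization.Away.lift (S := Localization.Away g) g hg) := by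
    rw [Ideal.map_le_iff_le_comap]
    intro a ha
    rw [Ideal.mem_comap, RingHom.mem_ker, IsLocalization.Away.lift_eq]
    exact hI a ha
  exact h1 hx

/-- As `g` becomes a unit on `Spec S`, the morphism `h` factors through the basic open set of `f g`,
where the glued morphism is given by its defining chart. What remains is an equality of ring
homomorphisms out of a localization. -/
theorem SpecMap_fromOfGlobalSections {X : Scheme.{0}} {S : Type} [CommRing S] (f : A →+* Γ(X, ⊤))
    (hf : ((HomogeneousIdeal.irrelevant 𝒜).toIdeal).map f = ⊤)
    (h : Spec (CommRingCat.of S) ⟶ X) (ψ : A →+* S)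
    (hψ : ψ = ((Scheme.ΓSpecIso (CommRingCat.of S)).hom.hom.comp h.appTop.hom).comp f)
    {g : A} {d : ℕ} (hg : g ∈ 𝒜 d) (hd : 0 < d) (hu : IsUnit (ψ g)) :
    h ≫ Proj.fromOfGlobalSections 𝒜 f hf =
      Spec.map (CommRingCat.ofHom (awayLift 𝒜 ψ hu)) ≫ Proj.awayι 𝒜 g hg hd := by
  have hu' : IsUnit (h.appTop.hom (f g)) := by
    have : IsUnit ((Scheme.ΓSpecIso (CommRingCat.of S)).hom.hom (h.appTop.hom (f g))) := by
      simpa [hψ] using hu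
    exact (MulEquiv.isUnit_map
      (Scheme.ΓSpecIso (CommRingCat.of S)).commRingCatIsoToRingEquiv).1 this
  have hrange : Set.range h ⊆ Set.range (X.basicOpen (f g)).ι := by
    rw [Scheme.Opens.range_ι]
    rintro _ ⟨x, rfl⟩
    change x ∈ h ⁻¹ᵁ X.basicOpen (f g)
    rw [Scheme.preimage_basicOpen_top, Scheme.basicOpen_of_isUnit _ hu']
    trivial
  set l := IsOpenImmersion.lift (X.basicOpen (f g)).ι h hrange
  have hl : l ≫ (X.basicOpen (f g)).ι = h := IsOpenImmersion.lift_fac _ _ _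
  have h1 : (X.basicOpen (f g)).ι ≫ Proj.fromOfGlobalSections 𝒜 f hf =
      Proj.toBasicOpenOfGlobalSections 𝒜 f rfl hd hg ≫ (Proj.basicOpen 𝒜 g).ι := 
    (Proj.openCoverOfMapIrrelevantEqTop 𝒜 f hf).ι_glueMorphisms _ _ ⟨_, _, hd, hg⟩
  conv_lhs => rw [← hl, Category.assoc, h1]
  simp only [Proj.toBasicOpenOfGlobalSections, Category.assoc, Proj.basicOpenIsoSpec_inv_ι]
  let β : Localization.Away (f g) →+* S :=
    IsLocalization.Away.lift (f g)
      (g := (Scheme.ΓSpecIso (CommRingCat.of S)).hom.hom.comp h.appTop.hom) (by simpa [hψ] using hu)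
  have h2 : l ≫ (X.isoOfEq (X.toSpecΓ_preimage_basicOpen (f g))).inv ≫
      X.toSpecΓ ∣_ PrimeSpectrum.basicOpen (f g) ≫ (basicOpenIsoSpecAway (f g)).hom =
        Spec.map (CommRingCat.ofHom β) := by
    rw [← cancel_mono (Spec.map (CommRingCat.ofHom (algebraMap Γ(X, ⊤) (Localization.Away (f g)))))]
    simp only [Category.assoc, basicOpenIsoSpecAway_hom_SpecMap]
    refine (congrArg (fun z => l ≫ (X.isoOfEq (X.toSpecΓ_preimage_basicOpen (f g))).inv ≫ z)
      (morphismRestrict_ι X.toSpecΓ (PrimeSpectrum.basicOpen (f g)))).trans ?_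
    rw [← Spec.map_comp, ← CommRingCat.ofHom_comp, IsLocalization.Away.lift_comp,
      CommRingCat.ofHom_comp, Spec.map_comp]
    refine (congrArg (fun z => l ≫ z) (Scheme.isoOfEq_inv_ι_assoc X
      (X.toSpecΓ_preimage_basicOpen (f g)) X.toSpecΓ)).trans ?_
    rw [reassoc_of% hl, Scheme.toSpecΓ_naturality]
    congr 1
    exact (SpecMap_ΓSpecIso_hom _).symm
  rw [reassoc_of% h2, ← Category.assoc]
  congr 1
  rw [← Spec.map_comp, ← CommRingCat.ofHom_comp]
  congr 2
  rw [awayLift, ← RingHom.comp_assoc]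
  congr 1
  apply IsLocalization.ringHom_ext (M := .powers g)
  ext x
  simp [β, hψ]


variable {G : Type} [CommRing G] {ρ : A →+* G}

/-- The morphism `Spec G ⟶ Proj A` given by a ring homomorphism `A →+* G`. -/
def specToProj (hρ : ((HomogeneousIdeal.irrelevant 𝒜).toIdeal).map
    ((Scheme.ΓSpecIso (CommRingCat.of G)).inv.hom.comp ρ) = ⊤) :
    Spec (CommRingCat.of G) ⟶ Proj 𝒜 :=
  Proj.fromOfGlobalSections 𝒜 ((Scheme.ΓSpecIso (CommRingCat.of G)).inv.hom.comp ρ) hρ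

variable (hρ : ((HomogeneousIdeal.irrelevant 𝒜).toIdeal).map
    ((Scheme.ΓSpecIso (CommRingCat.of G)).inv.hom.comp ρ) = ⊤)

theorem SpecMap_specToProj {S : Type} [CommRing S] (φ : G →+* S) (ψ : A →+* S)
    (hψ : ψ = φ.comp ρ)
    {g : A} {d : ℕ} (hg : g ∈ 𝒜 d) (hd : 0 < d) (hu : IsUnit (ψ g)) :
    Spec.map (CommRingCat.ofHom φ) ≫ specToProj 𝒜 hρ =
      Spec.map (CommRingCat.ofHom (awayLift 𝒜 ψ hu)) ≫ Proj.awayι 𝒜 g hg hd := by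
  refine SpecMap_fromOfGlobalSections 𝒜 _ hρ _ ψ ?_ hg hd hu
  have h : (Scheme.ΓSpecIso (CommRingCat.of G)).inv ≫
      (Spec.map (CommRingCat.ofHom φ)).appTop ≫ (Scheme.ΓSpecIso (CommRingCat.of S)).hom =
        CommRingCat.ofHom φ := by
    rw [Scheme.ΓSpecIso_naturality, Iso.inv_hom_id_assoc]
  rw [hψ]
  ext x
  exact (congrArg (fun z => z.hom (ρ x)) h).symm

theorem ker_SpecMap_mono {B C C' : Type} [CommRing B] [CommRing C] [CommRing C'] (α : B →+* C)
    (β : B →+* C') (h : RingHom.ker α ≤ RingHom.ker β) :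
    (Spec.map (CommRingCat.ofHom α)).ker ≤ (Spec.map (CommRingCat.ofHom β)).ker := by
  refine Scheme.IdealSheafData.le_of_iSup_eq_top
    (fun _ : Unit => ⟨⊤, isAffineOpen_top (Spec (CommRingCat.of B))⟩) (by simp) fun _ => ?_
  rw [Scheme.Hom.ker_apply, Scheme.Hom.ker_apply]
  intro x hx
  rw [RingHom.mem_ker] at hx ⊢
  have key : ∀ (D : Type) [CommRing D] (γ : B →+* D),
      (Spec.map (CommRingCat.ofHom γ)).appTop.hom x = 0 ↔
        γ ((Scheme.ΓSpecIso (CommRingCat.of B)).hom.hom x) = 0 := by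
    intro D _ γ
    have h := congrArg (fun z => z.hom x) (Scheme.ΓSpecIso_naturality (CommRingCat.ofHom γ))
    have h' : (Scheme.ΓSpecIso (CommRingCat.of D)).hom.hom
        ((Spec.map (CommRingCat.ofHom γ)).appTop.hom x) =
        γ ((Scheme.ΓSpecIso (CommRingCat.of B)).hom.hom x) := h
    rw [← h']
    exact (map_eq_zero_iff _ 
      (Scheme.ΓSpecIso (CommRingCat.of D)).commRingCatIsoToRingEquiv.injective).symm
  exact (key C' β).2 (h ((key C α).1 hx))

/-- If a fraction `a / g ^ N` vanishes on the part of `Spec (G ⧸ J)` where `g` is invertible, then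
some `g ^ K * a` restricts into `J`, and `hJ` puts a further multiple by a power of `g` into `I`. -/
theorem ker_le_ker_chartSubscheme {I : Ideal A} {J : Ideal G} {g : A} (L : Type) [CommRing L]
    [Algebra (G ⧸ J) L] [IsLocalization.Away (Ideal.Quotient.mk J (ρ g)) L]
    (hJ : ∀ e, ∀ a ∈ 𝒜 e, ρ a ∈ J → ∀ d, 0 < d → ∀ g ∈ 𝒜 d, ∃ M : ℕ, g ^ M * a ∈ I)
    {d : ℕ} (hg : g ∈ 𝒜 d) (hd : 0 < d) :
    (Spec.map (CommRingCat.ofHom (Ideal.Quotient.mk J)) ≫ specToProj 𝒜 hρ).ker ≤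
      (chartSubscheme 𝒜 I hg hd).ker := by
  rw [chartSubscheme, Scheme.Hom.ker_comp (Spec.map _) (Proj.awayι 𝒜 g hg hd),
    Scheme.IdealSheafData.le_map_iff_comap_le]
  let φ : G →+* L := (algebraMap (G ⧸ J) L).comp (Ideal.Quotient.mk J)
  have hu : IsUnit ((φ.comp ρ) g) := by
    rw [RingHom.comp_apply, RingHom.comp_apply]
    exact IsLocalization.Away.algebraMap_isUnit (S := L) (Ideal.Quotient.mk J (ρ g))
  have h1 := SpecMap_specToProj 𝒜 hρ φ (φ.comp ρ) rfl hg hd hu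
  have h2 : (Spec.map (CommRingCat.ofHom (Ideal.Quotient.mk J)) ≫ specToProj 𝒜 hρ).ker.comap
      (Proj.awayι 𝒜 g hg hd) ≤ (Spec.map (CommRingCat.ofHom (awayLift 𝒜 _ hu))).ker := by
    rw [← Scheme.IdealSheafData.le_map_iff_comap_le, ← Scheme.Hom.ker_comp, ← h1,
      CommRingCat.ofHom_comp, Spec.map_comp, Category.assoc]
    exact Scheme.Hom.le_ker_comp _ _
  refine h2.trans (ker_SpecMap_mono _ _ ?_)
  intro x hx
  obtain ⟨N, a, ha, rfl⟩ := HomogeneousLocalization.Away.mk_surjective 𝒜 hg x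
  rw [RingHom.mem_ker] at hx
  have h3 := awayLift_mk 𝒜 _ hu hg N a ha
  rw [hx, zero_mul] at h3
  have h4 : algebraMap (G ⧸ J) L (Ideal.Quotient.mk J (ρ a)) = 0 := h3.symm
  rw [IsLocalization.map_eq_zero_iff (.powers (Ideal.Quotient.mk J (ρ g)))] at h4
  obtain ⟨⟨_, K, rfl⟩, h5⟩ := h4
  dsimp only at h5
  rw [← map_pow, ← map_pow, ← map_mul, ← map_mul, Ideal.Quotient.eq_zero_iff_mem] at h5
  obtain ⟨M, hM⟩ := hJ (K • d + N • d) (g ^ K * a)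
    (SetLike.mul_mem_graded (SetLike.pow_mem_graded K hg) ha) h5 d hd g hg
  rw [RingHom.mem_ker, Ideal.Quotient.eq_zero_iff_mem, awayIdeal, Ideal.mem_comap,
    HomogeneousLocalization.algebraMap_apply, HomogeneousLocalization.Away.val_mk,
    Localization.mk_eq_mk', IsLocalization.mk'_mem_map_algebraMap_iff]
  refine ⟨g ^ (M + K), ⟨_, rfl⟩, ?_⟩
  rwa [pow_add, mul_assoc]

/-- For `≤` the single chart `D₊(t)` suffices, since `Spec G` maps into it; `≥` is checked on every
chart. -/
theorem projIdealSheaf_eq_ker {I : Ideal A} {J : Ideal G} (hIJ : I ≤ J.comap ρ) {t : A}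
    (ht : t ∈ 𝒜 1) (hρt : ρ t = 1)
    (hJ : ∀ e, ∀ a ∈ 𝒜 e, ρ a ∈ J → ∀ d, 0 < d → ∀ g ∈ 𝒜 d, ∃ M : ℕ, g ^ M * a ∈ I) :
    projIdealSheaf 𝒜 I =
      (Spec.map (CommRingCat.ofHom (Ideal.Quotient.mk J)) ≫ specToProj 𝒜 hρ).ker := by
  apply le_antisymm
  · refine (iInf_le _ ⟨(t, 1), ht, one_pos⟩).trans ?_
    have hu : IsUnit (((Ideal.Quotient.mk J).comp ρ) t) := by simp [hρt]
    rw [SpecMap_specToProj 𝒜 hρ (Ideal.Quotient.mk J) _ rfl ht one_pos hu]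
    have hk : ∀ x ∈ awayIdeal 𝒜 I t, awayLift 𝒜 ((Ideal.Quotient.mk J).comp ρ) hu x = 0 :=
      awayLift_eq_zero 𝒜 _ hu fun a ha => Ideal.Quotient.eq_zero_iff_mem.2 (hIJ ha)
    have h2 : awayLift 𝒜 ((Ideal.Quotient.mk J).comp ρ) hu =
        (Ideal.Quotient.lift _ _ hk).comp (Ideal.Quotient.mk (awayIdeal 𝒜 I t)) := by
      ext; simp
    rw [h2, CommRingCat.ofHom_comp, Spec.map_comp, Category.assoc]
    exact Scheme.Hom.le_ker_comp _ _
  · refine le_iInf fun ⟨⟨g, d⟩, hg, hd⟩ => ?_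
    exact ker_le_ker_chartSubscheme 𝒜 hρ (Localization.Away (Ideal.Quotient.mk J (ρ g))) hJ hg hd

/-- `Spec G` is the chart `D₊(t)`: the fraction `a / t ^ N` corresponds to `ρ a`. -/
theorem isOpenImmersion_specToProj {t : A} (ht : t ∈ 𝒜 1) (hρt : ρ t = 1)
    (hinj : ∀ d, ∀ a ∈ 𝒜 d, ρ a = 0 → a = 0) (hsurj : ∀ x, ∃ d, ∃ a ∈ 𝒜 d, ρ a = x) :
    IsOpenImmersion (specToProj 𝒜 hρ) := by
  have hu : IsUnit (ρ t) := by simp [hρt]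
  have h := SpecMap_specToProj 𝒜 hρ (RingHom.id G) ρ rfl ht one_pos hu
  rw [CommRingCat.ofHom_id, Spec.map_id, Category.id_comp] at h
  have hmk : ∀ (N : ℕ) (a : A) (ha : a ∈ 𝒜 (N • 1)),
      awayLift 𝒜 ρ hu (HomogeneousLocalization.Away.mk 𝒜 ht N a ha) = ρ a := by
    intro N a ha
    simpa [hρt] using awayLift_mk 𝒜 ρ hu ht N a ha
  have hb : Function.Bijective (awayLift 𝒜 ρ hu) := by
    constructor
    · rw [injective_iff_map_eq_zero]
      intro x hx
      obtain ⟨N, a, ha, rfl⟩ := HomogeneousLocalization.Away.mk_surjective 𝒜 ht x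
      rw [hmk] at hx
      obtain rfl := hinj _ a ha hx
      apply HomogeneousLocalization.val_injective
      rw [HomogeneousLocalization.Away.val_mk, Localization.mk_zero,
        HomogeneousLocalization.val_zero]
    · intro x
      obtain ⟨d, a, ha, rfl⟩ := hsurj x
      exact ⟨HomogeneousLocalization.Away.mk 𝒜 ht d a (by simpa using ha), hmk _ _ _⟩
  have hiso : IsIso (CommRingCat.ofHom (awayLift 𝒜 ρ hu)) :=
    (ConcreteCategory.isIso_iff_bijective _).2 hb
  rw [h]
  infer_instance

end ProjCharts

/-- The subscheme is the scheme-theoretic image of `q`, in which the source of a quasi-compact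
immersion is open. It is reduced by scheme-theoretic dominance and irreducible by density. -/
theorem exists_isOpenImmersion_subscheme {Y : Scheme.{0}} (I : Y.IdealSheafData) {C : Type}
    [CommRing C] [IsDomain C] (q : Spec (CommRingCat.of C) ⟶ Y) [IsImmersion q] [QuasiCompact q]
    (h : I = q.ker) : IsIntegral I.subscheme ∧
      ∃ m : Spec (CommRingCat.of C) ⟶ I.subscheme, m ≫ I.subschemeι = q ∧ IsOpenImmersion m := by
  subst h
  refine ⟨?_, q.toImage, q.toImage_imageι, inferInstanceAs (IsOpenImmersion q.toImage)⟩
  change IsIntegral q.image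
  have : IsSchemeTheoreticallyDominant q.toImage := by
    rw [isSchemeTheoreticallyDominant_iff]
    have hcov : ⨆ U : Y.affineOpens, q.imageι ⁻¹ᵁ U.1 = ⊤ := by
      rw [← Scheme.Hom.preimage_iSup, iSup_affineOpens_eq_top]
      rfl
    refine Scheme.IdealSheafData.ext_of_iSup_eq_top
      (fun U : Y.affineOpens => ⟨q.imageι ⁻¹ᵁ U.1, U.2.preimage q.imageι⟩) hcov fun U => ?_
    rw [Scheme.Hom.ker_apply, Scheme.IdealSheafData.ideal_bot]
    exact (RingHom.injective_iff_ker_eq_bot _).1 (q.toImage_app_injective U)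
  have : IsReduced q.image := IsSchemeTheoreticallyDominant.isReduced q.toImage
  have : IrreducibleSpace q.image := by
    rw [irreducibleSpace_def, Set.top_eq_univ, ← q.toImage.denseRange.closure_eq,
      isIrreducible_iff_closure, ← Set.image_univ]
    exact (IrreducibleSpace.isIrreducible_univ _).image _ q.toImage.continuous.continuousOn
  exact isIntegral_of_irreducibleSpace_of_isReduced _

end NefMirror

namespace NefMirror

/-! ### Generic freeness by Gröbner normal forms -/

section GenericFlatness

open MvPolynomial MonomialOrder

variable {k : ℕ} (m : MonomialOrder (Fin k)) {R : Type} [CommRing R]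

/-- Pseudo-division: up to powers of `g`, a polynomial is congruent modulo `I` to one whose
exponents are not divisible by the leading exponents in `D`, when `g` is a multiple of the
corresponding leading coefficients. -/
theorem exists_pow_mul_eq_add (I : Ideal (MvPolynomial (Fin k) R)) (D : Set (Fin k →₀ ℕ)) (g : R)
    (hD : ∀ d ∈ D, ∃ f ∈ I, m.degree f = d ∧ m.leadingCoeff f ∣ g)
    (p : MvPolynomial (Fin k) R) :
    ∃ (N : ℕ) (i r : MvPolynomial (Fin k) R), i ∈ I ∧ C g ^ N * p = i + r ∧
      ∀ e ∈ r.support, ∀ d ∈ D, ¬ d ≤ e := by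
  classical
  suffices H : ∀ (s : m.syn) (p : MvPolynomial (Fin k) R), m.toSyn (m.degree p) = s →
      ∃ (N : ℕ) (i r : MvPolynomial (Fin k) R), i ∈ I ∧ C g ^ N * p = i + r ∧
        ∀ e ∈ r.support, ∀ d ∈ D, ¬ d ≤ e from H _ p rfl
  intro s
  induction s using WellFoundedLT.induction with
  | ind s ih =>
  intro p hp
  -- the inductive step for a polynomial with strictly smaller leading exponent
  have step : ∀ q : MvPolynomial (Fin k) R, m.toSyn (m.degree q) ≤ s →
      q.coeff (m.degree p) = 0 →
      ∃ (N : ℕ) (i r : MvPolynomial (Fin k) R), i ∈ I ∧ C g ^ N * q = i + r ∧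
        ∀ e ∈ r.support, ∀ d ∈ D, ¬ d ≤ e := by
    intro q hq hq0
    by_cases h0 : q = 0
    · exact ⟨0, 0, 0, I.zero_mem, by simp [h0], by simp⟩
    · refine ih _ (lt_of_le_of_ne hq ?_) q rfl
      intro heq
      rw [← hp] at heq
      rw [← m.toSyn.injective heq] at hq0
      exact h0 (m.leadingCoeff_eq_zero_iff.1 hq0)
  by_cases hd : ∃ d ∈ D, d ≤ m.degree p
  · obtain ⟨d, hdD, hle⟩ := hd
    obtain ⟨f, hfI, rfl, g', hg'⟩ := hD d hdD
    -- Chosen so that `u * f` and `C g * p` have the same coefficient at the leading exponent of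
    -- `p`.
    set u : MvPolynomial (Fin k) R := monomial (m.degree p - m.degree f) (g' * m.leadingCoeff p)
    have hdeg : (m.degree p - m.degree f) + m.degree f = m.degree p := tsub_add_cancel_of_le hle
    obtain ⟨N, i, r, hi, hr, hs⟩ := step (C g * p - u * f) (by
        refine m.degree_sub_le.trans (sup_le ?_ ?_)
        · rw [← hp]
          refine m.degree_mul_le.trans ?_
          simp
        · rw [← hp, ← hdeg]
          refine m.degree_mul_le.trans ?_
          rw [map_add, map_add]
          gcongr
          exact m.degree_monomial_le _) (by
        rw [coeff_sub, coeff_C_mul, ← hdeg, coeff_monomial_mul, hdeg, hg']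
        simp only [MonomialOrder.leadingCoeff]
        ring)
    refine ⟨N + 1, i + C g ^ N * (u * f), r,
      I.add_mem hi (I.mul_mem_left _ (I.mul_mem_left _ hfI)), ?_, hs⟩
    linear_combination hr
  · push Not at hd
    obtain ⟨N, i, r, hi, hr, hs⟩ := step (p - monomial (m.degree p) (m.leadingCoeff p)) (by
        refine m.degree_sub_le.trans (sup_le hp.le ?_)
        rw [← hp]
        exact m.degree_monomial_le _) (by simp [MonomialOrder.leadingCoeff])
    refine ⟨N, i, r + C g ^ N * monomial (m.degree p) (m.leadingCoeff p), hi, ?_, ?_⟩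
    · linear_combination hr
    · intro e he
      rcases Finset.mem_union.1 (support_add he) with h | h
      · exact hs e h
      · rw [← C_pow, C_mul_monomial] at h
        rw [Finset.mem_singleton.1 (support_monomial_subset h)]
        exact hd

/-- Gröbner normal forms: after inverting one nonzero element of the base domain, a quotient of
a polynomial ring is spanned by monomials that are independent modulo the ideal. -/
theorem exists_normalForm [IsDomain R] (I : Ideal (MvPolynomial (Fin k) R)) :
    ∃ (g : R) (D : Set (Fin k →₀ ℕ)), g ≠ 0 ∧
      (∀ p : MvPolynomial (Fin k) R, ∃ (N : ℕ) (i r : MvPolynomial (Fin k) R),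
        i ∈ I ∧ C g ^ N * p = i + r ∧ ∀ e ∈ r.support, ∀ d ∈ D, ¬ d ≤ e) ∧
      ∀ r ∈ I, (∀ e ∈ r.support, ∀ d ∈ D, ¬ d ≤ e) → r = 0 := by
  classical
  let m : MonomialOrder (Fin k) := MonomialOrder.lex
  let P : (Fin k →₀ ℕ) → Prop := fun d => ∃ f ∈ I, f ≠ 0 ∧ m.degree f = d
  let D : Set (Fin k →₀ ℕ) := {d | Minimal P d}
  -- Dickson's lemma for the antichain of minimal leading exponents; it allows `g` to be the product
  -- of finitely many leading coefficients.
  have hfin : D.Finite :=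
    (setOfPred_minimal_antichain P).finite_of_partiallyWellOrderedOn
      (Set.isPWO_of_wellQuasiOrderedLE _)
  have hDP : ∀ d : D, ∃ f ∈ I, f ≠ 0 ∧ m.degree f = d := fun d => d.2.1
  choose f hfI hf0 hfd using hDP
  have : Fintype D := hfin.fintype
  refine ⟨∏ d : D, m.leadingCoeff (f d), D, ?_, ?_, ?_⟩
  · exact Finset.prod_ne_zero_iff.2 fun d _ => m.leadingCoeff_ne_zero_iff.2 (hf0 d)
  · exact exists_pow_mul_eq_add m I D _ fun d hd => ⟨f ⟨d, hd⟩, hfI _, hfd _,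
      Finset.dvd_prod_of_mem (fun d : D => m.leadingCoeff (f d)) (Finset.mem_univ _)⟩
  · intro r hr hs
    by_contra h0
    obtain ⟨d, hd, hmin⟩ := exists_minimal_le_of_wellFoundedLT P (m.degree r) ⟨r, hr, h0, rfl⟩
    exact hs _ (m.degree_mem_support h0) d hmin hd

/-- Once `g` is inverted, `B / h` is free over `R` on the normal monomials, so `h` stays a
non-zero-divisor modulo every ideal extended from `R`. -/
theorem exists_pow_smul_mem_map [IsDomain R] {B : Type} [CommRing B] [IsDomain B] [Algebra R B]
    [Algebra.FiniteType R B] {h : B} (hh : h ≠ 0) :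
    ∃ g : R, g ≠ 0 ∧ ∀ (p : Ideal R) (b : B), h * b ∈ p.map (algebraMap R B) →
      ∃ N : ℕ, algebraMap R B g ^ N * b ∈ p.map (algebraMap R B) := by
  obtain ⟨k, π, hπ⟩ := Algebra.FiniteType.iff_quotient_mvPolynomial''.1 ‹Algebra.FiniteType R B›
  obtain ⟨g, D, hg, hdiv, hind⟩ := exists_normalForm ((Ideal.span {h}).comap π)
  refine ⟨g, hg, fun p b hb => ?_⟩
  -- The point is that the cofactor `c` of `h` is again in `p B`: on a product `a y` with `a ∈ p`,
  -- one divides `y` and multiplies the result by `a`.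
  have key : ∀ x ∈ p.map (algebraMap R B), ∃ (N : ℕ) (c : B) (r : MvPolynomial (Fin k) R),
      c ∈ p.map (algebraMap R B) ∧ algebraMap R B g ^ N * x = h * c + π r ∧
        ∀ e ∈ r.support, ∀ d ∈ D, ¬ d ≤ e := by
    intro x hx
    have hx' : x ∈ (p • ⊤ : Submodule R B) := by
      rw [Ideal.smul_top_eq_map]
      exact hx
    refine Submodule.smul_induction_on hx' ?_ ?_
    · intro a ha y _
      obtain ⟨q, rfl⟩ := hπ y
      obtain ⟨N, i, r, hi, hr, hs⟩ := hdiv q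
      obtain ⟨c, hc⟩ := Ideal.mem_span_singleton.1 (Ideal.mem_comap.1 hi)
      refine ⟨N, algebraMap R B a * c, a • r,
        Ideal.mul_mem_right _ _ (Ideal.mem_map_of_mem _ ha), ?_, ?_⟩
      · have h1 := congrArg π hr
        rw [map_mul, map_pow, map_add, ← MvPolynomial.algebraMap_eq, AlgHom.commutes, hc] at h1
        rw [map_smul, Algebra.smul_def, Algebra.smul_def]
        linear_combination algebraMap R B a * h1
      · exact fun e he => hs e (support_smul he)
    · rintro x y ⟨N, c, r, hc, h1, hs⟩ ⟨N', c', r', hc', h1', hs'⟩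
      refine ⟨N + N', algebraMap R B g ^ N' * c + algebraMap R B g ^ N * c',
        C (g ^ N') * r + C (g ^ N) * r',
        Ideal.add_mem _ (Ideal.mul_mem_left _ _ hc) (Ideal.mul_mem_left _ _ hc'), ?_, ?_⟩
      · rw [map_add, map_mul, map_mul, ← MvPolynomial.algebraMap_eq, AlgHom.commutes,
          AlgHom.commutes, map_pow, map_pow]
        linear_combination algebraMap R B g ^ N' * h1 + algebraMap R B g ^ N * h1'
      · intro e he
        rcases Finset.mem_union.1 (support_add he) with h | h
        · rw [C_mul'] at h
          exact hs e (support_smul h)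
        · rw [C_mul'] at h
          exact hs' e (support_smul h)
  obtain ⟨N, c, r, hc, h1, hs⟩ := key _ hb
  have h2 : π r ∈ Ideal.span {h} :=
    Ideal.mem_span_singleton.2 ⟨algebraMap R B g ^ N * b - c, by linear_combination -h1⟩
  rw [hind r h2 hs, map_zero, add_zero] at h1
  refine ⟨N, ?_⟩
  rwa [mul_left_cancel₀ hh (show h * (algebraMap R B g ^ N * b) = h * c by
    linear_combination h1)]

/-- In an algebra of finite type over a domain that is a domain, a nonempty basic open set is
dense in the fibres over a nonempty open subset of the base. -/
theorem exists_forall_prime_comap_eq [IsDomain R] {B : Type} [CommRing B] [IsDomain B]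
    [Algebra R B] [Algebra.FiniteType R B] {h : B} (hh : h ≠ 0) :
    ∃ g : R, g ≠ 0 ∧ ∀ (P : Ideal B) [P.IsPrime] (k : B), algebraMap R B g ∉ P → k ∉ P →
      ∃ P' : Ideal B, P'.IsPrime ∧ P'.comap (algebraMap R B) = P.comap (algebraMap R B) ∧
        h ∉ P' ∧ k ∉ P' := by
  obtain ⟨g, hg, H⟩ := exists_pow_smul_mem_map (R := R) hh
  refine ⟨g, hg, fun P _ k hgP hk => ?_⟩
  set p := P.comap (algebraMap R B)
  -- `P'` is the generic point of a component of the fibre through `P`.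
  obtain ⟨P', hP', hle⟩ := Ideal.exists_minimalPrimes_le (Ideal.map_comap_le : p.map _ ≤ P)
  have hprime := hP'.1.1
  have hgP' : algebraMap R B g ∉ P' := fun hx => hgP (hle hx)
  refine ⟨P', hprime, le_antisymm (Ideal.comap_mono hle) (Ideal.map_le_iff_le_comap.1 hP'.1.2),
    fun hhP => ?_, fun hx => hk (hle hx)⟩
  -- The saturation of `p B` by `g`. An element of a minimal prime over it is a zero divisor modulo
  -- it, which `h` is not by the choice of `g`.
  let I : Ideal B :=
    { carrier := {b | ∃ N : ℕ, algebraMap R B g ^ N * b ∈ p.map (algebraMap R B)}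
      zero_mem' := ⟨0, by simp⟩
      add_mem' := by
        rintro a b ⟨N, hN⟩ ⟨M, hM⟩
        refine ⟨N + M, ?_⟩
        convert Ideal.add_mem _ (Ideal.mul_mem_left _ (algebraMap R B g ^ M) hN)
          (Ideal.mul_mem_left _ (algebraMap R B g ^ N) hM) using 1
        ring
      smul_mem' := by
        rintro c a ⟨N, hN⟩
        refine ⟨N, ?_⟩
        convert Ideal.mul_mem_left _ c hN using 1
        rw [smul_eq_mul]
        ring }
  have hI : P' ∈ I.minimalPrimes := by
    refine ⟨⟨hprime, ?_⟩, fun Q hQ hQP => hP'.2 ⟨hQ.1, fun x hx => hQ.2 ⟨0, by simpa⟩⟩ hQP⟩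
    rintro b ⟨N, hN⟩
    exact (hprime.mem_or_mem (hP'.1.2 hN)).resolve_left fun h => hgP' (hprime.mem_of_pow_mem _ h)
  obtain ⟨y, hy, N, hN⟩ := Ideal.exists_mul_mem_of_mem_minimalPrimes hI hhP
  obtain ⟨M, hM⟩ := H p (algebraMap R B g ^ N * y) (by
    convert hN using 1
    ring)
  exact hy ⟨M + N, by rwa [pow_add, mul_assoc]⟩

end GenericFlatness

/-! ### Density of an open subset in general fibres -/

section GenericDensity

/-- A nonempty open subset of an integral scheme of finite type over an integral affine scheme is
dense in the fibres over a dense open subset of the base. -/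
theorem exists_dense_in_fibres {R : Type} [CommRing R] [IsDomain R] {Z : Scheme.{0}} [IsIntegral Z]
    (f : Z ⟶ Spec (CommRingCat.of R)) [LocallyOfFiniteType f] [QuasiCompact f] (V : Z.Opens)
    (hV : (V : Set Z).Nonempty) :
    ∃ U : (Spec (CommRingCat.of R)).Opens, Dense (U : Set (Spec (CommRingCat.of R))) ∧
      ∀ c ∈ U, f ⁻¹' {c} ⊆ closure ((V : Set Z) ∩ f ⁻¹' {c}) := by
  have hlocal : ∀ W : Z.affineOpens, ∃ g : R, g ≠ 0 ∧ ∀ z ∈ W.1,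
      g ∉ PrimeSpectrum.asIdeal (f z) → z ∈ closure ((V : Set Z) ∩ f ⁻¹' {f z}) := by
    rintro ⟨W, hW : IsAffineOpen W⟩
    dsimp only
    by_cases hne : (W : Set Z).Nonempty
    swap
    · exact ⟨1, one_ne_zero, fun z hz => (hne ⟨z, hz⟩).elim⟩
    have : Nonempty W := hne.to_subtype
    set i := hW.fromSpec
    obtain ⟨φ, hφ⟩ := Spec.map_surjective (i ≫ f)
    have hfin : φ.hom.FiniteType := by
      rw [← HasRingHomProperty.Spec_iff (P := @LocallyOfFiniteType), hφ]
      infer_instance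
    let := φ.hom.toAlgebra
    have : Algebra.FiniteType R Γ(Z, W) := hfin
    have hrange : Set.range i = W := hW.range_fromSpec
    obtain ⟨z₀, hz₀V, hz₀W⟩ := nonempty_preirreducible_inter V.2 W.2 hV hne
    obtain ⟨x₀, hx₀⟩ : z₀ ∈ Set.range i := hrange ▸ hz₀W
    obtain ⟨_, ⟨h, rfl⟩, hx₀h, hhV⟩ :=
      PrimeSpectrum.isTopologicalBasis_basic_opens.exists_subset_of_mem_open
        (show x₀ ∈ i ⁻¹' V by rwa [Set.mem_preimage, hx₀]) (V.2.preimage i.continuous)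
    have hh : h ≠ 0 := by
      rintro rfl
      exact hx₀h (zero_mem x₀.asIdeal)
    obtain ⟨g, hg, H⟩ := exists_forall_prime_comap_eq (R := R) hh
    have hfi : ∀ x : Spec Γ(Z, W), f (i x) = Spec.map φ x := by
      intro x
      rw [hφ, Scheme.Hom.comp_apply]
    refine ⟨g, hg, fun z hz hgz => ?_⟩
    obtain ⟨x, rfl⟩ : z ∈ Set.range i := hrange ▸ hz
    rw [hfi] at hgz
    rw [mem_closure_iff]
    intro O hO hxO
    obtain ⟨_, ⟨k, rfl⟩, hxk, hkO⟩ :=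
      PrimeSpectrum.isTopologicalBasis_basic_opens.exists_subset_of_mem_open
        (show x ∈ i ⁻¹' O from hxO) (hO.preimage i.continuous)
    obtain ⟨P', hP', hcomap, hhP', hkP'⟩ := @H x.asIdeal (PrimeSpectrum.isPrime x) k hgz hxk
    let x' : Spec Γ(Z, W) := ⟨P', hP'⟩
    refine ⟨i x', hkO hkP', hhV hhP', ?_⟩
    rw [Set.mem_preimage, Set.mem_singleton_iff, hfi, hfi]
    exact PrimeSpectrum.ext hcomap
  have hc : CompactSpace Z := (quasiCompact_iff_compactSpace (f := f)).1 inferInstance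
  obtain ⟨s, hs⟩ := isCompact_univ.elim_finite_subcover (fun W : Z.affineOpens => (W.1 : Set Z))
    (fun W => W.1.2) (fun z _ => by
      have h := (iSup_affineOpens_eq_top Z).ge (show z ∈ (⊤ : Z.Opens) from trivial)
      simpa using h)
  choose g hg H using hlocal
  refine ⟨PrimeSpectrum.basicOpen (∏ W ∈ s, g W), ?_, ?_⟩
  · refine (PrimeSpectrum.basicOpen _).2.dense ⟨(⊥ : PrimeSpectrum R), ?_⟩
    change ∏ W ∈ s, g W ∉ (⊥ : Ideal R)
    rw [Ideal.mem_bot]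
    exact Finset.prod_ne_zero_iff.2 fun W _ => hg W
  · rintro _ hc z rfl
    obtain ⟨W, hWs, hzW⟩ := Set.mem_iUnion₂.1 (hs (Set.mem_univ z))
    refine H W z hzW fun hgW => hc ?_
    exact Ideal.mem_of_dvd _ (Finset.dvd_prod_of_mem g hWs) hgW

end GenericDensity
end NefMirror

namespace NefMirror

/-! ### Birational fibres of families with isomorphic open parts -/

section BirationalFibres

open Limits

variable {C Z V : Scheme.{0}} (f : Z ⟶ C) (m : V ⟶ Z) (c : C)

/-- The open immersion of fibres given by an open immersion of families. -/
def fiberInclusion : pullback m (f.fiberι c) ⟶ f.fiber c := pullback.snd _ _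

/-- Base change of `m` to the fibre is a dominant open immersion, and its source is the fibre of `V`
over `c` by associativity of pullbacks. -/
theorem birationalOver_fiberInclusion [IsOpenImmersion m]
    (h : f ⁻¹' {c} ⊆ closure (Set.range m ∩ f ⁻¹' {c})) :
    Scheme.BirationalOver
      (pullback.snd (m ≫ f) (C.fromSpecResidueField c)) (f.fiberToSpecResidueField c) := by
  have hrange : Set.range (fiberInclusion f m c) = f.fiberι c ⁻¹' Set.range m := 
    IsOpenImmersion.range_pullbackSnd _ _
  have hdom : IsDominant (fiberInclusion f m c) := by
    constructor
    rw [DenseRange, hrange]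
    intro z
    rw [(f.fiberι c).isEmbedding.isInducing.closure_eq_preimage_closure_image,
      Set.image_preimage_eq_inter_range, f.range_fiberι]
    apply h
    rw [← f.range_fiberι]
    exact ⟨z, rfl⟩
  have hopen : IsOpenImmersion (fiberInclusion f m c) :=
    inferInstanceAs (IsOpenImmersion (pullback.snd m (f.fiberι c)))
  let e : pullback m (f.fiberι c) ≅ pullback (m ≫ f) (C.fromSpecResidueField c) :=
    pullbackRightPullbackFstIso f (C.fromSpecResidueField c) m
  exact (Scheme.Hom.birationalOver (e.inv ≫ fiberInclusion f m c) _ _ (by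
    rw [Category.assoc, Iso.inv_comp_eq]
    exact (pullbackRightPullbackFstIso_hom_snd _ _ _).symm))

theorem exists_birationalOver_fibres {R : Type} [CommRing R] [IsDomain R]
    {Z₁ Z₂ V₁ V₂ : Scheme.{0}} [IsIntegral Z₁] [IsIntegral Z₂]
    (f₁ : Z₁ ⟶ Spec (CommRingCat.of R)) (f₂ : Z₂ ⟶ Spec (CommRingCat.of R))
    [LocallyOfFiniteType f₁] [QuasiCompact f₁] [LocallyOfFiniteType f₂] [QuasiCompact f₂]
    (m₁ : V₁ ⟶ Z₁) (m₂ : V₂ ⟶ Z₂) [IsOpenImmersion m₁] [IsOpenImmersion m₂] [Nonempty V₁]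
    (e : V₁ ≅ V₂) (he : e.hom ≫ m₂ ≫ f₂ = m₁ ≫ f₁) :
    ∃ U : (Spec (CommRingCat.of R)).Opens, Dense (U : Set (Spec (CommRingCat.of R))) ∧
      ∀ c ∈ U, Scheme.BirationalOver (f₁.fiberToSpecResidueField c)
        (f₂.fiberToSpecResidueField c) := by
  obtain ⟨v⟩ := ‹Nonempty V₁›
  obtain ⟨U₁, hU₁, h₁⟩ := exists_dense_in_fibres f₁ m₁.opensRange ⟨_, v, rfl⟩
  obtain ⟨U₂, hU₂, h₂⟩ := exists_dense_in_fibres f₂ m₂.opensRange ⟨_, e.hom v, rfl⟩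
  refine ⟨U₁ ⊓ U₂, hU₁.inter_of_isOpen_left hU₂ U₁.2, fun c hc => ?_⟩
  refine (birationalOver_fiberInclusion f₁ m₁ c (h₁ c hc.1)).symm.trans
    (Scheme.BirationalOver.trans ?_ (birationalOver_fiberInclusion f₂ m₂ c (h₂ c hc.2)))
  let g := pullback.map (m₁ ≫ f₁) ((Spec (CommRingCat.of R)).fromSpecResidueField c) (m₂ ≫ f₂)
    ((Spec (CommRingCat.of R)).fromSpecResidueField c) e.hom (𝟙 _) (𝟙 _) (by simp [he]) (by simp)
  exact Scheme.Hom.birationalOver g _ _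
    ((pullback.lift_snd _ _ _).trans (Category.comp_id _))

end BirationalFibres
end NefMirror

/-! ### `Z⁽ⁱ⁾` as the closure of its part over the big torus -/

namespace NefMirror

theorem map_irrelevant_eq_top {R A B : Type} [CommRing R] [CommRing A] [Algebra R A]
    (𝒜 : ℕ → Submodule R A) [GradedAlgebra 𝒜] [CommRing B] (ρ : A →+* B) {t : A} (ht : t ∈ 𝒜 1)
    (hρt : ρ t = 1) : ((HomogeneousIdeal.irrelevant 𝒜).toIdeal).map ρ = ⊤ := by
  rw [Ideal.eq_top_iff_one, ← hρt]
  exact Ideal.mem_map_of_mem _ (HomogeneousIdeal.mem_irrelevant_of_mem 𝒜 one_pos ht)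

theorem isImmersion_of_isOpenImmersion {X Y : Scheme.{0}} (f : X ⟶ Y) [IsOpenImmersion f] :
    IsImmersion f := inferInstance

theorem isImmersion_comp {X Y Z : Scheme.{0}} (f : X ⟶ Y) (g : Y ⟶ Z) [IsImmersion f]
    [IsImmersion g] : IsImmersion (f ≫ g) := inferInstance

theorem quasiCompact_of_isSeparated {X Y : Scheme.{0}} (f : X ⟶ Y) [CompactSpace X]
    [Y.IsSeparated] : QuasiCompact f := inferInstance

theorem _root_.Topology.IsOpenEmbedding.mem_closure_image_iff {X Y : Type*} [TopologicalSpace X]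
    [TopologicalSpace Y] {f : X → Y} (hf : Topology.IsOpenEmbedding f) {s : Set X}
    (hs : IsClosed s) {x : X} : f x ∈ closure (f '' s) ↔ x ∈ s := by
  rw [← Set.mem_preimage, hf.isOpenMap.preimage_closure_eq_closure_preimage hf.continuous,
    Set.preimage_image_eq _ hf.injective, hs.closure_eq]

namespace NefPartition

variable {n r : ℕ} (Δ : NefPartition n r) (R : Type) [CommRing R]

/-- A lattice point of `0 • P` is zero, so only constants have degree zero. -/
theorem toBase_surjective : Function.Surjective (algebraMap R (Δ.grading R 0)) := by
  have h : ∀ a ∈ Δ.grading R 0, ∃ z : R, AddMonoidAlgebra.single 0 z = a := by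
    intro a ha
    refine Δ.mem_grading_induction (p := fun a => ∃ z : R, AddMonoidAlgebra.single 0 z = a)
      ⟨0, AddMonoidAlgebra.single_zero _⟩ ?_ ?_ ha
    · rintro _ _ ⟨z, rfl⟩ ⟨w, rfl⟩
      exact ⟨z + w, AddMonoidAlgebra.single_add _ _ _⟩
    · intro x z hx
      refine ⟨z, ?_⟩
      congr 1
      apply Subtype.ext
      obtain ⟨p, -, hp⟩ := x.2
      have h1 : toReal x.1.1 = 0 := by
        rw [← hp, hx]
        simp
      ext1
      · exact (toReal_injective (by rw [h1]; exact toReal_zero.symm)).symm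
      · exact hx.symm
  rintro ⟨a, ha⟩
  obtain ⟨z, hz⟩ := h a ha
  exact ⟨z, Subtype.ext hz⟩

instance : AddMonoid.FG Δ.coneMonoid :=
  (AddMonoid.fg_iff_addSubmonoid_fg _).2 Δ.fg_coneMonoid

instance : Algebra.FiniteType (Δ.grading R 0) (Δ.CoordRing R) :=
  have : IsScalarTower R (Δ.grading R 0) (Δ.CoordRing R) :=
    IsScalarTower.of_algebraMap_eq (R := R) (S := Δ.grading R 0) (A := Δ.CoordRing R) fun _ => rfl
  Algebra.FiniteType.of_restrictScalars_finiteType R _ _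

instance : LocallyOfFiniteType (Δ.toBase R) := by
  have : LocallyOfFiniteType (Spec.map (CommRingCat.ofHom (algebraMap R (Δ.grading R 0)))) := by
    rw [HasRingHomProperty.Spec_iff (P := @LocallyOfFiniteType)]
    exact RingHom.FiniteType.of_surjective _ (Δ.toBase_surjective R)
  have h : LocallyOfFiniteType (Proj.toSpecZero (Δ.grading R)) := inferInstance
  exact MorphismProperty.comp_mem _ _ _ h this

instance : QuasiCompact (Δ.toBase R) := by
  have h : QuasiCompact (Proj.toSpecZero (Δ.grading R)) := inferInstance
  have h' : QuasiCompact (Spec.map (CommRingCat.ofHom (algebraMap R (Δ.grading R 0)))) :=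
    inferInstance
  exact MorphismProperty.comp_mem _ _ _ h h'

theorem irrelevant_map_toTorus : ((HomogeneousIdeal.irrelevant (Δ.grading R)).toIdeal).map
    ((Scheme.ΓSpecIso (CommRingCat.of (AddMonoidAlgebra R (Fin n → ℤ)))).inv.hom.comp
      (Δ.toTorus R)) = ⊤ :=
  map_irrelevant_eq_top _ _ (Δ.coordT_mem (R := R)) (by
    rw [RingHom.comp_apply, toTorus_coordT, map_one])

/-- The inclusion of the big torus in the toric variety. -/
def torusInclusion : Spec (CommRingCat.of (AddMonoidAlgebra R (Fin n → ℤ))) ⟶ Δ.toricVariety R :=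
  specToProj (Δ.grading R) (Δ.irrelevant_map_toTorus R)

instance : IsOpenImmersion (Δ.torusInclusion R) :=
  isOpenImmersion_specToProj (Δ.grading R) (Δ.irrelevant_map_toTorus R) (Δ.coordT_mem (R := R))
    (Δ.toTorus_coordT) (Δ.eq_zero_of_toTorus_eq_zero) (Δ.exists_mem_grading_toTorus_eq)

theorem torusInclusion_toBase : Δ.torusInclusion R ≫ Δ.toBase R =
    Spec.map (CommRingCat.ofHom (algebraMap R (AddMonoidAlgebra R (Fin n → ℤ)))) := by
  have h := Proj.fromOfGlobalSections_toSpecZero (Δ.grading R) _ (Δ.irrelevant_map_toTorus R)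
  have h2 : Δ.torusInclusion R ≫ Proj.toSpecZero (Δ.grading R) =
      Spec.map (CommRingCat.ofHom ((Δ.toTorus R).comp (algebraMap (Δ.grading R 0) _))) := by
    refine h.trans ?_
    rw [RingHom.comp_assoc, CommRingCat.ofHom_comp, Spec.map_comp, ← Category.assoc]
    convert Category.id_comp _
    exact toSpecΓ_SpecMap_ΓSpecIso_inv _
  have h3 : Δ.torusInclusion R ≫ Δ.toBase R = (Δ.torusInclusion R ≫
      Proj.toSpecZero (Δ.grading R)) ≫
        Spec.map (CommRingCat.ofHom (algebraMap R (Δ.grading R 0))) :=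
    (Category.assoc _ _ _).symm
  rw [h3, h2, ← Spec.map_comp, ← CommRingCat.ofHom_comp]
  congr 2
  exact RingHom.ext fun z => Δ.toTorus_single R 0 z

end NefPartition

namespace MultipleMirrors

variable {n r : ℕ} (D : MultipleMirrors n r)

/-- The ring of functions on `Z⁽ⁱ⁾` over the big torus. -/
def EquationRing (i : Fin 2) : Type := D.BaseRing ⧸ D.equationIdeal i

instance (i : Fin 2) : CommRing (D.EquationRing i) :=
  inferInstanceAs (CommRing (D.BaseRing ⧸ D.equationIdeal i))

instance (i : Fin 2) : IsDomain (D.EquationRing i) :=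
  inferInstanceAs (IsDomain (D.BaseRing ⧸ D.equationIdeal i))

/-- The restriction of functions to `Z⁽ⁱ⁾`. -/
def toEquationRing (i : Fin 2) : D.BaseRing →+* D.EquationRing i :=
  Ideal.Quotient.mk (D.equationIdeal i)

theorem toEquationRing_surjective (i : Fin 2) : Function.Surjective (D.toEquationRing i) :=
  Ideal.Quotient.mk_surjective

theorem toEquationRing_eq_zero_iff {i : Fin 2} {a : D.BaseRing} :
    D.toEquationRing i a = 0 ↔ a ∈ D.equationIdeal i := Ideal.Quotient.eq_zero_iff_mem

theorem toEquationRing_sect (i : Fin 2) (k : Fin r) : D.toEquationRing i (D.sect i k) = 0 :=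
  D.toEquationRing_eq_zero_iff.2 (D.sect_mem_equationIdeal i k)

theorem ker_toEquationRing (i : Fin 2) : RingHom.ker (D.toEquationRing i) = D.equationIdeal i :=
  Ideal.mk_ker

/-- The part of `Z⁽ⁱ⁾` over the big torus, in `Y⁽ⁱ⁾`. -/
def equationInclusion (i : Fin 2) : Spec (CommRingCat.of (D.EquationRing i)) ⟶ D.ambient i :=
  Spec.map (CommRingCat.ofHom (D.toEquationRing i)) ≫ (D.Δ i).torusInclusion D.CoeffRing

/-- The saturation statement `exists_pow_mul_mem` says that no component of `Z⁽ⁱ⁾`, embedded or not,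
is supported on the toric boundary. -/
theorem idealSheaf_eq_ker (i : Fin 2) : D.idealSheaf i = (D.equationInclusion i).ker :=
  projIdealSheaf_eq_ker ((D.Δ i).grading D.CoeffRing) ((D.Δ i).irrelevant_map_toTorus D.CoeffRing)
    (D.zeroIdeal_le_comap i) (D.Δ i).coordT_mem (D.Δ i).toTorus_coordT (D.exists_pow_mul_mem i)

theorem isImmersion_equationInclusion (i : Fin 2) : IsImmersion (D.equationInclusion i) := by
  have h1 : IsClosedImmersion (Spec.map (CommRingCat.ofHom (D.toEquationRing i))) :=
    IsClosedImmersion.spec_of_surjective _ (D.toEquationRing_surjective i)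
  have h2 : IsImmersion ((D.Δ i).torusInclusion D.CoeffRing) :=
    isImmersion_of_isOpenImmersion ((D.Δ i).torusInclusion D.CoeffRing)
  exact @isImmersion_comp _ _ _ _ _ inferInstance h2

theorem quasiCompact_equationInclusion (i : Fin 2) : QuasiCompact (D.equationInclusion i) := by
  have : (D.ambient i).IsSeparated :=
    inferInstanceAs (Scheme.IsSeparated (Proj ((D.Δ i).grading D.CoeffRing)))
  exact quasiCompact_of_isSeparated _

theorem exists_isOpenImmersion (i : Fin 2) : IsIntegral (D.Z i) ∧
    ∃ m : Spec (CommRingCat.of (D.EquationRing i)) ⟶ D.Z i,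
      m ≫ D.ι i = D.equationInclusion i ∧ IsOpenImmersion m := by
  have := D.isImmersion_equationInclusion i
  have := D.quasiCompact_equationInclusion i
  exact exists_isOpenImmersion_subscheme (D.idealSheaf i) (D.equationInclusion i)
    (D.idealSheaf_eq_ker i)

instance (i : Fin 2) : IsIntegral (D.Z i) := (D.exists_isOpenImmersion i).1

/-- The part of `Z⁽ⁱ⁾` over the big torus. -/
def torusChart (i : Fin 2) : Spec (CommRingCat.of (D.EquationRing i)) ⟶ D.Z i :=
  (D.exists_isOpenImmersion i).2.choose

theorem torusChart_ι (i : Fin 2) : D.torusChart i ≫ D.ι i = D.equationInclusion i :=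
  (D.exists_isOpenImmersion i).2.choose_spec.1

instance (i : Fin 2) : IsOpenImmersion (D.torusChart i) :=
  (D.exists_isOpenImmersion i).2.choose_spec.2

instance (i : Fin 2) : IsClosedImmersion (D.ι i) :=
  inferInstanceAs (IsClosedImmersion (D.idealSheaf i).subschemeι)

instance (i : Fin 2) : LocallyOfFiniteType (D.toCoeff i) := by
  unfold toCoeff
  have : LocallyOfFiniteType ((D.Δ i).toBase D.CoeffRing) := inferInstance
  exact MorphismProperty.comp_mem _ _ _ inferInstance this

instance (i : Fin 2) : QuasiCompact (D.toCoeff i) := by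
  unfold toCoeff
  have : QuasiCompact ((D.Δ i).toBase D.CoeffRing) := inferInstance
  exact MorphismProperty.comp_mem _ _ _ inferInstance this

theorem torusChart_toCoeff (i : Fin 2) : D.torusChart i ≫ D.toCoeff i =
    Spec.map (CommRingCat.ofHom
      ((D.toEquationRing i).comp (algebraMap D.CoeffRing D.BaseRing))) := by
  have h1 : D.torusChart i ≫ D.toCoeff i =
      (D.torusChart i ≫ D.ι i) ≫ (D.Δ i).toBase D.CoeffRing := (Category.assoc _ _ _).symm
  have h2 := congrArg (Spec.map (CommRingCat.ofHom (D.toEquationRing i)) ≫ ·)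
    ((D.Δ i).torusInclusion_toBase D.CoeffRing)
  rw [h1, torusChart_ι]
  refine ((Category.assoc _ _ _).trans h2).trans ?_
  exact (Spec.map_comp _ _).symm

/-- The inclusion of the functions on the big torus in the functions on `T`. -/
def baseHom (i : Fin 2) : D.BaseRing →+* D.TorusRing :=
  AddMonoidAlgebra.mapDomainRingHom D.CoeffRing (D.baseChar i)

theorem pullbackHom_eq (i : Fin 2) :
    D.pullbackHom i = (D.baseHom i).comp ((D.Δ i).toTorus D.CoeffRing) := by
  rw [pullbackHom, baseHom, NefPartition.toTorus, ← AddMonoidAlgebra.mapDomainRingHom_comp]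

theorem proj_eq (i : Fin 2) : D.proj i =
    Spec.map (CommRingCat.ofHom (D.baseHom i)) ≫ (D.Δ i).torusInclusion D.CoeffRing := by
  have h1 : D.pullbackHom i = (RingHom.id _).comp (D.pullbackHom i) := rfl
  have hu : IsUnit (D.pullbackHom i (D.Δ i).coordT) := by
    rw [pullbackHom_eq, RingHom.comp_apply, NefPartition.toTorus_coordT, map_one]
    exact isUnit_one
  have h2 := SpecMap_specToProj ((D.Δ i).grading D.CoeffRing) (D.map_irrelevant i)
    (RingHom.id D.TorusRing) _ h1 (D.Δ i).coordT_mem one_pos hu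
  have h3 := SpecMap_specToProj ((D.Δ i).grading D.CoeffRing)
    ((D.Δ i).irrelevant_map_toTorus D.CoeffRing)
    (D.baseHom i) _ (D.pullbackHom_eq i) (D.Δ i).coordT_mem one_pos hu
  refine Eq.trans ?_ (h2.trans h3.symm)
  rw [CommRingCat.ofHom_id, Spec.map_id]
  exact (Category.id_comp _).symm

/-- A point of `T` lies over `Z⁽ⁱ⁾` if and only if the equations of `Z⁽ⁱ⁾` vanish at it. -/
theorem proj_mem_range_ι_iff (i : Fin 2) (x : PrimeSpectrum D.TorusRing) :
    D.proj i x ∈ Set.range (D.ι i) ↔ D.equationIdeal i ≤ x.asIdeal.comap (D.baseHom i) := by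
  have := D.quasiCompact_equationInclusion i
  -- Taking the closure adds no points inside the open torus, where the zero locus is already
  -- closed.
  have h1 : Set.range (D.ι i) = closure (Set.range (D.equationInclusion i)) := by
    rw [← Scheme.Hom.support_ker, ← idealSheaf_eq_ker]
    exact Scheme.IdealSheafData.range_subschemeι _
  have h2 : Set.range (D.equationInclusion i) = (D.Δ i).torusInclusion D.CoeffRing ''
      PrimeSpectrum.zeroLocus (D.equationIdeal i) := by
    have h3 : Set.range (Spec.map (CommRingCat.ofHom (D.toEquationRing i))) =
        PrimeSpectrum.zeroLocus (D.equationIdeal i) := by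
      rw [← ker_toEquationRing]
      exact range_comap_of_surjective _ _ (D.toEquationRing_surjective i)
    rw [← h3, ← Set.range_comp]
    rfl
  have h4 := ((D.Δ i).torusInclusion D.CoeffRing).isOpenEmbedding
  have h5 : D.proj i x = (D.Δ i).torusInclusion D.CoeffRing
      (Spec.map (CommRingCat.ofHom (D.baseHom i)) x) := by
    rw [proj_eq]
    rfl
  rw [h1, h2, h5]
  exact h4.mem_closure_image_iff (PrimeSpectrum.isClosed_zeroLocus _)

end MultipleMirrors
end NefMirror

namespace NefMirror

/-! ### Block matrices with zero row sums and their cofactor null vectors -/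

section Grounded

open Matrix

variable {ι : Type*} [Fintype ι] [DecidableEq ι] (ρ : ι → ι)

/-- The indicator function of the fixed points of `ρ`, the roots of the blocks. -/
def rootVec (K : Type*) [CommRing K] : ι → K := fun a => if ρ a = a then 1 else 0

section CommRing

variable {K L : Type*} [CommRing K] [CommRing L] (w : Matrix ι ι K)

/-- The matrix obtained by adding one to the diagonal entries at the roots. -/
def grounded : Matrix ι ι K := w + diagonal (rootVec ρ K)

/-- The left null vector of a matrix with zero row sums, given by cofactors. -/
def leftNull : ι → K := rootVec ρ K ᵥ* (grounded ρ w).adjugate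

/-- The function whose non-vanishing says that the corank is the number of roots and that the left
null vector is nowhere zero. -/
def discr : K := (grounded ρ w).det * ∏ a, leftNull ρ w a

variable (f : K →+* L)

omit [Fintype ι] in
theorem map_grounded : grounded ρ (w.map f) = (grounded ρ w).map f := by
  ext a b
  simp only [grounded, rootVec, Matrix.add_apply, map_apply, map_add, diagonal_apply]
  split_ifs <;> simp

theorem map_det_grounded : (grounded ρ (w.map f)).det = f (grounded ρ w).det := by
  rw [map_grounded, RingHom.map_det]
  rfl

theorem map_leftNull (a : ι) : leftNull ρ (w.map f) a = f (leftNull ρ w a) := by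
  have h := f.map_adjugate (grounded ρ w)
  simp only [RingHom.mapMatrix_apply] at h
  rw [leftNull, map_grounded, ← h]
  simp only [vecMul, dotProduct, leftNull, map_sum, map_mul, map_apply, rootVec]
  refine Finset.sum_congr rfl fun b _ => ?_
  split_ifs <;> simp

theorem map_discr : discr ρ (w.map f) = f (discr ρ w) := by
  rw [discr, discr, map_mul, map_prod, map_det_grounded]
  simp_rw [map_leftNull]

theorem leftNull_vecMul_grounded :
    leftNull ρ w ᵥ* grounded ρ w = (grounded ρ w).det • rootVec ρ K := by
  rw [leftNull, vecMul_vecMul, adjugate_mul, vecMul_smul, vecMul_one]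

variable {ρ w}

theorem isUnit_of_isUnit_discr (h : IsUnit (discr ρ w)) : IsUnit (grounded ρ w).det :=
  isUnit_of_mul_isUnit_left h

theorem isUnit_leftNull_of_isUnit_discr (h : IsUnit (discr ρ w)) (a : ι) :
    IsUnit (leftNull ρ w a) := by
  have h1 := isUnit_of_mul_isUnit_right h
  rw [← Finset.mul_prod_erase _ _ (Finset.mem_univ a)] at h1
  exact isUnit_of_mul_isUnit_left h1

theorem grounded_mulVec_one (h1 : w *ᵥ 1 = 0) : grounded ρ w *ᵥ 1 = rootVec ρ K := by
  rw [grounded, add_mulVec, h1, zero_add]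
  ext a
  rw [mulVec_diagonal, Pi.one_apply, mul_one]

theorem eq_leftNull_of_vecMul (hu : IsUnit (grounded ρ w).det) {t : ι → K}
    (ht : t ᵥ* grounded ρ w = (grounded ρ w).det • rootVec ρ K) : t = leftNull ρ w := by
  rw [← leftNull_vecMul_grounded] at ht
  have h := congrArg (· ᵥ* (grounded ρ w)⁻¹) ht
  simpa [vecMul_vecMul, mul_nonsing_inv _ hu] using h

variable (hw : ∀ a b, ρ a ≠ ρ b → w a b = 0)

/-- The indicator function of the block of `c`. -/
def blockVec (ρ : ι → ι) (K : Type*) [CommRing K] (c : ι) : ι → K :=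
  fun a => if ρ a = c then 1 else 0

include hw in
theorem mulVec_blockVec (h1 : w *ᵥ 1 = 0) (c : ι) : w *ᵥ blockVec ρ K c = 0 := by
  ext a
  have ha := congrFun h1 a
  simp only [mulVec, dotProduct, Pi.one_apply, mul_one, Pi.zero_apply] at ha ⊢
  by_cases hac : ρ a = c
  · rw [← ha]
    refine Finset.sum_congr rfl fun b _ => ?_
    by_cases hab : ρ a = ρ b
    · rw [blockVec, if_pos (by rw [← hab, hac]), mul_one]
    · rw [hw a b hab, zero_mul]
  · refine Finset.sum_eq_zero fun b _ => ?_
    by_cases hab : ρ a = ρ b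
    · rw [blockVec, if_neg (by rwa [← hab]), mul_zero]
    · rw [hw a b hab, zero_mul]

include hw in
-- The grounded matrix sends the indicator of the block of `c` to the basis vector at the root `c`;
-- pairing with `leftNull` reads off its entry there.
theorem leftNull_eq_det (h1 : w *ᵥ 1 = 0) {c : ι} (hc : ρ c = c) :
    leftNull ρ w c = (grounded ρ w).det := by
  have h2 : grounded ρ w *ᵥ blockVec ρ K c = Pi.single c 1 := by
    rw [grounded, add_mulVec, mulVec_blockVec hw h1, zero_add]
    ext a
    rw [mulVec_diagonal, rootVec, blockVec, Pi.single_apply]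
    by_cases h : a = c
    · subst h
      simp [hc]
    · by_cases h' : ρ a = a
      · simp [h, h']
      · simp [h, h']
  have h3 : leftNull ρ w ⬝ᵥ (grounded ρ w *ᵥ blockVec ρ K c) =
      (grounded ρ w).det • (rootVec ρ K ⬝ᵥ blockVec ρ K c) := by
    rw [dotProduct_mulVec, leftNull_vecMul_grounded, smul_dotProduct]
  rw [h2, dotProduct_single_one] at h3
  rw [h3]
  have h4 : rootVec ρ K ⬝ᵥ blockVec ρ K c = 1 := by
    rw [dotProduct, Finset.sum_eq_single c]
    · simp [rootVec, blockVec, hc]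
    · intro b _ hb
      rw [rootVec, blockVec]
      by_cases h : ρ b = b
      · simp [h, hb]
      · simp [h]
    · simp
  rw [h4, smul_eq_mul, mul_one]

include hw in
-- At the roots, the contribution of the added diagonal is exactly the determinant on the right of
-- `leftNull_vecMul_grounded`.
theorem leftNull_vecMul (h1 : w *ᵥ 1 = 0) : leftNull ρ w ᵥ* w = 0 := by
  have h2 := leftNull_vecMul_grounded ρ w
  rw [grounded, vecMul_add, ← grounded, ← eq_sub_iff_add_eq] at h2
  rw [h2]
  ext a
  rw [Pi.sub_apply, vecMul_diagonal, Pi.smul_apply, rootVec]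
  split_ifs with h
  · rw [leftNull_eq_det hw h1 h]
    simp
  · simp

/-- The null vector of the transposed matrix, after the rescaling that makes its row sums zero. -/
theorem leftNull_eq_of_conj {w' : Matrix ι ι K} (h1 : w *ᵥ 1 = 0)
    (hw : ∀ a b, ρ a ≠ ρ b → w a b = 0) (hu : ∀ a, IsUnit (leftNull ρ w a))
    (hdet : IsUnit (grounded ρ w).det)
    (hw' : ∀ a b, leftNull ρ w a * w' a b = w b a * leftNull ρ w b) :
    (grounded ρ w').det = (grounded ρ w).det ∧ leftNull ρ w' = leftNull ρ w := by
  -- Rescaling by the null vector respects grounding, since the added matrix is diagonal and so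
  -- commutes with the rescaling.
  have hconj : diagonal (leftNull ρ w) * grounded ρ w' =
      (grounded ρ w)ᵀ * diagonal (leftNull ρ w) := by
    ext a b
    rw [diagonal_mul, mul_diagonal, transpose_apply, grounded, grounded, Matrix.add_apply,
      Matrix.add_apply, mul_add, add_mul, hw']
    congr 1
    by_cases hab : a = b
    · subst hab
      rw [mul_comm]
    · rw [diagonal_apply_ne _ hab, diagonal_apply_ne' _ hab, mul_zero, zero_mul]
  have hd : (grounded ρ w').det = (grounded ρ w).det := by
    have h := congrArg det hconj
    rw [det_mul, det_mul, det_transpose, mul_comm] at h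
    have hD : IsUnit (diagonal (leftNull ρ w)).det := by
      rw [det_diagonal]
      exact IsUnit.prod_univ_iff.2 hu
    exact hD.mul_right_cancel h
  refine ⟨hd, (eq_leftNull_of_vecMul (by rwa [hd]) ?_).symm⟩
  -- Through `hconj`, the equation characterizing the null vector of `w'` becomes the statement that
  -- `grounded ρ w` maps `1` to `rootVec`.
  have h2 : leftNull ρ w = 1 ᵥ* diagonal (leftNull ρ w) := by
    ext a
    rw [vecMul_diagonal, Pi.one_apply, one_mul]
  rw [h2, vecMul_vecMul, hconj, ← vecMul_vecMul, vecMul_transpose, grounded_mulVec_one h1, hd]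
  ext a
  rw [vecMul_diagonal, Pi.smul_apply, rootVec]
  split_ifs with h
  · rw [leftNull_eq_det hw h1 h, one_mul, smul_eq_mul, mul_one]
  · simp

end CommRing

section Field

variable {ρ} {K : Type*} [Field K] {w : Matrix ι ι K}
  (hw : ∀ a b, ρ a ≠ ρ b → w a b = 0)

include hw in
-- The block indicators are in the kernel, so subtracting from a vector its root value on each block
-- does not affect `w`, and `w` factors through the projection `E` to the non-root coordinates.
theorem rank_add_card_le (h1 : w *ᵥ 1 = 0) :
    w.rank + Fintype.card {a // ρ a = a} ≤ Fintype.card ι := by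
  let Q : Matrix ι ι K := fun a b => if ρ a = b then 1 else 0
  have hQ : w * Q = 0 := by
    ext a b
    exact congrFun (mulVec_blockVec hw h1 b) a
  let E : Matrix ι ι K := diagonal fun a => if ρ a = a then 0 else 1
  have hE : E * (1 - Q) = 1 - Q := by
    ext a b
    rw [diagonal_mul, Matrix.sub_apply]
    split_ifs with h
    · simp only [Q, one_apply, h, zero_mul, sub_self]
    · rw [one_mul]
  have h2 : w = w * E * (1 - Q) := by
    rw [mul_assoc, hE, mul_sub, hQ, mul_one, sub_zero]
  have h3 : w.rank ≤ E.rank := by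
    rw [h2]
    exact (rank_mul_le_left _ _).trans (rank_mul_le_right _ _)
  have h4 : E.rank + Fintype.card {a // ρ a = a} = Fintype.card ι := by
    classical
    rw [rank_diagonal]
    have : Fintype.card {a // (if ρ a = a then (0 : K) else 1) ≠ 0} =
        Fintype.card {a // ¬ ρ a = a} :=
      Fintype.card_congr (Equiv.subtypeEquivRight fun a => by simp)
    rw [this, Fintype.card_subtype_compl]
    have := Fintype.card_subtype_le fun a => ρ a = a
    omega
  omega

omit [DecidableEq ι] in
theorem _root_.Matrix.rank_add_le (A B : Matrix ι ι K) : (A + B).rank ≤ A.rank + B.rank := by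
  have h : LinearMap.range (A + B).mulVecLin ≤
      LinearMap.range A.mulVecLin ⊔ LinearMap.range B.mulVecLin := by
    rintro _ ⟨x, rfl⟩
    rw [mulVecLin_add, LinearMap.add_apply]
    exact Submodule.add_mem_sup ⟨x, rfl⟩ ⟨x, rfl⟩
  exact (Submodule.finrank_mono h).trans (Submodule.finrank_add_le_finrank_add_finrank _ _)

include hw in
-- An invertible matrix differs from `w` by one whose rank is the number of roots.
theorem rank_add_card_eq (h1 : w *ᵥ 1 = 0) (hdet : (grounded ρ w).det ≠ 0) :
    w.rank + Fintype.card {a // ρ a = a} = Fintype.card ι := by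
  apply le_antisymm (rank_add_card_le hw h1)
  have h2 : (grounded ρ w).rank = Fintype.card ι :=
    rank_of_isUnit _ ((isUnit_iff_isUnit_det _).2 hdet.isUnit)
  have h3 : (diagonal (rootVec ρ K)).rank = Fintype.card {a // ρ a = a} := by
    classical
    rw [rank_diagonal]
    exact Fintype.card_congr (Equiv.subtypeEquivRight fun a => by simp [rootVec])
  rw [← h2, ← h3]
  exact rank_add_le _ _

include hw in
-- Let `x` be in the kernel of the grounded matrix. Pairing with `t` restricted to a block shows
-- that `x` vanishes at the root, so `w x = 0`. By the rank hypothesis a vector in the kernel of `w`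
-- is determined by its root values, hence `x = 0`.
theorem det_grounded_ne_zero {t : ι → K} (h1 : w *ᵥ 1 = 0) (ht : ∀ a, t a ≠ 0) (htw : t ᵥ* w = 0)
    (hrank : w.rank + Fintype.card {a // ρ a = a} = Fintype.card ι) :
    (grounded ρ w).det ≠ 0 := by
  intro hdet
  obtain ⟨x, hx0, hx⟩ := exists_mulVec_eq_zero_iff.2 hdet
  have htb : ∀ c, (fun a => t a * blockVec ρ K c a) ᵥ* w = 0 := by
    intro c
    ext b
    have hb := congrFun htw b
    simp only [vecMul, dotProduct, Pi.zero_apply] at hb ⊢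
    by_cases hbc : ρ b = c
    · rw [← hb]
      refine Finset.sum_congr rfl fun a _ => ?_
      by_cases hab : ρ a = ρ b
      · rw [blockVec, if_pos (by rw [hab, hbc]), mul_one]
      · rw [hw a b hab, mul_zero, mul_zero]
    · refine Finset.sum_eq_zero fun a _ => ?_
      by_cases hab : ρ a = ρ b
      · rw [blockVec, if_neg (by rwa [hab]), mul_zero, zero_mul]
      · rw [hw a b hab, mul_zero]
  have hroot : ∀ c, ρ c = c → x c = 0 := by
    intro c hc
    have h2 := congrArg ((fun a => t a * blockVec ρ K c a) ⬝ᵥ ·) hx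
    rw [dotProduct_mulVec, grounded, vecMul_add, htb, zero_add, dotProduct_zero, dotProduct,
      Finset.sum_eq_single c] at h2
    · simpa [vecMul_diagonal, rootVec, blockVec, hc, ht] using h2
    · intro b _ hb
      rw [vecMul_diagonal, blockVec, rootVec]
      by_cases h : ρ b = b
      · simp [h, hb]
      · simp [h]
    · simp
  have hwx : w *ᵥ x = 0 := by
    rw [grounded, add_mulVec] at hx
    rw [← hx, left_eq_add]
    ext a
    rw [mulVec_diagonal, rootVec]
    split_ifs with h
    · simp [hroot a h]
    · simp
  let f : LinearMap.ker w.mulVecLin →ₗ[K] ({a // ρ a = a} → K) :=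
    (LinearMap.funLeft K K (Subtype.val : {a // ρ a = a} → ι)).comp (Submodule.subtype _)
  have hf : ∀ y a, f y a = y.1 a.1 := fun _ _ => rfl
  have hsurj : Function.Surjective f := by
    intro z
    let y : ι → K := ∑ c : {a // ρ a = a}, z c • blockVec ρ K c.1
    have hy : w.mulVecLin y = 0 := by
      rw [map_sum]
      refine Finset.sum_eq_zero fun c _ => ?_
      rw [map_smul, mulVecLin_apply, mulVec_blockVec hw h1, smul_zero]
    refine ⟨⟨y, hy⟩, funext fun a => ?_⟩
    rw [hf]
    simp only [y, Finset.sum_apply, Pi.smul_apply, smul_eq_mul, blockVec, a.2, mul_ite, mul_one,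
      mul_zero]
    rw [Finset.sum_eq_single a]
    · simp
    · intro c _ hc
      rw [if_neg fun h => hc (Subtype.ext h.symm)]
    · simp
  have hdim : Module.finrank K (LinearMap.ker w.mulVecLin) =
      Module.finrank K ({a // ρ a = a} → K) := by
    have h2 := LinearMap.finrank_range_add_finrank_ker w.mulVecLin
    rw [Module.finrank_fintype_fun_eq_card] at h2 ⊢
    change w.rank + _ = _ at h2
    omega
  have hinj := (LinearMap.injective_iff_surjective_of_finrank_eq_finrank hdim).2 hsurj
  apply hx0
  have h2 : f ⟨x, hwx⟩ = f 0 := by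
    ext a
    rw [map_zero, hf, Pi.zero_apply]
    exact hroot a.1 a.2
  exact congrArg Subtype.val (hinj h2)

include hw in
-- Rescaling `t` on each block so that its root value is the determinant gives a vector satisfying
-- the equation that characterizes `leftNull`.
theorem discr_ne_zero {t : ι → K} (h1 : w *ᵥ 1 = 0) (ht : ∀ a, t a ≠ 0) (htw : t ᵥ* w = 0)
    (hrank : w.rank + Fintype.card {a // ρ a = a} = Fintype.card ι) : discr ρ w ≠ 0 := by
  have hdet := det_grounded_ne_zero hw h1 ht htw hrank
  let s : ι → K := fun a => (grounded ρ w).det * (t a / t (ρ a))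
  have hs : s ᵥ* grounded ρ w = (grounded ρ w).det • rootVec ρ K := by
    ext b
    rw [grounded, vecMul_add, ← grounded, Pi.add_apply, vecMul_diagonal, Pi.smul_apply, smul_eq_mul]
    have h2 : (s ᵥ* w) b = 0 := by
      have hb := congrFun htw b
      have h3 : (s ᵥ* w) b = (grounded ρ w).det / t (ρ b) * (t ᵥ* w) b := by
        simp only [vecMul, dotProduct, Finset.mul_sum]
        refine Finset.sum_congr rfl fun a _ => ?_
        by_cases hab : ρ a = ρ b
        · simp only [s, hab]
          ring
        · rw [hw a b hab, mul_zero, mul_zero, mul_zero]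
      rw [h3, hb, Pi.zero_apply, mul_zero]
    rw [h2, zero_add, rootVec]
    split_ifs with h
    · simp only [s, h]
      rw [div_self (ht b), mul_one]
    · simp
  have h2 := eq_leftNull_of_vecMul hdet.isUnit hs
  refine mul_ne_zero hdet (Finset.prod_ne_zero_iff.2 fun a _ => ?_)
  rw [← h2]
  exact mul_ne_zero hdet (div_ne_zero (ht a) (ht _))

end Field

theorem _root_.Relation.ReflTransGen.of_forall {α : Type*} {R : α → α → Prop} {p : α → Prop}
    {a b : α} (h : Relation.ReflTransGen R a b) (ha : p a) (hR : ∀ c d, R c d → p c → p d) :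
    p b := by
  induction h with
  | refl => exact ha
  | tail _ hcd ih => exact hR _ _ hcd ih

section Real

variable {ρ} {w : Matrix ι ι ℝ} (hρ : ∀ a, ρ (ρ a) = ρ a) (h1 : w *ᵥ 1 = 0)
  (hneg : ∀ a b, a ≠ b → w a b ≤ 0)
  (hconn : ∀ a b, ρ a = ρ b → Relation.ReflTransGen (fun a b => a ≠ b → w a b < 0) a b)

omit [DecidableEq ι] in
include h1 in
theorem mulVec_eq_sum_sub (y : ι → ℝ) (a : ι) :
    (w *ᵥ y) a = ∑ b, w a b * (y b - y a) := by
  have ha := congrFun h1 a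
  simp only [mulVec, dotProduct, Pi.one_apply, mul_one, Pi.zero_apply] at ha ⊢
  simp_rw [mul_sub, Finset.sum_sub_distrib, ← Finset.sum_mul, ha]
  ring

include h1 hneg in
theorem mulVec_nonpos_of_forall_le {y : ι → ℝ} {a : ι} (ha : ∀ b, y a ≤ y b) :
    (w *ᵥ y) a ≤ 0 ∧ ((w *ᵥ y) a = 0 → ∀ b, w a b < 0 → y b = y a) := by
  have h2 : ∀ b ∈ Finset.univ, w a b * (y b - y a) ≤ 0 := by
    intro b _
    by_cases h : a = b
    · subst h
      simp
    · exact mul_nonpos_of_nonpos_of_nonneg (hneg a b h) (sub_nonneg.2 (ha b))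
  rw [mulVec_eq_sum_sub h1]
  refine ⟨Finset.sum_nonpos h2, fun h b hb => ?_⟩
  have h3 := (Finset.sum_eq_zero_iff_of_nonpos h2).1 h b (Finset.mem_univ b)
  have := (mul_eq_zero.1 h3).resolve_left hb.ne
  linarith

include hρ h1 hneg hconn in
-- Minimum principle: a negative minimum propagates along arrows to the root of its block, where the
-- added diagonal entry makes the product negative.
theorem nonneg_of_grounded_mulVec_nonneg {y : ι → ℝ} (hy : ∀ a, 0 ≤ (grounded ρ w *ᵥ y) a)
    (b : ι) : 0 ≤ y b := by
  by_contra! hb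
  obtain ⟨a, -, ha⟩ := Finset.exists_min_image Finset.univ y ⟨b, Finset.mem_univ b⟩
  have hya : y a < 0 := (ha b (Finset.mem_univ b)).trans_lt hb
  have key : ∀ c, y c = y a → ρ c ≠ c ∧ ∀ d, w c d < 0 → y d = y a := by
    intro c hc
    have h2 := mulVec_nonpos_of_forall_le h1 hneg (y := y) (a := c)
      fun d => hc ▸ ha d (Finset.mem_univ d)
    have h3 := hy c
    rw [grounded, add_mulVec, Pi.add_apply, mulVec_diagonal, rootVec, hc] at h3
    split_ifs at h3 with h
    · linarith [h2.1]
    · refine ⟨h, fun d hd => ?_⟩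
      rw [← hc]
      exact h2.2 (by linarith [h2.1]) d hd
  have h4 : y (ρ a) = y a := by
    refine (hconn a (ρ a) (hρ a).symm).of_forall (p := fun c => y c = y a) rfl fun c d hcd ih => ?_
    by_cases h : c = d
    · rw [← h, ih]
    · exact (key c ih).2 d (hcd h)
  exact (key _ h4).1 (hρ a)

include hρ h1 hneg hconn in
-- The minimum principle for `x` and `-x` gives invertibility. The entry of the null vector at `a`
-- is the determinant times the sum of the root values of `y`, the `a`-th column of the inverse.
-- Were it zero, the minimum `0` of `y ≥ 0` would propagate from the root `ρ a` to `a`, where `w y`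
-- equals one although it is nonpositive at a minimum.
theorem discr_ne_zero_of_real : discr ρ w ≠ 0 := by
  have hnn := @nonneg_of_grounded_mulVec_nonneg _ _ _ _ _ hρ h1 hneg hconn
  have hdet : (grounded ρ w).det ≠ 0 := by
    intro hdet
    obtain ⟨x, hx0, hx⟩ := exists_mulVec_eq_zero_iff.2 hdet
    apply hx0
    ext b
    have h2 := hnn (y := x) (fun a => by rw [hx, Pi.zero_apply]) b
    have h3 := hnn (y := -x) (fun a => by rw [mulVec_neg, hx, neg_zero, Pi.zero_apply]) b
    rw [Pi.neg_apply] at h3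
    rw [Pi.zero_apply]
    linarith
  refine mul_ne_zero hdet (Finset.prod_ne_zero_iff.2 fun a _ => ?_)
  let y : ι → ℝ := (grounded ρ w)⁻¹ *ᵥ Pi.single a 1
  have hNy : grounded ρ w *ᵥ y = Pi.single a 1 := by
    simp only [y]
    rw [mulVec_mulVec, mul_nonsing_inv _ hdet.isUnit, one_mulVec]
  have hy0 : ∀ b, 0 ≤ y b := hnn fun b => by
    rw [hNy, Pi.single_apply]
    split_ifs <;> norm_num
  have hz : leftNull ρ w a = (grounded ρ w).det * (rootVec ρ ℝ ⬝ᵥ y) := by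
    have h2 := congrArg (· ⬝ᵥ y) (leftNull_vecMul_grounded ρ w)
    rwa [← dotProduct_mulVec, hNy, dotProduct_single_one, smul_dotProduct, smul_eq_mul] at h2
  rw [hz]
  refine mul_ne_zero hdet fun h0 => ?_
  have hroot : y (ρ a) = 0 := by
    rw [dotProduct, Finset.sum_eq_zero_iff_of_nonneg] at h0
    · simpa [rootVec, hρ] using h0 (ρ a) (Finset.mem_univ _)
    · intro b _
      rw [rootVec]
      split_ifs
      · simpa using hy0 b
      · simp
  have key : ∀ c, y c = 0 → c ≠ a ∧ ∀ d, w c d < 0 → y d = 0 := by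
    intro c hc
    have h2 := mulVec_nonpos_of_forall_le h1 hneg (y := y) (a := c) fun d => hc ▸ hy0 d
    have h3 := congrFun hNy c
    rw [grounded, add_mulVec, Pi.add_apply, mulVec_diagonal, hc, mul_zero, add_zero,
      Pi.single_apply] at h3
    split_ifs at h3 with h
    · linarith [h2.1]
    · refine ⟨h, fun d hd => ?_⟩
      rw [h2.2 h3 d hd, hc]
  have h4 : y a = 0 := by
    refine (hconn (ρ a) a (hρ a)).of_forall (p := fun c => y c = 0) hroot fun c d hcd ih => ?_
    by_cases h : c = d
    · rw [← h, ih]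
    · exact (key c ih).2 d (hcd h)
  exact (key a h4).1 rfl

end Real

end Grounded

end NefMirror

namespace NefMirror
namespace MultipleMirrors

variable {n r : ℕ} (D : MultipleMirrors n r)

/-! ### Roots of the components of the graph -/

section Root

/-- A chosen vertex in the connected component of `a`. -/
def root (a : Fin r) : Fin r := Quot.out (D.graph.connectedComponentMk a)

theorem connectedComponentMk_root (a : Fin r) :
    D.graph.connectedComponentMk (D.root a) = D.graph.connectedComponentMk a := Quot.out_eq _

theorem root_eq_root_iff {a b : Fin r} :
    D.root a = D.root b ↔ D.graph.connectedComponentMk a = D.graph.connectedComponentMk b := by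
  constructor
  · intro h
    rw [← D.connectedComponentMk_root a, h, D.connectedComponentMk_root]
  · intro h
    rw [root, root, h]

theorem root_root (a : Fin r) : D.root (D.root a) = D.root a :=
  D.root_eq_root_iff.2 (D.connectedComponentMk_root a)

theorem card_root : Fintype.card {a // D.root a = a} = D.numComponents := by
  rw [numComponents, ← Nat.card_eq_fintype_card]
  refine Nat.card_congr (Equiv.ofBijective
    (fun a : {a // D.root a = a} => D.graph.connectedComponentMk a.1) ⟨?_, ?_⟩)
  · intro a b h
    apply Subtype.ext
    rw [← a.2, ← b.2]
    exact D.root_eq_root_iff.2 h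
  · intro c
    induction c using SimpleGraph.ConnectedComponent.ind with
    | _ a => exact ⟨⟨D.root a, D.root_root a⟩, D.connectedComponentMk_root a⟩

end Root

/-! ### The matrix whose row sums are the universal sections -/

section Matrices

open Matrix

open Classical in
/-- The indices of the terms that belong to `L⁽ⁱ⁾_a` and to the `b`-th bundle of the mirror. -/
def termFinset (i : Fin 2) (a b : Fin r) : Finset D.indexSet :=
  D.sectionFinset i a ∩ D.sectionFinset i.rev b

theorem mem_termFinset {i : Fin 2} {a b : Fin r} {x : D.indexSet} :
    x ∈ D.termFinset i a b ↔ x.1 ∈ D.sectionChars i a ∧ x.1 ∈ D.sectionChars i.rev b := by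
  rw [termFinset, Finset.mem_inter, mem_sectionFinset, mem_sectionFinset]

theorem termFinset_rev (i : Fin 2) (a b : Fin r) :
    D.termFinset i.rev a b = D.termFinset i b a := by
  ext x
  rw [mem_termFinset, mem_termFinset, Fin.rev_rev, and_comm]

theorem arrow_of_termFinset_nonempty {i : Fin 2} {a b : Fin r}
    (h : (D.termFinset i a b).Nonempty) : D.Arrow a b ∨ D.Arrow b a := by
  obtain ⟨x, hx⟩ := h
  rw [mem_termFinset] at hx
  fin_cases i
  · exact Or.inl ⟨x, hx.1, hx.2⟩
  · exact Or.inr ⟨x, hx.2, hx.1⟩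

theorem termFinset_eq_empty {i : Fin 2} {a b : Fin r} (h : D.root a ≠ D.root b) :
    D.termFinset i a b = ∅ := by
  by_contra hne
  apply h
  rw [root_eq_root_iff]
  rcases D.arrow_of_termFinset_nonempty (Finset.nonempty_iff_ne_empty.2 hne) with h | h
  · exact D.connectedComponentMk_eq_of_arrow h
  · exact (D.connectedComponentMk_eq_of_arrow h).symm

theorem exists_mem_sectionChars_rev {i : Fin 2} {a : Fin r} {x : Char n r}
    (h : x ∈ D.sectionChars i a) : ∃ b, x ∈ D.sectionChars i.rev b := by
  fin_cases i
  · exact D.exists_mem_sectionChars_one h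
  · exact D.exists_mem_sectionChars_zero h

theorem sum_termFinset {M : Type*} [AddCommMonoid M] (i : Fin 2) (a : Fin r)
    (f : D.indexSet → M) :
    ∑ b, ∑ x ∈ D.termFinset i a b, f x = ∑ x ∈ D.sectionFinset i a, f x := by
  classical
  rw [← Finset.sum_biUnion]
  · refine Finset.sum_congr ?_ fun _ _ => rfl
    ext x
    simp only [Finset.mem_biUnion, Finset.mem_univ, true_and, mem_termFinset, mem_sectionFinset]
    constructor
    · rintro ⟨b, h, -⟩
      exact h
    · intro h
      obtain ⟨b, hb⟩ := D.exists_mem_sectionChars_rev h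
      exact ⟨b, h, hb⟩
  · intro b _ c _ hbc
    refine Finset.disjoint_left.2 fun x hb hc => hbc ?_
    rw [mem_termFinset] at hb hc
    exact D.eq_of_mem_sectionChars hb.2 hc.2

/-- The matrix with row sums the universal sections, on the big torus of the `i`-th variety. -/
def baseMatrix (i : Fin 2) : Matrix (Fin r) (Fin r) D.BaseRing := fun a b =>
  ∑ x ∈ D.termFinset i a b, AddMonoidAlgebra.single x.1.1 (D.coeff x)

theorem baseMatrix_eq_zero {i : Fin 2} {a b : Fin r} (h : D.root a ≠ D.root b) :
    D.baseMatrix i a b = 0 := by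
  rw [baseMatrix, D.termFinset_eq_empty h, Finset.sum_empty]

theorem sum_baseMatrix (i : Fin 2) (a : Fin r) : ∑ b, D.baseMatrix i a b = D.sect i a :=
  D.sum_termFinset i a _

theorem map_baseMatrix_mulVec_one {S : Type*} [CommRing S] {i : Fin 2} (γ : D.BaseRing →+* S)
    (hγ : ∀ k, γ (D.sect i k) = 0) : (D.baseMatrix i).map γ *ᵥ 1 = 0 := by
  ext a
  simp only [mulVec, dotProduct, map_apply, Pi.one_apply, mul_one, Pi.zero_apply]
  rw [← map_sum, sum_baseMatrix, hγ]

theorem map_baseMatrix_eq_zero {S : Type*} [CommRing S] {i : Fin 2} (γ : D.BaseRing →+* S)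
    (a b : Fin r) (h : D.root a ≠ D.root b) : (D.baseMatrix i).map γ a b = 0 := by
  rw [map_apply, baseMatrix_eq_zero D h, map_zero]

end Matrices

/-! ### Specialization to a graph Laplacian -/

section Specialization

open Matrix

theorem exists_mem_sectionFinset_fst_eq_zero (i : Fin 2) (k : Fin r) :
    ∃ x ∈ D.sectionFinset i k, x.1.1 = 0 := by
  have hx : D.baseChar i 0 + (0, Pi.single k 1) ∈ D.sectionChars i k :=
    ⟨0, (D.Δ i).zero_mem_latticePoints k, rfl⟩
  exact ⟨⟨_, D.sectionChars_subset_indexSet i k hx⟩, D.mem_sectionFinset.2 hx, by simp [baseChar]⟩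

theorem exists_mem_sectionFinset (i : Fin 2) (x : D.indexSet) : ∃ k, x ∈ D.sectionFinset i k := by
  obtain ⟨a, b, ha, hb⟩ := D.exists_mem_sectionChars_inter x
  fin_cases i
  · exact ⟨a, D.mem_sectionFinset.2 ha⟩
  · exact ⟨b, D.mem_sectionFinset.2 hb⟩

/-- The bundle that an index belongs to. -/
def bundle (i : Fin 2) (x : D.indexSet) : Fin r := (D.exists_mem_sectionFinset i x).choose

theorem bundle_eq {i : Fin 2} {x : D.indexSet} {k : Fin r} (h : x ∈ D.sectionFinset i k) :
    D.bundle i x = k :=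
  D.eq_of_mem_sectionChars (D.mem_sectionFinset.1 (D.exists_mem_sectionFinset i x).choose_spec)
    (D.mem_sectionFinset.1 h)

/-- Coefficients for which the matrix is the Laplacian of the directed graph. -/
def laplaceCoeff (i : Fin 2) (x : D.indexSet) : ℝ :=
  open Classical in
  if x.1.1 = 0 then ((D.sectionFinset i (D.bundle i x)).card : ℝ) - 1 else -1

theorem laplaceCoeff_ne_zero (i : Fin 2) (x : D.indexSet) : D.laplaceCoeff i x ≠ 0 := by
  rw [laplaceCoeff]
  split_ifs with h
  · have : (1 : ℝ) < (D.sectionFinset i (D.bundle i x)).card := by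
      exact_mod_cast D.one_lt_card_sectionFinset i _
    exact (sub_pos.2 this).ne'
  · norm_num

theorem sum_laplaceCoeff (i : Fin 2) (k : Fin r) :
    ∑ x ∈ D.sectionFinset i k, D.laplaceCoeff i x = 0 := by
  classical
  obtain ⟨y, hy, hy0⟩ := D.exists_mem_sectionFinset_fst_eq_zero i k
  rw [← Finset.add_sum_erase _ _ hy]
  have h : ∀ x ∈ (D.sectionFinset i k).erase y, D.laplaceCoeff i x = -1 := by
    intro x hx
    rw [Finset.mem_erase] at hx
    rw [laplaceCoeff, if_neg]
    intro hx0
    apply hx.1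
    apply Subtype.ext
    exact D.ext_of_mem_sectionChars (D.mem_sectionFinset.1 hx.2) (D.mem_sectionFinset.1 hy)
      (hx0.trans hy0.symm)
  rw [Finset.sum_congr rfl h, Finset.sum_const, Finset.card_erase_of_mem hy, laplaceCoeff,
    if_pos hy0, D.bundle_eq hy, nsmul_eq_mul, Nat.cast_sub (D.one_lt_card_sectionFinset i k).le]
  push_cast
  ring

/-- The Laplacian of the directed graph. -/
def laplacian (i : Fin 2) : Matrix (Fin r) (Fin r) ℝ := fun a b =>
  ∑ x ∈ D.termFinset i a b, D.laplaceCoeff i x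

/-- The index over `m = 0` in `L_k` has type `(k, k)`, so off the diagonal all coefficients are
`-1`. -/
theorem laplacian_apply_of_ne {i : Fin 2} {a b : Fin r} (hab : a ≠ b) :
    D.laplacian i a b = -((D.termFinset i a b).card : ℝ) := by
  have h : ∀ x ∈ D.termFinset i a b, D.laplaceCoeff i x = -1 := by
    intro x hx
    rw [mem_termFinset, mem_sectionChars, mem_sectionChars] at hx
    rw [laplaceCoeff, if_neg]
    intro hx0
    have h1 := hx.1.2 b
    have h2 := hx.2.2 b
    rw [h1, hx0] at h2
    simp [hab] at h2
  rw [laplacian, Finset.sum_congr rfl h]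
  simp

/-- For the second nef-partition all arrows are reversed, which is harmless by strong connectivity.
-/
theorem reflTransGen_termFinset (i : Fin 2) {a b : Fin r} (h : D.root a = D.root b) :
    Relation.ReflTransGen (fun a b => (D.termFinset i a b).Nonempty) a b := by
  rw [root_eq_root_iff] at h
  have h1 := SimpleGraph.ConnectedComponent.exact h
  have h0 : ∀ a b, D.Arrow a b → (D.termFinset 0 a b).Nonempty := by
    rintro a b ⟨x, hx⟩
    exact ⟨⟨x, D.sectionChars_subset_indexSet 0 a hx.1⟩, D.mem_termFinset.2 hx⟩
  fin_cases i
  · exact Relation.ReflTransGen.mono h0 _ _ (D.reflTransGen_arrow_of_reachable h1)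
  · rw [← Relation.reflTransGen_swap]
    refine Relation.ReflTransGen.mono (fun a b hab => ?_) _ _
      (D.reflTransGen_arrow_of_reachable h1.symm)
    have := h0 a b hab
    rwa [← termFinset_rev] at this

theorem discr_laplacian_ne_zero (i : Fin 2) : discr D.root (D.laplacian i) ≠ 0 := by
  apply discr_ne_zero_of_real D.root_root
  · ext a
    simp only [mulVec, dotProduct, Pi.one_apply, mul_one, Pi.zero_apply, laplacian]
    rw [sum_termFinset, sum_laplaceCoeff]
  · intro a b hab
    rw [D.laplacian_apply_of_ne hab, neg_nonpos]
    exact Nat.cast_nonneg _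
  · intro a b hab
    refine Relation.ReflTransGen.mono (fun a b h hne => ?_) _ _ (D.reflTransGen_termFinset i hab)
    rw [D.laplacian_apply_of_ne hne, neg_lt_zero]
    exact_mod_cast h.card_pos

/-- The point of the big torus times `C` that gives the Laplacian. -/
def laplacePoint (i : Fin 2) : D.BaseRing →+* ℂ :=
  specialize (fun x => Units.mk0 (D.laplaceCoeff i x : ℂ)
    (Complex.ofReal_ne_zero.2 (D.laplaceCoeff_ne_zero i x))) 1

theorem laplacePoint_single (i : Fin 2) (m : Fin n → ℤ) (x : D.indexSet) :
    D.laplacePoint i (AddMonoidAlgebra.single m (D.coeff x)) = D.laplaceCoeff i x := by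
  rw [laplacePoint, coeff_eq, specialize_single_var]
  simp

/-- At the Laplacian point the equations of `Z⁽ⁱ⁾` hold while the function does not vanish; this is
what makes `Ω⁽ⁱ⁾` non-empty. -/
theorem discr_baseMatrix_notMem (i : Fin 2) :
    discr D.root (D.baseMatrix i) ∉ D.equationIdeal i := by
  intro h
  have hle : D.equationIdeal i ≤ RingHom.ker (D.laplacePoint i) := by
    rw [equationIdeal, Ideal.span_le]
    rintro _ ⟨k, rfl⟩
    rw [SetLike.mem_coe, RingHom.mem_ker, sect, map_sum]
    simp_rw [laplacePoint_single]
    rw [← Complex.ofReal_sum, sum_laplaceCoeff, Complex.ofReal_zero]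
  have h1 := hle h
  rw [RingHom.mem_ker, ← map_discr] at h1
  have h2 : (D.baseMatrix i).map (D.laplacePoint i) =
      (D.laplacian i).map (algebraMap ℝ ℂ) := by
    ext a b
    rw [map_apply, map_apply, baseMatrix, laplacian, map_sum, map_sum]
    simp_rw [laplacePoint_single]
    rfl
  rw [h2, map_discr, map_eq_zero] at h1
  exact D.discr_laplacian_ne_zero i h1

end Specialization

/-! ### The matrix `(W)` in fibre coordinates, and homomorphisms from functions on `T` -/

section Torus

open Matrix

/-- The matrix `(W)` for `i = 0` and its transpose for `i = 1`. -/
def torusMatrix (i : Fin 2) : Matrix (Fin r) (Fin r) D.TorusRing := fun a b =>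
  ∑ x ∈ D.termFinset i a b, AddMonoidAlgebra.single x.1 (D.coeff x)

theorem torusMatrix_rev (i : Fin 2) : D.torusMatrix i.rev = (D.torusMatrix i)ᵀ := by
  ext1 a b
  rw [transpose_apply, torusMatrix, torusMatrix, termFinset_rev]

theorem torusMatrix_zero : D.torusMatrix 0 = D.W := by
  ext1 a b
  rw [torusMatrix, W]
  refine (finsum_mem_eq_sum_of_inter_support_eq _ ?_).symm
  congr 1
  ext x
  exact D.mem_termFinset.symm

theorem torusMatrix_one : D.torusMatrix 1 = D.Wᵀ := by
  rw [← torusMatrix_zero, ← torusMatrix_rev]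
  rfl

/-- The coordinate of `T` on the fibres of `L⁽ⁱ⁾_a`. -/
def fibreCoord (a : Fin r) : D.TorusRingˣ where
  val := AddMonoidAlgebra.single (0, Pi.single a 1) 1
  inv := AddMonoidAlgebra.single (0, -Pi.single a 1) 1
  val_inv := by
    rw [AddMonoidAlgebra.single_mul_single, mul_one, Prod.mk_add_mk, add_zero, add_neg_cancel]
    rfl
  inv_val := by
    rw [AddMonoidAlgebra.single_mul_single, mul_one, Prod.mk_add_mk, add_zero, neg_add_cancel]
    rfl

/-- Both embeddings of `M` use the same `e_a`, so one set of fibre coordinates serves both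
nef-partitions. -/
theorem torusMatrix_apply (i : Fin 2) (a b : Fin r) :
    D.torusMatrix i a b = D.fibreCoord a * D.baseHom i (D.baseMatrix i a b) := by
  rw [torusMatrix, baseMatrix, map_sum, Finset.mul_sum]
  refine Finset.sum_congr rfl fun x hx => ?_
  rw [baseHom, AddMonoidAlgebra.mapDomainRingHom_apply, AddMonoidAlgebra.mapDomain_single,
    fibreCoord, Units.val_mk, AddMonoidAlgebra.single_mul_single, one_mul]
  congr 1
  rw [mem_termFinset] at hx
  obtain ⟨m, hm, hxm⟩ := hx.1
  have h1 : x.1.1 = m := by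
    rw [hxm]
    simp [baseChar]
  rw [h1, hxm, add_comm]

theorem fibreCoord_mul_sect (i : Fin 2) (b : Fin r) :
    (D.fibreCoord b : D.TorusRing) * D.baseHom i.rev (D.sect i.rev b) =
      ∑ a, D.fibreCoord a * D.baseHom i (D.baseMatrix i a b) := by
  rw [← sum_baseMatrix, map_sum, Finset.mul_sum]
  refine Finset.sum_congr rfl fun a _ => ?_
  rw [← torusMatrix_apply, torusMatrix_rev, transpose_apply, torusMatrix_apply]

/-- Every character is the image of its first component under `baseChar`, times a Laurent monomial
in the fibre coordinates. -/
theorem torus_hom_ext {S : Type*} [CommRing S] {f g : D.TorusRing →+* S} (i : Fin 2)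
    (h : f.comp (D.baseHom i) = g.comp (D.baseHom i))
    (h' : ∀ a, f (D.fibreCoord a) = g (D.fibreCoord a)) : f = g := by
  have hb : ∀ z, f (D.baseHom i z) = g (D.baseHom i z) := fun z => RingHom.congr_fun h z
  let F : (D.TorusRing →+* S) → (Fin r → ℤ) →+ Additive S := fun f =>
    { toFun := fun l => Additive.ofMul (f (AddMonoidAlgebra.single (0, l) 1))
      map_zero' := by
        rw [Prod.mk_zero_zero, ← AddMonoidAlgebra.one_def, map_one]
        rfl
      map_add' := fun l l' => by
        rw [← ofMul_mul, ← map_mul, AddMonoidAlgebra.single_mul_single, Prod.mk_add_mk, zero_add,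
          one_mul] }
  have hF : F f = F g := by
    apply AddMonoidHom.functions_ext
    intro a k
    have : (F f).comp (AddMonoidHom.single (fun _ : Fin r => ℤ) a) =
        (F g).comp (AddMonoidHom.single (fun _ : Fin r => ℤ) a) := AddMonoidHom.ext_int (h' a)
    exact DFunLike.congr_fun this k
  apply AddMonoidAlgebra.ringHom_ext
  · intro z
    have := hb (AddMonoidAlgebra.single 0 z)
    simpa [baseHom] using this
  · rintro ⟨m, l⟩
    have h1 : (AddMonoidAlgebra.single (m, l) 1 : D.TorusRing) =
        D.baseHom i (AddMonoidAlgebra.single m 1) *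
          AddMonoidAlgebra.single (0, l - (D.baseChar i m).2) 1 := by
      rw [baseHom, AddMonoidAlgebra.mapDomainRingHom_apply, AddMonoidAlgebra.mapDomain_single,
        AddMonoidAlgebra.single_mul_single, one_mul]
      congr 1
      ext j <;> simp [baseChar]
    rw [h1, map_mul, map_mul, hb]
    congr 1
    exact DFunLike.congr_fun hF (l - (D.baseChar i m).2)

/-- The homomorphism that is `γ` on the big torus and `τ` on the fibre coordinates. -/
def torusLift {S : Type*} [CommRing S] (i : Fin 2) (γ : D.BaseRing →+* S) (τ : Fin r → Sˣ) :
    D.TorusRing →+* S :=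
  AddMonoidAlgebra.liftNCRingHom (γ.comp (algebraMap D.CoeffRing D.BaseRing))
    { toFun := fun x => γ (AddMonoidAlgebra.single x.toAdd.1 1) *
        ((∏ k, τ k ^ (x.toAdd.2 k - (D.baseChar i x.toAdd.1).2 k) : Sˣ) : S)
      map_one' := by
        rw [toAdd_one, Prod.fst_zero, ← AddMonoidAlgebra.one_def, map_one, map_zero]
        simp
      map_mul' := fun x y => by
        rw [toAdd_mul, Prod.fst_add, map_add, ← one_mul (1 : D.CoeffRing),
          ← AddMonoidAlgebra.single_mul_single, map_mul, mul_mul_mul_comm, ← Units.val_mul,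
          ← Finset.prod_mul_distrib, one_mul]
        congr 2
        refine Finset.prod_congr rfl fun k _ => ?_
        rw [← _root_.zpow_add]
        congr 1
        simp only [Prod.snd_add, Pi.add_apply]
        ring }
    (fun _ _ => Commute.all _ _)

theorem torusLift_single {S : Type*} [CommRing S] (i : Fin 2) (γ : D.BaseRing →+* S)
    (τ : Fin r → Sˣ) (x : Char n r) (z : D.CoeffRing) :
    D.torusLift i γ τ (AddMonoidAlgebra.single x z) =
      γ (AddMonoidAlgebra.single 0 z) * (γ (AddMonoidAlgebra.single x.1 1) *
        ((∏ k, τ k ^ (x.2 k - (D.baseChar i x.1).2 k) : Sˣ) : S)) :=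
  AddMonoidAlgebra.liftNCRingHom_single ..

theorem torusLift_comp_baseHom {S : Type*} [CommRing S] (i : Fin 2) (γ : D.BaseRing →+* S)
    (τ : Fin r → Sˣ) : (D.torusLift i γ τ).comp (D.baseHom i) = γ := by
  have h : ∀ m z, D.torusLift i γ τ (D.baseHom i (AddMonoidAlgebra.single m z)) =
      γ (AddMonoidAlgebra.single m z) := by
    intro m z
    rw [baseHom, AddMonoidAlgebra.mapDomainRingHom_apply, AddMonoidAlgebra.mapDomain_single,
      torusLift_single]
    have h1 : (D.baseChar i m).1 = m := rfl
    simp only [h1, sub_self, zpow_zero, Finset.prod_const_one, Units.val_one, mul_one]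
    rw [← map_mul, AddMonoidAlgebra.single_mul_single, zero_add, mul_one]
  exact AddMonoidAlgebra.ringHom_ext (fun z => h 0 z) fun m => h m 1

theorem torusLift_baseHom {S : Type*} [CommRing S] (i : Fin 2) (γ : D.BaseRing →+* S)
    (τ : Fin r → Sˣ) (g : D.BaseRing) : D.torusLift i γ τ (D.baseHom i g) = γ g :=
  RingHom.congr_fun (D.torusLift_comp_baseHom i γ τ) g

theorem torusLift_fibreCoord {S : Type*} [CommRing S] (i : Fin 2) (γ : D.BaseRing →+* S)
    (τ : Fin r → Sˣ) (a : Fin r) : D.torusLift i γ τ (D.fibreCoord a) = τ a := by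
  rw [fibreCoord, Units.val_mk, torusLift_single]
  simp only [map_zero, Prod.snd_zero, Pi.zero_apply, sub_zero]
  rw [← AddMonoidAlgebra.one_def, map_one, one_mul, one_mul,
    Finset.prod_eq_single a]
  · rw [Pi.single_eq_same, zpow_one]
  · intro b _ hb
    rw [Pi.single_eq_of_ne hb, zpow_zero]
  · simp

end Torus

end MultipleMirrors
end NefMirror

namespace NefMirror
namespace MultipleMirrors

variable {n r : ℕ} (D : MultipleMirrors n r)

/-! ### `Ω⁽ⁱ⁾` as a basic open subset -/

section Image

open Matrix

/-- The function on the torus part of `Z⁽ⁱ⁾` that vanishes outside `Ω⁽ⁱ⁾`. -/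
def equationDiscr (i : Fin 2) : D.EquationRing i :=
  D.toEquationRing i (discr D.root (D.baseMatrix i))

theorem equationDiscr_ne_zero (i : Fin 2) : D.equationDiscr i ≠ 0 := fun h =>
  D.discr_baseMatrix_notMem i (D.toEquationRing_eq_zero_iff.1 h)

variable {S : Type*} [CommRing S]

theorem map_torusMatrix (i : Fin 2) (ψ : D.TorusRing →+* S) :
    (D.torusMatrix i).map ψ = diagonal (fun a => ψ (D.fibreCoord a)) *
      (D.baseMatrix i).map (ψ.comp (D.baseHom i)) := by
  ext a b
  rw [diagonal_mul, map_apply, map_apply, torusMatrix_apply, map_mul]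
  rfl

theorem fibreCoord_vecMul (i : Fin 2) (ψ : D.TorusRing →+* S) (b : Fin r) :
    ((fun a => ψ (D.fibreCoord a)) ᵥ* (D.baseMatrix i).map (ψ.comp (D.baseHom i))) b =
      ψ (D.fibreCoord b) * ψ (D.baseHom i.rev (D.sect i.rev b)) := by
  rw [← map_mul, fibreCoord_mul_sect, map_sum]
  simp only [vecMul, dotProduct, map_mul, map_apply, RingHom.comp_apply]

/-- The equations of the mirror are the column sums of the torus matrix up to units; they say that
the fibre coordinates form a left null vector. -/
theorem fibreCoord_vecMul_eq_zero_iff (i : Fin 2) (ψ : D.TorusRing →+* S) :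
    (fun a => ψ (D.fibreCoord a)) ᵥ* (D.baseMatrix i).map (ψ.comp (D.baseHom i)) = 0 ↔
      ∀ b, ψ (D.baseHom i.rev (D.sect i.rev b)) = 0 := by
  rw [funext_iff]
  refine forall_congr' fun b => ?_
  rw [fibreCoord_vecMul, Pi.zero_apply]
  exact ((D.fibreCoord b).isUnit.map ψ).mul_right_eq_zero

theorem rankAt_eq_rank_baseMatrix (i : Fin 2) (x : PrimeSpectrum D.TorusRing) :
    D.rankAt x = ((D.baseMatrix i).map
      ((algebraMap D.TorusRing x.asIdeal.ResidueField).comp (D.baseHom i))).rank := by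
  have h1 : D.rankAt x =
      ((D.torusMatrix i).map (algebraMap D.TorusRing x.asIdeal.ResidueField)).rank := by
    fin_cases i
    · exact congrArg (fun A : Matrix (Fin r) (Fin r) D.TorusRing =>
        (A.map (algebraMap D.TorusRing x.asIdeal.ResidueField)).rank) D.torusMatrix_zero.symm
    · refine Eq.trans ?_ (congrArg (fun A : Matrix (Fin r) (Fin r) D.TorusRing =>
        (A.map (algebraMap D.TorusRing x.asIdeal.ResidueField)).rank) D.torusMatrix_one.symm)
      rw [transpose_map, rank_transpose]
      rfl
  rw [h1, map_torusMatrix]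
  apply rank_mul_eq_right_of_isUnit_det
  rw [det_diagonal]
  exact IsUnit.prod_univ_iff.2 fun a => (D.fibreCoord a).isUnit.map _

theorem forall_fin_two_iff_rev {p : Fin 2 → Prop} (i : Fin 2) : (∀ j, p j) ↔ p i ∧ p i.rev := by
  rw [Fin.forall_fin_two]
  fin_cases i
  · exact Iff.rfl
  · exact and_comm

theorem equationIdeal_le_comap_iff (i : Fin 2) {ψ : D.BaseRing →+* S} {I : Ideal S} :
    D.equationIdeal i ≤ I.comap ψ ↔ ∀ k, ψ (D.sect i k) ∈ I := by
  rw [equationIdeal, Ideal.span_le]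
  exact Set.range_subset_iff

/-- Over both `Z⁽¹⁾` and `Z⁽²⁾` the fibre coordinates are a left null vector without zero entries,
so the rank condition becomes the non-vanishing of `discr`, a function pulled back from the base. -/
theorem mem_R_iff (i : Fin 2) (x : PrimeSpectrum D.TorusRing) :
    x ∈ D.R ↔ (∀ k, D.baseHom i (D.sect i k) ∈ x.asIdeal) ∧
      (∀ k, D.baseHom i.rev (D.sect i.rev k) ∈ x.asIdeal) ∧
      D.baseHom i (discr D.root (D.baseMatrix i)) ∉ x.asIdeal := by
  set ψ := algebraMap D.TorusRing x.asIdeal.ResidueField with hψ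
  have hmem : ∀ a, ψ a = 0 ↔ a ∈ x.asIdeal := fun a => Ideal.algebraMap_residueField_eq_zero
  have h1 : x ∈ D.R ↔ ((∀ k, D.baseHom i (D.sect i k) ∈ x.asIdeal) ∧
      ∀ k, D.baseHom i.rev (D.sect i.rev k) ∈ x.asIdeal) ∧
        D.rankAt x + D.numComponents = r := by
    refine and_congr ?_ Iff.rfl
    rw [forall_fin_two_iff_rev i, proj_mem_range_ι_iff, proj_mem_range_ι_iff,
      equationIdeal_le_comap_iff, equationIdeal_le_comap_iff]
  rw [h1, and_assoc]
  refine and_congr_right fun h2 => and_congr_right fun h3 => ?_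
  have hw := D.map_baseMatrix_eq_zero (i := i) (ψ.comp (D.baseHom i))
  have hone := D.map_baseMatrix_mulVec_one (i := i) (ψ.comp (D.baseHom i))
    fun k => (hmem _).2 (h2 k)
  have hd : ψ (D.baseHom i (discr D.root (D.baseMatrix i))) =
      discr D.root ((D.baseMatrix i).map (ψ.comp (D.baseHom i))) :=
    (map_discr D.root (D.baseMatrix i) (ψ.comp (D.baseHom i))).symm
  rw [← hmem, hd, rankAt_eq_rank_baseMatrix D i, ← card_root]
  constructor
  · intro h
    refine discr_ne_zero hw hone (t := fun a => ψ (D.fibreCoord a))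
      (fun a => ((D.fibreCoord a).isUnit.map ψ).ne_zero)
      ((D.fibreCoord_vecMul_eq_zero_iff i ψ).2 fun b => (hmem _).2 (h3 b)) ?_
    rw [Fintype.card_fin]
    exact h
  · intro h
    refine (rank_add_card_eq hw hone (isUnit_of_isUnit_discr (Ne.isUnit h)).ne_zero).trans ?_
    exact Fintype.card_fin r

/-- The torus homomorphism given by the left null vector. -/
def nullLift (i : Fin 2) (γ : D.BaseRing →+* S)
    (hu : IsUnit (γ (discr D.root (D.baseMatrix i)))) : D.TorusRing →+* S :=
  D.torusLift i γ fun a =>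
    (isUnit_leftNull_of_isUnit_discr (ρ := D.root) (w := (D.baseMatrix i).map γ)
      (by rwa [map_discr]) a).unit

variable {D} {i : Fin 2} {γ : D.BaseRing →+* S}
  {hu : IsUnit (γ (discr D.root (D.baseMatrix i)))}

theorem nullLift_fibreCoord (a : Fin r) :
    D.nullLift i γ hu (D.fibreCoord a) = leftNull D.root ((D.baseMatrix i).map γ) a :=
  (D.torusLift_fibreCoord i γ _ a).trans (IsUnit.unit_spec _)

theorem nullLift_comp_baseHom : (D.nullLift i γ hu).comp (D.baseHom i) = γ :=
  D.torusLift_comp_baseHom i γ _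

theorem nullLift_baseHom (g : D.BaseRing) : D.nullLift i γ hu (D.baseHom i g) = γ g :=
  D.torusLift_baseHom i γ _ g

theorem nullLift_baseHom_rev_sect (hγ : ∀ k, γ (D.sect i k) = 0) (b : Fin r) :
    D.nullLift i γ hu (D.baseHom i.rev (D.sect i.rev b)) = 0 := by
  refine (D.fibreCoord_vecMul_eq_zero_iff i _).1 ?_ b
  rw [nullLift_comp_baseHom, funext nullLift_fibreCoord]
  exact leftNull_vecMul (D.map_baseMatrix_eq_zero γ) (D.map_baseMatrix_mulVec_one γ hγ)

variable (D) (i)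

theorem equationInclusion_apply (q : PrimeSpectrum (D.EquationRing i)) :
    D.equationInclusion i q = (D.Δ i).torusInclusion D.CoeffRing
      (PrimeSpectrum.comap (D.toEquationRing i) q) := rfl

theorem proj_apply (x : PrimeSpectrum D.TorusRing) :
    D.proj i x = (D.Δ i).torusInclusion D.CoeffRing
      (PrimeSpectrum.comap (D.baseHom i) x) := by
  rw [proj_eq]
  rfl

theorem ι_torusChart_apply (q : PrimeSpectrum (D.EquationRing i)) :
    D.ι i (D.torusChart i q) = D.equationInclusion i q := by
  rw [← torusChart_ι]
  rfl

theorem Omega_eq : D.Omega i =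
    D.torusChart i '' {q : PrimeSpectrum (D.EquationRing i) | D.equationDiscr i ∉ q.asIdeal} := by
  ext z
  constructor
  · rintro ⟨x, hx, hz⟩
    obtain ⟨h1, -, h3⟩ := (D.mem_R_iff i x).1 hx
    obtain ⟨q, hq⟩ : PrimeSpectrum.comap (D.baseHom i) x ∈
        Set.range (PrimeSpectrum.comap (D.toEquationRing i)) := by
      rw [range_comap_of_surjective _ _ (D.toEquationRing_surjective i),
        ker_toEquationRing]
      exact (D.equationIdeal_le_comap_iff i).2 h1
    refine ⟨q, fun hmem => h3 ?_, (D.ι i).isClosedEmbedding.injective ?_⟩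
    · have h4 : discr D.root (D.baseMatrix i) ∈
          (PrimeSpectrum.comap (D.toEquationRing i) q).asIdeal := hmem
      rw [hq] at h4
      exact h4
    · rw [ι_torusChart_apply, ← hz, equationInclusion_apply, hq]
      exact (D.proj_apply i x).symm
  · suffices h : ∀ q : PrimeSpectrum (D.EquationRing i), D.equationDiscr i ∉ q.asIdeal →
        D.torusChart i q ∈ D.Omega i by
      rintro ⟨q, hq, rfl⟩
      exact h q hq
    intro q hq
    let γ := (algebraMap (D.EquationRing i) q.asIdeal.ResidueField).comp (D.toEquationRing i)
    have hu : IsUnit (γ (discr D.root (D.baseMatrix i))) :=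
      Ne.isUnit fun h => hq (Ideal.algebraMap_residueField_eq_zero.1 h)
    have hγ : ∀ k, γ (D.sect i k) = 0 := fun k => by
      rw [RingHom.comp_apply, toEquationRing_sect, map_zero]
    -- The lift of `q` to `T` whose fibre coordinates are the entries of the cofactor null vector at
    -- `q`.
    let x : PrimeSpectrum D.TorusRing := PrimeSpectrum.comap (D.nullLift i γ hu) ⊥
    have hx : ∀ a, a ∈ x.asIdeal ↔ D.nullLift i γ hu a = 0 := fun a => Iff.rfl
    refine ⟨x, (D.mem_R_iff i x).2 ⟨fun k => ?_, fun k => ?_, ?_⟩, ?_⟩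
    · rw [hx, nullLift_baseHom, hγ]
    · rw [hx, nullLift_baseHom_rev_sect hγ]
    · rw [hx, nullLift_baseHom]
      exact hu.ne_zero
    · rw [ι_torusChart_apply, equationInclusion_apply, proj_apply]
      refine congrArg _ (PrimeSpectrum.ext (Ideal.ext fun a => ?_))
      change D.nullLift i γ hu (D.baseHom i a) = 0 ↔ D.toEquationRing i a ∈ q.asIdeal
      rw [nullLift_baseHom]
      exact Ideal.algebraMap_residueField_eq_zero

theorem isOpen_Omega : IsOpen (D.Omega i) := by
  rw [Omega_eq]
  exact (D.torusChart i).isOpenEmbedding.isOpenMap _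
    (PrimeSpectrum.basicOpen (D.equationDiscr i)).isOpen

theorem dense_Omega : Dense (D.Omega i) := by
  apply (D.isOpen_Omega i).dense
  rw [Omega_eq]
  exact Set.Nonempty.image _ ⟨(⊥ : PrimeSpectrum (D.EquationRing i)), D.equationDiscr_ne_zero i⟩

end Image

end MultipleMirrors
end NefMirror

namespace NefMirror
namespace MultipleMirrors

variable {n r : ℕ} (D : MultipleMirrors n r)

/-! ### The isomorphism of `Ω⁽¹⁾` and `Ω⁽²⁾` over `C` -/

section Birational

open Matrix

/-- The ring of functions on `Ω⁽ⁱ⁾`. -/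
abbrev OmegaRing (i : Fin 2) : Type := Localization.Away (D.equationDiscr i)

/-- The restriction of functions from the torus times `C` to `Ω⁽ⁱ⁾`. -/
def toOmegaRing (i : Fin 2) : D.BaseRing →+* D.OmegaRing i :=
  (algebraMap (D.EquationRing i) (D.OmegaRing i)).comp (D.toEquationRing i)

theorem toOmegaRing_sect (i : Fin 2) (k : Fin r) : D.toOmegaRing i (D.sect i k) = 0 := by
  rw [toOmegaRing, RingHom.comp_apply, toEquationRing_sect, map_zero]

theorem isUnit_toOmegaRing_discr (i : Fin 2) :
    IsUnit (D.toOmegaRing i (discr D.root (D.baseMatrix i))) :=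
  IsLocalization.Away.algebraMap_isUnit (D.equationDiscr i)

theorem omegaRing_hom_ext {S : Type*} [CommRing S] {i : Fin 2} {f g : D.OmegaRing i →+* S}
    (h : f.comp (D.toOmegaRing i) = g.comp (D.toOmegaRing i)) : f = g := by
  apply IsLocalization.ringHom_ext (Submonoid.powers (D.equationDiscr i))
  rw [← RingHom.cancel_right (D.toEquationRing_surjective i)]
  exact h

theorem exists_omegaRing_lift {S : Type*} [CommRing S] {i : Fin 2} (u : D.BaseRing →+* S)
    (h : ∀ k, u (D.sect i k) = 0) (hu : IsUnit (u (discr D.root (D.baseMatrix i)))) :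
    ∃ f : D.OmegaRing i →+* S, f.comp (D.toOmegaRing i) = u := by
  let v : D.EquationRing i →+* S :=
    RingHom.liftOfSurjective (D.toEquationRing i) (D.toEquationRing_surjective i)
      ⟨u, by
        rw [ker_toEquationRing]
        exact (D.equationIdeal_le_comap_iff i (I := ⊥)).2 h⟩
  have hv : ∀ a, v (D.toEquationRing i a) = u a := fun a =>
    RingHom.liftOfRightInverse_comp_apply ..
  have hd : IsUnit (v (D.equationDiscr i)) := by
    rw [equationDiscr, hv]
    exact hu
  refine ⟨IsLocalization.Away.lift (D.equationDiscr i) hd, RingHom.ext fun a => ?_⟩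
  exact (IsLocalization.Away.lift_eq (D.equationDiscr i) hd _).trans (hv a)

/-- The homomorphism to the ring of functions on `Ω⁽ⁱ⁾` that defines a section of
`R⁽¹⁾ ∩ R⁽²⁾ → Ω⁽ⁱ⁾`. -/
def omegaLift (i : Fin 2) : D.TorusRing →+* D.OmegaRing i :=
  D.nullLift i (D.toOmegaRing i) (D.isUnit_toOmegaRing_discr i)

theorem omegaLift_comp_baseHom (i : Fin 2) :
    (D.omegaLift i).comp (D.baseHom i) = D.toOmegaRing i := nullLift_comp_baseHom

/-- On the section the base matrix of the mirror is the transposed one rescaled by the null vector,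
so `leftNull_eq_of_conj` applies: the section lies over the mirror `Ω` and is cut out there by the
same null vector. -/
theorem omegaLift_rev_discr (i : Fin 2) :
    IsUnit ((D.omegaLift i).comp (D.baseHom i.rev) (discr D.root (D.baseMatrix i.rev))) ∧
      leftNull D.root ((D.baseMatrix i.rev).map ((D.omegaLift i).comp (D.baseHom i.rev))) =
        leftNull D.root ((D.baseMatrix i).map (D.toOmegaRing i)) := by
  have hd : IsUnit (discr D.root ((D.baseMatrix i).map (D.toOmegaRing i))) := by
    rw [map_discr]
    exact D.isUnit_toOmegaRing_discr i
  have hf : ∀ a, D.omegaLift i (D.fibreCoord a) =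
      leftNull D.root ((D.baseMatrix i).map (D.toOmegaRing i)) a := nullLift_fibreCoord
  obtain ⟨h1, h2⟩ := leftNull_eq_of_conj (ρ := D.root)
    (w := (D.baseMatrix i).map (D.toOmegaRing i))
    (w' := (D.baseMatrix i.rev).map ((D.omegaLift i).comp (D.baseHom i.rev)))
    (D.map_baseMatrix_mulVec_one _ (D.toOmegaRing_sect i)) (D.map_baseMatrix_eq_zero _)
    (isUnit_leftNull_of_isUnit_discr hd) (isUnit_of_isUnit_discr hd) fun a b => by
      have h := congrArg (D.omegaLift i) (D.torusMatrix_apply i.rev a b)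
      rw [torusMatrix_rev, transpose_apply, torusMatrix_apply, map_mul, map_mul, hf, hf] at h
      rw [map_apply, map_apply, RingHom.comp_apply, ← h, mul_comm, ← omegaLift_comp_baseHom]
      rfl
  refine ⟨?_, h2⟩
  rw [← map_discr, discr, h1, h2]
  exact hd

/-- The section over `Ω⁽ⁱ⁾`, projected to the mirror side. Its compatibility with both sections
amounts to the equality of the two null vectors. -/
theorem exists_omegaRing_hom (i : Fin 2) : ∃ f : D.OmegaRing i.rev →+* D.OmegaRing i,
    f.comp (D.omegaLift i.rev) = D.omegaLift i := by
  obtain ⟨h1, h2⟩ := D.omegaLift_rev_discr i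
  obtain ⟨f, hf⟩ := D.exists_omegaRing_lift ((D.omegaLift i).comp (D.baseHom i.rev))
    (nullLift_baseHom_rev_sect (hu := D.isUnit_toOmegaRing_discr i) (D.toOmegaRing_sect i)) h1
  refine ⟨f, D.torus_hom_ext i.rev ?_ fun a => ?_⟩
  · rw [RingHom.comp_assoc, omegaLift_comp_baseHom, hf]
  · have h3 : D.omegaLift i (D.fibreCoord a) =
      leftNull D.root ((D.baseMatrix i).map (D.toOmegaRing i)) a := nullLift_fibreCoord a
    have h4 : D.omegaLift i.rev (D.fibreCoord a) =
      leftNull D.root ((D.baseMatrix i.rev).map (D.toOmegaRing i.rev)) a := nullLift_fibreCoord a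
    rw [RingHom.comp_apply, h3, h4, ← map_leftNull, ← h2, ← hf]
    rfl

/-- The composite fixes the section homomorphism, through which the functions on the base reach
`OmegaRing`. -/
theorem comp_eq_id_of_comp_omegaLift {i j : Fin 2} {f : D.OmegaRing j →+* D.OmegaRing i}
    {g : D.OmegaRing i →+* D.OmegaRing j} (hf : f.comp (D.omegaLift j) = D.omegaLift i)
    (hg : g.comp (D.omegaLift i) = D.omegaLift j) : f.comp g = RingHom.id _ := by
  apply D.omegaRing_hom_ext
  rw [← omegaLift_comp_baseHom, ← RingHom.comp_assoc, RingHom.comp_assoc _ _ f, hg, hf,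
    ← RingHom.comp_assoc, RingHom.id_comp]

theorem baseHom_algebraMap (i : Fin 2) (z : D.CoeffRing) :
    D.baseHom i (algebraMap D.CoeffRing D.BaseRing z) = algebraMap D.CoeffRing D.TorusRing z := by
  change D.baseHom i (AddMonoidAlgebra.single 0 z) = AddMonoidAlgebra.single 0 z
  rw [baseHom, AddMonoidAlgebra.mapDomainRingHom_apply, AddMonoidAlgebra.mapDomain_single, map_zero]

theorem omegaLift_algebraMap (i : Fin 2) :
    (D.omegaLift i).comp (algebraMap D.CoeffRing D.TorusRing) =
      (D.toOmegaRing i).comp (algebraMap D.CoeffRing D.BaseRing) := by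
  refine RingHom.ext fun z => ?_
  rw [RingHom.comp_apply, RingHom.comp_apply, ← omegaLift_comp_baseHom, RingHom.comp_apply,
    baseHom_algebraMap]

/-- The inclusion of `Ω⁽ⁱ⁾` in `Z⁽ⁱ⁾`. -/
def omegaChart (i : Fin 2) : Spec (CommRingCat.of (D.OmegaRing i)) ⟶ D.Z i :=
  Spec.map (CommRingCat.ofHom (algebraMap (D.EquationRing i) (D.OmegaRing i))) ≫ D.torusChart i

instance (i : Fin 2) : IsOpenImmersion (D.omegaChart i) :=
  haveI : IsOpenImmersion
      (Spec.map (CommRingCat.ofHom (algebraMap (D.EquationRing i) (D.OmegaRing i)))) :=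
    IsOpenImmersion.of_isLocalization (D.equationDiscr i)
  inferInstanceAs (IsOpenImmersion (_ ≫ _))

instance (i : Fin 2) : Nontrivial (D.OmegaRing i) :=
  (IsLocalization.isDomain_localization
    (powers_le_nonZeroDivisors_of_noZeroDivisors (D.equationDiscr_ne_zero i))).toNontrivial

theorem omegaChart_toCoeff (i : Fin 2) : D.omegaChart i ≫ D.toCoeff i =
    Spec.map (CommRingCat.ofHom ((D.omegaLift i).comp (algebraMap D.CoeffRing D.TorusRing))) := by
  rw [omegaChart, Category.assoc, torusChart_toCoeff, omegaLift_algebraMap, ← Spec.map_comp,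
    ← CommRingCat.ofHom_comp]
  rfl

theorem exists_omegaChart_iso :
    ∃ e : Spec (CommRingCat.of (D.OmegaRing 0)) ≅ Spec (CommRingCat.of (D.OmegaRing 1)),
      e.hom ≫ D.omegaChart 1 ≫ D.toCoeff 1 = D.omegaChart 0 ≫ D.toCoeff 0 := by
  obtain ⟨f, hf⟩ : ∃ f : D.OmegaRing 1 →+* D.OmegaRing 0,
    f.comp (D.omegaLift 1) = D.omegaLift 0 := D.exists_omegaRing_hom 0
  obtain ⟨g, hg⟩ : ∃ g : D.OmegaRing 0 →+* D.OmegaRing 1,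
    g.comp (D.omegaLift 0) = D.omegaLift 1 := D.exists_omegaRing_hom 1
  let ε : D.OmegaRing 1 ≃+* D.OmegaRing 0 := RingEquiv.ofRingHom f g
    (D.comp_eq_id_of_comp_omegaLift hf hg) (D.comp_eq_id_of_comp_omegaLift hg hf)
  refine ⟨Scheme.Spec.mapIso ε.toCommRingCatIso.op, ?_⟩
  rw [omegaChart_toCoeff, omegaChart_toCoeff, ← hf, RingHom.comp_assoc, CommRingCat.ofHom_comp _ f,
    Spec.map_comp]
  rfl

end Birational

theorem exists_birationalOver_fibres_toCoeff :
    ∃ U : D.coeffTorus.Opens, Dense (U : Set D.coeffTorus) ∧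
      ∀ c ∈ U, Scheme.BirationalOver ((D.toCoeff 0).fiberToSpecResidueField c)
        ((D.toCoeff 1).fiberToSpecResidueField c) := by
  obtain ⟨e, he⟩ := D.exists_omegaChart_iso
  exact exists_birationalOver_fibres (D.toCoeff 0) (D.toCoeff 1) (D.omegaChart 0) (D.omegaChart 1)
    e he

end MultipleMirrors
end NefMirror

end

theorem mainTheorem1 (n r : ℕ) (D : NefMirror.MultipleMirrors n r) :
    D.globalSectionChars 0 = D.globalSectionChars 1 ∧
    (∀ i : Fin 2, IrreducibleSpace (D.Z i) ∧ IsOpen (D.Omega i) ∧ Dense (D.Omega i)) ∧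
    ∃ U : D.coeffTorus.Opens, Dense (U : Set D.coeffTorus) ∧
      ∀ c ∈ U, Scheme.BirationalOver ((D.toCoeff 0).fiberToSpecResidueField c)
        ((D.toCoeff 1).fiberToSpecResidueField c) := by
  exact ⟨D.globalSectionChars_eq,
    fun i => ⟨inferInstance, D.isOpen_Omega i, D.dense_Omega i⟩,
    D.exists_birationalOver_fibres_toCoeff⟩
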